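/- Let $k$ be a field and let $G$ be a finite simple graph with vertex set $V$. **Definitions.** A simplicial complex $\Delta$ on $n$ vertices whose largest faces have $d$ vertices has codimension $c=n-d$. With $S=k[x_1,\dots,x_n]$ and $I_\Delta$ the Stanley–Reisner ideal, its *type defect* is $$\operatorname{td}(\Delta)=\dim_k \operatorname{Tor}^S_c(S/I_\Delta,k)-\dim_k \operatorname{Tor}^S_c(S/I_\Delta,k)_c-c ,$$ where the subscript $c$ on the second term denotes the component of degree $c$. A graph is viewed as the simplicial complex whose nonempty faces are its vertices and edges, and $\widetilde H_1(G)$ is its reduced simplicial homology with coefficients in $k$. A graph is *chordal* if it has no induced cycle of length at least $4$. A graph is *treeish* if it can be constructed recursively by the following rules: (a) an edge (two adjacent vertices) or a triangle is treeish; (b) if $H$ is treeish and $v$ is a vertex of $H$, then adding a new vertex $w$ and the edge $\{v,w\}$ gives a treeish graph; (c) if $H$ is treeish and $\{v,w\}$ is an edge of $H$, then adding a new vertex $z$ and the edges $\{v,z\}$ and $\{w,z\}$ gives a treeish graph. **Theorem.** Consider the conditions 1. $G$ is treeish; 2. $\operatorname{td}(G|_W)=0$ for every $W\subseteq V$ such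 that the induced subgraph $G|_W$ is connected (in particular nonempty); 3. $G$ is chordal, and the number of triangles of $G$ equals $\dim_k\widetilde H_1(G)$. If $G$ is connected and has at least one edge, then (1), (2) and (3) are equivalent. Moreover, for every finite simple graph $G$, (1) implies (2), and (2) and (3) are equivalent. -/

import Mathlib

universe u v

noncomputable section

namespace TypeDefect

/-! ### Simplicial complexes and graphs -/

section Complexes

variable {V : Type u}

/-- The number `d` such that the complex `Δ` is `(d - 1)`-dimensional, i.e. the largest number of
vertices of a face of `Δ`. -/
def maxFaceCard (Δ : AbstractSimplicialComplex V) : ℕ :=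
  sSup (Finset.card '' Δ.faces)

/-- The codimension `c = n - d` of a `(d - 1)`-dimensional complex on `n` vertices. (For a finite
vertex set `d ≤ n`, so the subtraction does not truncate.) -/
def codim (Δ : AbstractSimplicialComplex V) : ℕ :=
  Nat.card V - maxFaceCard Δ

/-- A simple graph viewed as a simplicial complex of dimension at most one: the nonempty faces are
the vertices and the edges. -/
def graphComplex (G : SimpleGraph V) : AbstractSimplicialComplex V where
  faces := {s | s.Nonempty ∧ s.card ≤ 2 ∧ G.IsClique (s : Set V)}
  isRelLowerSet_faces := fun s hs => by
    refine ⟨hs.1, fun t hts ht => ⟨ht, (Finset.card_le_card hts).trans hs.2.1, ?_⟩⟩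
    exact hs.2.2.subset (Finset.coe_subset.mpr hts)
  singleton_mem := fun v => by
    refine ⟨Finset.singleton_nonempty v, by simp, ?_⟩
    simp

end Complexes

/-! ### Alternating functions

The `p`-th exterior power of the free `k`-module on `V`, tensored with `M`, is realised for finite
`V` as the space of alternating functions `(Fin p → V) → M`: the element
`∑_{v₀ < ⋯ < v_{p-1}} e_{v₀} ∧ ⋯ ∧ e_{v_{p-1}} ⊗ m_{v₀ ⋯ v_{p-1}}` is the alternating function `f` with
`f (v₀, …, v_{p-1}) = m_{v₀ ⋯ v_{p-1}}`. No ordering of `V` has to be chosen. -/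

section Alternating

variable (k : Type v) [Field k] (V : Type u) (M : Type*) [AddCommGroup M] [Module k M]

/-- Functions on `p`-tuples that vanish on tuples with a repetition and are multiplied by the sign
of a permutation of the entries. -/
def alternatingFunctions (p : ℕ) : Submodule k ((Fin p → V) → M) where
  carrier := {f | (∀ x, ¬ Function.Injective x → f x = 0) ∧
    ∀ (σ : Equiv.Perm (Fin p)) (x), f (x ∘ σ) = (Equiv.Perm.sign σ : ℤ) • f x}
  zero_mem' := ⟨fun _ _ => rfl, fun _ _ => by simp⟩
  add_mem' := fun {f g} hf hg =>
    ⟨fun x hx => by simp [hf.1 x hx, hg.1 x hx], fun σ x => by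
      simp [hf.2 σ x, hg.2 σ x]⟩
  smul_mem' := fun a f hf =>
    ⟨fun x hx => by simp [hf.1 x hx], fun σ x => by
      rw [Pi.smul_apply, Pi.smul_apply, hf.2 σ x, smul_comm]⟩

end Alternating

/-! ### Reduced simplicial homology -/

section ReducedHomology

variable (k : Type v) [Field k] {V : Type u} [Fintype V]

/-- The oriented simplicial chains of `Δ` over `k` on faces with `p` vertices (so in homological
degree `p - 1`): alternating functions supported on the tuples whose entries form a face. The empty
set counts as a face, so that for `p = 0` this is the augmentation term `k`. -/
def simplicialChains (Δ : AbstractSimplicialComplex V) (p : ℕ) : Submodule k ((Fin p → V) → k) where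
  carrier := {f | f ∈ alternatingFunctions k V k p ∧
    ∀ x, f x ≠ 0 → ∀ s : Finset V, s.Nonempty → (s : Set V) = Set.range x → s ∈ Δ}
  zero_mem' := ⟨Submodule.zero_mem _, fun x hx => absurd rfl hx⟩
  add_mem' := fun {f g} hf hg => ⟨Submodule.add_mem _ hf.1 hg.1, fun x hx => by
    by_cases h : f x = 0
    · exact hg.2 x (fun h' => hx (by simp [h, h']))
    · exact hf.2 x h⟩
  smul_mem' := fun a f hf => ⟨Submodule.smul_mem _ a hf.1, fun x hx =>
    hf.2 x (fun h => hx (by simp [h]))⟩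

/-- The simplicial boundary `[v₀, …, v_p] ↦ ∑ᵢ (-1)ⁱ [v₀, …, v̂ᵢ, …, v_p]`; on coefficients it is
`(∂ f)(x₁, …, x_p) = ∑_w f (w, x₁, …, x_p)`. For `p = 0` it is the augmentation. -/
def simplicialBoundary (p : ℕ) : ((Fin (p + 1) → V) → k) →ₗ[k] ((Fin p → V) → k) where
  toFun f := fun x => ∑ w : V, f (Fin.cons w x)
  map_add' f g := by
    funext x
    simp [Finset.sum_add_distrib]
  map_smul' a f := by
    funext x
    simp [Finset.mul_sum]

/-- The `p`-cycles of the augmented oriented chain complex of `Δ`. -/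
def reducedCycles (Δ : AbstractSimplicialComplex V) (p : ℕ) :
    Submodule k ((Fin (p + 1) → V) → k) :=
  simplicialChains k Δ (p + 1) ⊓ LinearMap.ker (simplicialBoundary k p)

/-- The `p`-boundaries of the augmented oriented chain complex of `Δ`. -/
def reducedBoundaries (Δ : AbstractSimplicialComplex V) (p : ℕ) :
    Submodule k ((Fin (p + 1) → V) → k) :=
  (simplicialChains k Δ (p + 2)).map (simplicialBoundary k (p + 1))

/-- The reduced simplicial homology `H̃_p(Δ; k)`, for `p ≥ 0`. -/
abbrev ReducedHomology (Δ : AbstractSimplicialComplex V) (p : ℕ) : Type (max u v) :=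
  reducedCycles k Δ p ⧸ (reducedBoundaries k Δ p).submoduleOf (reducedCycles k Δ p)

end ReducedHomology

/-! ### Stanley–Reisner rings and Tor -/

section Tor

variable (k : Type v) [Field k] {V : Type u}

/-- The Stanley–Reisner ideal of `Δ` in `S = k[x_v : v ∈ V]`, generated by the squarefree monomials
of the non-faces. -/
def stanleyReisnerIdeal (Δ : AbstractSimplicialComplex V) : Ideal (MvPolynomial V k) :=
  Ideal.span {m | ∃ s : Finset V, s.Nonempty ∧ s ∉ Δ ∧ m = ∏ w ∈ s, MvPolynomial.X w}

variable {k}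

/-- The `S`-module `Tor_i^S(S/I, k)`, where `S = k[x_v : v ∈ V]` and `k` is the residue field
`S/(x_v : v ∈ V)`. -/
def torModule (I : Ideal (MvPolynomial V k)) (i : ℕ) : ModuleCat.{max u v} (MvPolynomial V k) :=
  ((CategoryTheory.Tor (ModuleCat.{max u v} (MvPolynomial V k)) i).obj
    (ModuleCat.of (MvPolynomial V k) (MvPolynomial V k ⧸ I))).obj
    (ModuleCat.of (MvPolynomial V k)
      (MvPolynomial V k ⧸ Ideal.span (Set.range (MvPolynomial.X : V → MvPolynomial V k))))

/-- `dim_k Tor_i^S(S/I, k)`. -/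
def torDim (I : Ideal (MvPolynomial V k)) (i : ℕ) : ℕ :=
  Module.finrank k
    ((ModuleCat.restrictScalars (algebraMap k (MvPolynomial V k))).obj (torModule I i))

/-! The grading on `Tor_i^S(S/I, k)`, for `I` a homogeneous ideal and `V` finite, is that of the
homology of `S/I ⊗_S F` for a graded free resolution `F` of `k`. We take for `F` the Koszul
complex on the variables, whose `p`-th term is `⋀^p S(-1)^V`. -/

/-- The degree `d` component of the graded ring `S/I`; it is zero for `d < 0`. -/
def quotientDegreePart (I : Ideal (MvPolynomial V k)) :
    ℤ → Submodule k (MvPolynomial V k ⧸ I)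
  | Int.ofNat d =>
      (MvPolynomial.homogeneousSubmodule V k d).map (Ideal.Quotient.mkₐ k I).toLinearMap
  | Int.negSucc _ => ⊥

/-- The degree `j` component of the `p`-th term `S/I ⊗ ⋀^p S(-1)^V` of the Koszul complex: a basis
element `e_{x₁} ∧ ⋯ ∧ e_{x_p}` has degree `p`, so its coefficient has degree `j - p`. -/
def koszulChains (I : Ideal (MvPolynomial V k)) (p j : ℕ) :
    Submodule k ((Fin p → V) → MvPolynomial V k ⧸ I) :=
  alternatingFunctions k V (MvPolynomial V k ⧸ I) p ⊓
    Submodule.pi Set.univ (fun _ => quotientDegreePart I ((j : ℤ) - (p : ℤ)))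

variable [Fintype V]

/-- The Koszul differential `e_{v₀} ∧ ⋯ ∧ e_{v_p} ↦ ∑ᵢ (-1)ⁱ x_{vᵢ} e_{v₀} ∧ ⋯ ê_{vᵢ} ⋯ ∧ e_{v_p}`;
on coefficients it is `(∂ f)(y) = ∑_w x_w f (w, y)`. -/
def koszulDifferential (I : Ideal (MvPolynomial V k)) (p : ℕ) :
    ((Fin (p + 1) → V) → MvPolynomial V k ⧸ I) →ₗ[k] ((Fin p → V) → MvPolynomial V k ⧸ I) where
  toFun f := fun y =>
    ∑ w : V, (MvPolynomial.X w : MvPolynomial V k) • f (Fin.cons w y)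
  map_add' f g := by
    funext y
    simp [Finset.sum_add_distrib]
  map_smul' a f := by
    funext y
    simp only [Pi.smul_apply, RingHom.id_apply, Finset.smul_sum]
    exact Finset.sum_congr rfl fun w _ => smul_comm _ _ _

/-- The cycles of degree `j` in the `p`-th term of the Koszul complex of `S/I`. -/
def koszulCycles (I : Ideal (MvPolynomial V k)) :
    (p j : ℕ) → Submodule k ((Fin p → V) → MvPolynomial V k ⧸ I)
  | 0, j => koszulChains I 0 j
  | p + 1, j => koszulChains I (p + 1) j ⊓ LinearMap.ker (koszulDifferential I p)

/-- The boundaries of degree `j` in the `p`-th term of the Koszul complex of `S/I`. -/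
def koszulBoundaries (I : Ideal (MvPolynomial V k)) (p j : ℕ) :
    Submodule k ((Fin p → V) → MvPolynomial V k ⧸ I) :=
  (koszulChains I (p + 1) j).map (koszulDifferential I p)

/-- The degree `j` component `Tor_i^S(S/I, k)_j`. -/
abbrev TorDegree (I : Ideal (MvPolynomial V k)) (i j : ℕ) : Type (max u v) :=
  koszulCycles I i j ⧸ (koszulBoundaries I i j).submoduleOf (koszulCycles I i j)

end Tor

/-! ### Modified type and type defect -/

section Defect

variable (k : Type v) [Field k] {V : Type u} [Fintype V]

/-- The modified type `dim Tor_c^S(S/I_Δ, k) - dim Tor_c^S(S/I_Δ, k)_c`, where `c = codim Δ`. -/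
def modifiedType (Δ : AbstractSimplicialComplex V) : ℤ :=
  (torDim (stanleyReisnerIdeal k Δ) (codim Δ) : ℤ) -
    (Module.finrank k (TorDegree (stanleyReisnerIdeal k Δ) (codim Δ) (codim Δ)) : ℤ)

/-- The type defect: the difference between the modified type and the codimension. -/
def typeDefect (Δ : AbstractSimplicialComplex V) : ℤ :=
  modifiedType k Δ - (codim Δ : ℤ)

end Defect

/-! ### Treeish graphs and chordal graphs -/

section Graphs

/-- The graph obtained from `G` by adding one new vertex (`none`) adjacent to exactly the vertices
in `N`. -/
def addVertex {V : Type u} (G : SimpleGraph V) (N : Set V) : SimpleGraph (Option V) where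
  Adj
    | some a, some b => G.Adj a b
    | some a, none => a ∈ N
    | none, some b => b ∈ N
    | none, none => False
  symm := by
    constructor
    rintro (_ | a) (_ | b) h
    exacts [h, h, h, SimpleGraph.Adj.symm (G := G) h]
  loopless := ⟨by
    rintro (_ | a) h
    exacts [h, G.irrefl h]⟩

/-- Treeish graphs, up to isomorphism. -/
inductive IsTreeish : {V : Type u} → SimpleGraph V → Prop
  /-- an edge is treeish -/
  | edge {V : Type u} {G : SimpleGraph V}
      (e : Nonempty (G ≃g (⊤ : SimpleGraph (Fin 2)))) : IsTreeish G
  /-- a triangle is treeish -/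
  | triangle {V : Type u} {G : SimpleGraph V}
      (e : Nonempty (G ≃g (⊤ : SimpleGraph (Fin 3)))) : IsTreeish G
  /-- add a new vertex `w` and an edge from `w` to a vertex `v` of a treeish graph -/
  | addPendant {V V' : Type u} {G : SimpleGraph V} {G' : SimpleGraph V'} (h : IsTreeish G)
      (v : V) (e : Nonempty (G' ≃g addVertex G {v})) : IsTreeish G'
  /-- add a new vertex `z` and edges from `z` to both ends of an edge of a treeish graph -/
  | addTriangle {V V' : Type u} {G : SimpleGraph V} {G' : SimpleGraph V'} (h : IsTreeish G)
      (v w : V) (hvw : G.Adj v w) (e : Nonempty (G' ≃g addVertex G {v, w})) : IsTreeish G'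

variable {V : Type u}

/-- A graph is chordal if it has no induced cycle of length at least four. -/
def IsChordal (G : SimpleGraph V) : Prop :=
  ∀ m : ℕ, 4 ≤ m → IsEmpty (SimpleGraph.cycleGraph m ↪g G)

/-- The number of triangles of `G`. -/
def numTriangles (G : SimpleGraph V) : ℕ :=
  {s : Finset V | G.IsNClique 3 s}.ncard

variable [Fintype V] (k : Type v) [Field k]

/-- Every connected induced subgraph of `G`, viewed as a simplicial complex, has type defect
zero. -/
def ConnectedInducedDefectZero (G : SimpleGraph V) : Prop :=
  ∀ W : Finset V, (G.induce (W : Set V)).Connected →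
    typeDefect k (graphComplex (G.induce (W : Set V))) = 0

/-- `G` is chordal, and its number of triangles is `dim_k H̃_1(G; k)`. -/
def ChordalWithTriangleCount (G : SimpleGraph V) : Prop :=
  IsChordal G ∧ numTriangles G = Module.finrank k (ReducedHomology k (graphComplex G) 1)

end Graphs

end TypeDefect

end

/-!
Let `n` be the number of vertices of `G`, `S = k[x_v : v ∈ V]` and `I` the Stanley–Reisner ideal.
The vanishing of the type defects of the connected induced subgraphs is equivalent to `G` being
chordal without `K₄`, and so is chordality together with the triangle count.

*The type defect.* For `G` connected and `n ≥ 3` the codimension is `n - 2`. The Koszul complex is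
self-dual: it can be written with `⋀^(n - p) S^V` in homological degree `p` and with the
differential `ω ∧ ·`, where `ω = ∑ x_v e_v`. Hence `Tor_{n-2}(S/I, k)` is the second cohomology of
`(S/I ⊗ ⋀ S^V, ω ∧ ·)`, the space of alternating families `g(u, w)` in `S/I` satisfying
`x_u g(v, w) - x_v g(u, w) + x_w g(u, v) = 0`, modulo coboundaries. Subtracting coboundaries, one
lowers the exponents of one variable after another until `g(u, w)` has only monomials dividing
`x_u x_w` (`IsTwoCocycle.exists_reduced`). What is left is
`g(u, w) = α(u, w) x_u x_w + β(u, w) x_w - β(w, u) x_u`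
with `α` antisymmetric and supported on the edges, and `β(u, ·)` constant on the
components of `G - u` (`IsTwoCocycle.exists_localCocycle`). Such a cocycle is a coboundary if and
only if `α` is the difference of a potential and every `β(u, ·)` is constant, which accounts for
`2 n - 1` dimensions. As `Tor_{n-2}(S/I, k)` vanishes in degree `n - 2`, the type defect is zero
exactly if the space of pairs `(α, β)` has dimension `3 n - 3`
(`typeDefect_graphComplex_eq_zero_iff`).

*From the dimension to the shape of the graph.* Attaching a vertex to a vertex or to an edge of a
connected graph raises the dimension of the space of pairs by `3`, so treeish graphs have type
defect zero. For a cycle of length `m ≥ 4` the dimension is too small, and for `K₄` it is too big;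
so if all connected induced subgraphs have type defect zero, `G` is chordal without `K₄`.
Conversely, by Dirac's theorem (`IsChordal.exists_isSimplicialIn`) a chordal graph has a vertex
whose neighbours form a clique.
In a connected graph without `K₄` on at least two vertices that clique is a vertex or an edge, and
removing such vertices one by one shows that a connected chordal graph without `K₄` is a single
vertex or treeish (`isTreeish_of_isChordal`). This applies to all connected induced subgraphs.

*Triangles.* Removing the edges at a vertex of degree `d ≥ 1` whose neighbours form a clique
lowers the number of triangles by `d (d - 1) / 2` and the dimension of `H̃₁` by `d - 1`. The
difference `(d - 1) (d - 2) / 2` is nonnegative, and it is zero exactly if `d ≤ 2`, that is, if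
the vertex lies in no `K₄`. So a chordal graph has as many triangles as `dim H̃₁` exactly if it
has no `K₄` (`IsChordal.numTriangles_eq_iff`).
-/

noncomputable section

namespace TypeDefect

open MvPolynomial CategoryTheory

/-! ### Division of polynomials by a monomial -/

section DivMonomial

variable {V : Type u} {k : Type v} [Field k]

lemma X_mul_divMonomial_single [DecidableEq V] {w v : V} (h : w ≠ v) (p : MvPolynomial V k) :
    (X w * p).divMonomial (Finsupp.single v 1) = X w * p.divMonomial (Finsupp.single v 1) := by
  ext m
  simp only [coeff_divMonomial, coeff_X_mul', Finsupp.mem_support_iff, Finsupp.add_apply,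
    Finsupp.single_apply, if_neg h.symm, zero_add]
  split_ifs with h1
  · congr 1
    ext t
    simp only [Finsupp.tsub_apply, Finsupp.add_apply, Finsupp.single_apply]
    split_ifs <;> simp_all
  · rfl

lemma zsmul_divMonomial (z : ℤ) (m : V →₀ ℕ) (p : MvPolynomial V k) :
    (z • p).divMonomial m = z • p.divMonomial m := by
  ext t
  simp only [coeff_divMonomial, coeff_smul]

lemma sum_divMonomial {ι : Type*} (s : Finset ι) (m : V →₀ ℕ) (p : ι → MvPolynomial V k) :
    (∑ i ∈ s, p i).divMonomial m = ∑ i ∈ s, (p i).divMonomial m := by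
  ext t
  simp only [coeff_divMonomial, coeff_sum]

end DivMonomial

/-! ### The exterior algebra with the differential `ω ∧ ·` -/

section KoszulTotal

lemma card_erase_add {V : Type u} [DecidableEq V] {p : ℕ} {s : Finset V} {w : V} (hw : w ∈ s) :
    (s.erase w).card + (p + 1) = s.card + p := by
  have := Finset.card_erase_add_one hw
  omega

variable {V : Type u} [Fintype V]

/-- The sign `-1` if `u` precedes `w` in an auxiliary linear order on `V`, and `1` otherwise. -/
def transSign (u w : V) : ℤ :=
  if Fintype.equivFin V u < Fintype.equivFin V w then -1 else 1

lemma transSign_self (u : V) : transSign u u = 1 := by simp [transSign]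

lemma transSign_swap {u w : V} (h : u ≠ w) : transSign u w = -transSign w u := by
  have h' : Fintype.equivFin V u ≠ Fintype.equivFin V w :=
    fun e => h ((Fintype.equivFin V).injective e)
  rcases lt_or_gt_of_ne h' with h1 | h1
  · simp [transSign, h1, h1.not_gt]
  · simp [transSign, h1, h1.not_gt]

lemma transSign_mul_self (u w : V) : transSign u w * transSign u w = 1 := by
  unfold transSign; split_ifs <;> norm_num

/-- The sign of `e_w ∧ e_{s \ {w}} = ± e_s`, for `w ∈ s`: the parity of the number of elements of
`s` that precede `w`. -/
def wedgeSign (w : V) (s : Finset V) : ℤ := ∏ u ∈ s, transSign u w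

lemma wedgeSign_mul_self (w : V) (s : Finset V) : wedgeSign w s * wedgeSign w s = 1 := by
  rw [wedgeSign, ← Finset.prod_mul_distrib]
  exact Finset.prod_eq_one fun u _ => transSign_mul_self u w

variable [DecidableEq V]

lemma wedgeSign_insert {u : V} (w : V) {s : Finset V} (h : u ∉ s) :
    wedgeSign w (insert u s) = transSign u w * wedgeSign w s :=
  Finset.prod_insert h

lemma wedgeSign_insert_self {w : V} {s : Finset V} (h : w ∉ s) :
    wedgeSign w (insert w s) = wedgeSign w s := by
  rw [wedgeSign_insert w h, transSign_self, one_mul]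

lemma wedgeSign_erase {u : V} (w : V) {s : Finset V} (h : u ∈ s) :
    wedgeSign w s = transSign u w * wedgeSign w (s.erase u) :=
  (Finset.mul_prod_erase s _ h).symm

/-- The sign rule behind `ω ∧ ω = 0`: removing two elements in either order gives opposite
signs. -/
lemma wedgeSign_mul_wedgeSign_erase {w w' : V} {s : Finset V} (hw : w ∈ s) (hw' : w' ∈ s)
    (hne : w ≠ w') :
    wedgeSign w s * wedgeSign w' (s.erase w) = -(wedgeSign w' s * wedgeSign w (s.erase w')) := by
  rw [wedgeSign_erase w hw', wedgeSign_erase w' hw, transSign_swap hne]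
  ring

variable (k : Type v) [Field k] (M : Type*) [AddCommGroup M] [Module (MvPolynomial V k) M]

/-- Multiplication by `ω = ∑_w x_w e_w` on `M ⊗ ⋀ S^V`. An element `∑_s f_s e_s` of the exterior
algebra, all degrees together, is encoded as the function `s ↦ f_s` on subsets of `V`. -/
def wedgeVars : (Finset V → M) →ₗ[MvPolynomial V k] (Finset V → M) where
  toFun f := fun s => ∑ w ∈ s, wedgeSign w s • (X w : MvPolynomial V k) • f (s.erase w)
  map_add' f g := by
    funext s
    simp [Finset.sum_add_distrib]
  map_smul' a f := by
    funext s
    simp only [Pi.smul_apply, RingHom.id_apply, Finset.smul_sum]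
    refine Finset.sum_congr rfl fun w _ => ?_
    rw [smul_comm (X w) a, smul_comm (wedgeSign w s) a]

variable {M}

lemma wedgeVars_apply (f : Finset V → M) (s : Finset V) :
    wedgeVars k M f s = ∑ w ∈ s, wedgeSign w s • (X w : MvPolynomial V k) • f (s.erase w) := rfl

lemma wedgeVars_wedgeVars (f : Finset V → M) : wedgeVars k M (wedgeVars k M f) = 0 := by
  funext s
  simp only [wedgeVars_apply, Finset.smul_sum, Pi.zero_apply]
  rw [Finset.sum_sigma' s (fun w => s.erase w)]
  refine Finset.sum_involution (fun x _ => ⟨x.2, x.1⟩) ?_ ?_ ?_ ?_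
  · rintro ⟨w, w'⟩ h
    simp only [Finset.mem_sigma, Finset.mem_erase] at h
    obtain ⟨hw, hne, hw'⟩ := h
    simp only
    rw [Finset.erase_right_comm (a := w')]
    have := wedgeSign_mul_wedgeSign_erase hw hw' (Ne.symm hne)
    rw [smul_comm (X w) (wedgeSign w' _), smul_comm (X w') (wedgeSign w _),
      smul_smul (wedgeSign w s), smul_smul (wedgeSign w' s), this,
      smul_comm (X w : MvPolynomial V k) (X w'), neg_smul, neg_add_cancel]
  · rintro ⟨w, w'⟩ h _ h2
    simp only [Finset.mem_sigma, Finset.mem_erase] at h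
    simp only [Sigma.mk.injEq] at h2
    exact h.2.1 h2.1
  · rintro ⟨w, w'⟩ h
    simp only [Finset.mem_sigma, Finset.mem_erase] at h ⊢
    exact ⟨h.2.2, Ne.symm h.2.1, h.1⟩
  · rintro ⟨w, w'⟩ h
    rfl

variable {k}

/-- Contraction with `e_v` followed by division by `x_v` (discarding the monomials that `x_v` does
not divide): a partial homotopy for `ω ∧ ·`. -/
def contractVar (v : V) (f : Finset V → MvPolynomial V k) : Finset V → MvPolynomial V k :=
  fun s => if v ∈ s then 0 else
    wedgeSign v (insert v s) • (f (insert v s)).divMonomial (Finsupp.single v 1)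

/-- A cocycle is cohomologous to one that is supported on the subsets containing `v` and has no
monomial divisible by `x_v`. -/
lemma sub_wedgeVars_contractVar (v : V) {f : Finset V → MvPolynomial V k}
    (hf : wedgeVars k _ f = 0) (s : Finset V) :
    f s - wedgeVars k _ (contractVar v f) s =
      if v ∈ s then (f s).modMonomial (Finsupp.single v 1) else 0 := by
  rw [wedgeVars_apply]
  split_ifs with hv
  · -- Only the summand `w = v` survives, and it is the part of `f s` divisible by `x_v`.
    rw [Finset.sum_eq_single_of_mem v hv]
    · rw [contractVar, if_neg (by simp), Finset.insert_erase hv, smul_comm (X v), smul_smul,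
        wedgeSign_mul_self, one_smul, smul_eq_mul]
      rw [sub_eq_iff_eq_add, modMonomial_add_divMonomial_single]
    · intro w _ hw
      rw [contractVar, if_pos (Finset.mem_erase.mpr ⟨hw.symm, hv⟩), smul_zero, smul_zero]
  · -- The cocycle condition at `s ∪ {v}`, divided by `x_v`, expresses `f s` by the other terms.
    have h := congrFun hf (insert v s)
    rw [wedgeVars_apply, Finset.sum_insert hv, Finset.erase_insert hv, Pi.zero_apply] at h
    have h2 := congrArg (fun p => p.divMonomial (Finsupp.single v 1)) h
    simp only [add_divMonomial, sum_divMonomial, zsmul_divMonomial, smul_eq_mul,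
      X_mul_divMonomial, zero_divMonomial] at h2
    have h3 : f s = -(wedgeSign v s • ∑ x ∈ s, wedgeSign x (insert v s) •
        (X x * f ((insert v s).erase x)).divMonomial (Finsupp.single v 1)) := by
      rw [wedgeSign_insert_self hv] at h2
      rw [← smul_neg, ← eq_neg_of_add_eq_zero_left h2, smul_smul, wedgeSign_mul_self, one_smul]
    rw [sub_eq_zero, h3, Finset.smul_sum, ← Finset.sum_neg_distrib]
    refine Finset.sum_congr rfl fun w hw => ?_
    have hwv : w ≠ v := fun e => hv (e ▸ hw)
    rw [X_mul_divMonomial_single hwv, contractVar, if_neg (by simp [hv]), smul_eq_mul,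
      mul_smul_comm, smul_smul, smul_smul, ← neg_smul, wedgeSign_insert _ hv,
      wedgeSign_insert_self (by simp [hv]), wedgeSign_erase v hw, transSign_swap hwv,
      Finset.erase_insert_of_ne hwv.symm]
    congr 1
    linear_combination (wedgeSign v (s.erase w) * wedgeSign w s) * transSign_mul_self v w

/-- Applying `sub_wedgeVars_contractVar` for each `v ∈ T` in turn, a cocycle becomes cohomologous
to one supported on the subsets containing `T`. -/
lemma exists_wedgeVars_eq (T : Finset V) {f : Finset V → MvPolynomial V k}
    (hf : wedgeVars k _ f = 0) :
    ∃ g f', f = wedgeVars k _ g + f' ∧ wedgeVars k _ f' = 0 ∧ ∀ v ∈ T, ∀ s, v ∉ s → f' s = 0 := by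
  induction T using Finset.induction_on with
  | empty => exact ⟨0, f, by simp, hf, by simp⟩
  | insert v T hv ih =>
    obtain ⟨g, f', h1, h2, h3⟩ := ih
    refine ⟨g + contractVar v f', f' - wedgeVars k _ (contractVar v f'), ?_, ?_, ?_⟩
    · rw [map_add, h1]; abel
    · rw [map_sub, h2, wedgeVars_wedgeVars, sub_zero]
    · intro t ht s hts
      rw [Pi.sub_apply, sub_wedgeVars_contractVar v h2]
      split_ifs with hvs
      · rcases Finset.mem_insert.mp ht with rfl | ht
        · exact absurd hvs hts
        · rw [h3 t ht s hts]
          ext m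
          by_cases hm : Finsupp.single v 1 ≤ m
          · rw [coeff_modMonomial_of_le _ hm, coeff_zero]
          · rw [coeff_modMonomial_of_not_le _ hm]
      · rfl

/-- Exactness of `ω ∧ ·` over `S` in all exterior degrees but the top one. -/
lemma exists_eq_wedgeVars_of_card_lt {f : Finset V → MvPolynomial V k}
    (hf : wedgeVars k _ f = 0) :
    ∃ g, ∀ s : Finset V, s.card < Fintype.card V → f s = wedgeVars k _ g s := by
  obtain ⟨g, f', h1, -, h3⟩ := exists_wedgeVars_eq Finset.univ hf
  refine ⟨g, fun s hs => ?_⟩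
  obtain ⟨v, hv⟩ : ∃ v, v ∉ s := by
    by_contra! h
    rw [Finset.eq_univ_iff_forall.mpr h, Finset.card_univ] at hs
    exact lt_irrefl _ hs
  rw [h1, Pi.add_apply, h3 v (Finset.mem_univ v) s hv, add_zero]

end KoszulTotal

/-! ### The Koszul complex and its exactness -/

section KoszulComplex

variable {V : Type u} [Fintype V]

variable (V) in
/-- The subsets of `V` whose complement has `p` elements: the index set of a basis of
`⋀^(n - p) S^V`, which is the term of homological degree `p` of the Koszul complex, written in its
self-dual form. The condition avoids truncated subtraction. -/
abbrev CoCard (p : ℕ) : Type u := {s : Finset V // s.card + p = Fintype.card V}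

section Defs
variable (k : Type v) [Field k] (M : Type*) [AddCommGroup M] [Module (MvPolynomial V k) M]

/-- Extension by zero from the subsets with `p`-element complement to all subsets. -/
def extendZero (p : ℕ) : (CoCard V p → M) →ₗ[MvPolynomial V k] (Finset V → M) where
  toFun f := fun s => if h : s.card + p = Fintype.card V then f ⟨s, h⟩ else 0
  map_add' f g := by
    funext s
    simp only [Pi.add_apply]
    split_ifs <;> simp
  map_smul' a f := by
    funext s
    simp only [Pi.smul_apply, RingHom.id_apply]
    split_ifs <;> simp

variable [DecidableEq V]

/-- The differential `⋀^(n - p - 1) → ⋀^(n - p)`, `f ↦ ω ∧ f`, of the Koszul complex with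
coefficients in `M`. -/
def koszulD (p : ℕ) : (CoCard V (p + 1) → M) →ₗ[MvPolynomial V k] (CoCard V p → M) where
  toFun f := fun s => wedgeVars k M (extendZero k M (p + 1) f) s.1
  map_add' f g := by
    funext s
    simp
  map_smul' a f := by
    funext s
    simp
end Defs

variable {k : Type v} [Field k] {M : Type*} [AddCommGroup M] [Module (MvPolynomial V k) M]

lemma extendZero_coe {p : ℕ} (f : CoCard V p → M) (s : CoCard V p) :
    extendZero k M p f s.1 = f s := by
  simp [extendZero, s.2]

lemma extendZero_of_ne {p : ℕ} (f : CoCard V p → M) {s : Finset V}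
    (h : s.card + p ≠ Fintype.card V) : extendZero k M p f s = 0 := by
  simp [extendZero, h]

variable (k V) in
/-- The ideal of `S` generated by the variables. -/
def irrelevantIdeal : Ideal (MvPolynomial V k) :=
  Ideal.span (Set.range (X : V → MvPolynomial V k))

variable (V) in
/-- The whole vertex set, the only subset with empty complement. -/
def topIdx : CoCard V 0 := ⟨Finset.univ, by simp⟩

instance : Subsingleton (CoCard V 0) := ⟨fun s t => by
  have h : ∀ s : CoCard V 0, s.1 = Finset.univ := fun s =>
    (Finset.card_eq_iff_eq_univ _).mp s.2
  exact Subtype.ext ((h s).trans (h t).symm)⟩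

variable (k V) in
/-- The augmentation of the Koszul complex onto the residue field. -/
def koszulAug : (CoCard V 0 → MvPolynomial V k) →ₗ[MvPolynomial V k]
    (MvPolynomial V k ⧸ irrelevantIdeal V k) :=
  (irrelevantIdeal V k).mkQ ∘ₗ LinearMap.proj (topIdx V)

lemma koszulAug_surjective : Function.Surjective (koszulAug V k) := by
  intro x
  obtain ⟨p, rfl⟩ := Submodule.mkQ_surjective _ x
  exact ⟨fun _ => p, rfl⟩

variable [DecidableEq V]

lemma koszulD_apply {p : ℕ} (f : CoCard V (p + 1) → M) (s : CoCard V p) :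
    koszulD k M p f s = wedgeVars k M (extendZero k M (p + 1) f) s.1 := rfl

/-- Extension by zero commutes with the differential. -/
lemma extendZero_koszulD {p : ℕ} (f : CoCard V (p + 1) → M) :
    extendZero k M p (koszulD k M p f) = wedgeVars k M (extendZero k M (p + 1) f) := by
  funext s
  by_cases h : s.card + p = Fintype.card V
  · exact extendZero_coe (k := k) (koszulD k M p f) ⟨s, h⟩
  · rw [extendZero_of_ne _ h, wedgeVars_apply]
    symm
    refine Finset.sum_eq_zero fun w hw => ?_
    rw [extendZero_of_ne _ (by rwa [card_erase_add hw]), smul_zero, smul_zero]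

lemma koszulD_koszulD {p : ℕ} (f : CoCard V (p + 2) → M) :
    koszulD k M p (koszulD k M (p + 1) f) = 0 := by
  funext s
  rw [koszulD_apply, extendZero_koszulD, wedgeVars_wedgeVars]
  rfl

lemma koszulD_restrict {p : ℕ} (g : Finset V → M) (s : CoCard V p) :
    koszulD k M p (fun t => g t.1) s = wedgeVars k M g s.1 := by
  rw [koszulD_apply, wedgeVars_apply, wedgeVars_apply]
  refine Finset.sum_congr rfl fun w hw => ?_
  rw [extendZero_coe (k := k) (fun t : CoCard V (p + 1) => g t.1)
    ⟨s.1.erase w, by rw [card_erase_add hw]; exact s.2⟩]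

lemma koszulD_exact {p : ℕ} {f : CoCard V (p + 1) → MvPolynomial V k}
    (hf : koszulD k (MvPolynomial V k) p f = 0) :
    ∃ g, koszulD k (MvPolynomial V k) (p + 1) g = f := by
  have h : wedgeVars k _ (extendZero k (MvPolynomial V k) (p + 1) f) = 0 := by
    rw [← extendZero_koszulD, hf, map_zero]
  obtain ⟨g, hg⟩ := exists_eq_wedgeVars_of_card_lt h
  refine ⟨fun t => g t.1, ?_⟩
  funext s
  rw [koszulD_restrict, ← hg s.1 (by have := s.2; omega), extendZero_coe]

/-- Exactness of the augmented Koszul complex in degree `0`: the image of the last differential is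
the ideal generated by the variables. -/
lemma koszulAug_eq_zero_iff (f : CoCard V 0 → MvPolynomial V k) :
    koszulAug V k f = 0 ↔ ∃ g, koszulD k (MvPolynomial V k) 0 g = f := by
  have hmem : koszulAug V k f = 0 ↔ f (topIdx V) ∈ irrelevantIdeal V k := by
    exact Ideal.Quotient.eq_zero_iff_mem
  rw [hmem]
  constructor
  · intro h
    rw [irrelevantIdeal, Ideal.span, Submodule.mem_span_range_iff_exists_fun] at h
    obtain ⟨c, hc⟩ := h
    refine ⟨fun t => ∑ w, if t.1 = Finset.univ.erase w then
      wedgeSign w Finset.univ • c w else 0, ?_⟩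
    funext s
    obtain rfl : s = topIdx V := Subsingleton.elim _ _
    rw [koszulD_restrict (fun t => ∑ w, if t = Finset.univ.erase w then
      wedgeSign w Finset.univ • c w else 0), wedgeVars_apply, ← hc]
    refine Finset.sum_congr rfl fun w _ => ?_
    have hinj : ∀ x, Finset.univ.erase w = Finset.univ.erase x ↔ x = w := fun x => by
      rw [Finset.erase_inj _ (Finset.mem_univ w)]; exact eq_comm
    change wedgeSign w Finset.univ • _ • (∑ x, if Finset.univ.erase w = Finset.univ.erase x then
      wedgeSign x Finset.univ • c x else 0) = _
    simp only [hinj, Finset.sum_ite_eq', Finset.mem_univ, if_true]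
    rw [smul_comm (X w), smul_smul, wedgeSign_mul_self, one_smul, smul_eq_mul, smul_eq_mul,
      mul_comm]
  · rintro ⟨g, rfl⟩
    rw [koszulD_apply, wedgeVars_apply]
    refine Submodule.sum_mem _ fun w _ => zsmul_mem ?_ _
    exact Ideal.mul_mem_right _ _ (Ideal.subset_span ⟨w, rfl⟩)

end KoszulComplex

/-! ### The Koszul resolution of the residue field -/

section Resolution

variable (V : Type u) [Fintype V] [DecidableEq V] (k : Type v) [Field k]

/-- The Koszul complex on the variables, with `⋀^(n - p) S^V` in homological degree `p`. -/
def koszulComplex : ChainComplex (ModuleCat.{max u v} (MvPolynomial V k)) ℕ :=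
  ChainComplex.of (fun p => ModuleCat.of _ (CoCard V p → MvPolynomial V k))
    (fun p => ModuleCat.ofHom (koszulD k (MvPolynomial V k) p))
    (fun p => by
      refine ModuleCat.hom_ext (LinearMap.ext fun f => ?_)
      exact koszulD_koszulD f)

lemma koszulComplex_d (p : ℕ) :
    (koszulComplex V k).d (p + 1) p = ModuleCat.ofHom (koszulD k (MvPolynomial V k) p) :=
  ChainComplex.of_d (fun p => ModuleCat.of (MvPolynomial V k) (CoCard V p → MvPolynomial V k))
    (fun p => ModuleCat.ofHom (koszulD k (MvPolynomial V k) p)) p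

/-- The augmentation as a map to the residue field, placed in degree `0`. -/
def koszulπ : koszulComplex V k ⟶ (ChainComplex.single₀ _).obj
    (ModuleCat.of (MvPolynomial V k) (MvPolynomial V k ⧸ irrelevantIdeal V k)) :=
  (ChainComplex.toSingle₀Equiv _ _).symm ⟨ModuleCat.ofHom (koszulAug V k), by
    rw [koszulComplex_d]
    refine ModuleCat.hom_ext (LinearMap.ext fun f => ?_)
    exact (koszulAug_eq_zero_iff _).mpr ⟨f, rfl⟩⟩

lemma koszulπ_f_zero : (koszulπ V k).f 0 = ModuleCat.ofHom (koszulAug V k) :=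
  ChainComplex.toSingle₀Equiv_symm_apply_f_zero _ _

lemma koszulComplex_exactAt_succ (p : ℕ) : (koszulComplex V k).ExactAt (p + 1) := by
  rw [HomologicalComplex.exactAt_iff' _ (p + 1 + 1) (p + 1) p (by simp) (by simp)]
  rw [ShortComplex.moduleCat_exact_iff]
  intro f hf
  dsimp only [HomologicalComplex.sc', HomologicalComplex.shortComplexFunctor'] at f hf ⊢
  rw [koszulComplex_d] at hf ⊢
  exact koszulD_exact hf

lemma koszulπ_quasiIso : QuasiIso (koszulπ V k) where
  quasiIsoAt n := by
    cases n with
    | zero =>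
      rw [ChainComplex.quasiIsoAt₀_iff, ShortComplex.quasiIso_iff_of_zeros']
      · constructor
        · rw [ShortComplex.moduleCat_exact_iff]
          intro f hf
          have h1 : ((koszulπ V k).f 0) f = 0 := hf
          have h2 : koszulAug V k f = 0 := by
            rw [koszulπ_f_zero] at h1
            exact h1
          obtain ⟨g, hg⟩ := (koszulAug_eq_zero_iff _).mp h2
          refine ⟨g, ?_⟩
          change ((koszulComplex V k).d 1 0) g = f
          rw [koszulComplex_d]
          exact hg
        · rw [ModuleCat.epi_iff_surjective]
          change Function.Surjective ((koszulπ V k).f 0)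
          rw [koszulπ_f_zero]
          exact koszulAug_surjective
      all_goals rfl
    | succ n =>
      rw [quasiIsoAt_iff_exactAt']
      · exact koszulComplex_exactAt_succ V k n
      · exact ChainComplex.exactAt_succ_single_obj _ _

/-- The Koszul complex as a projective resolution of the residue field. -/
def koszulResolution : ProjectiveResolution
    (ModuleCat.of (MvPolynomial V k) (MvPolynomial V k ⧸ irrelevantIdeal V k)) where
  complex := koszulComplex V k
  projective p := by
    change Projective (ModuleCat.of (MvPolynomial V k) (CoCard V p → MvPolynomial V k))
    rw [← IsProjective.iff_projective]
    infer_instance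
  π := koszulπ V k
  quasiIso := koszulπ_quasiIso V k

end Resolution

/-! ### Tor as Koszul homology -/

section TorKoszul

variable {V : Type u} [Fintype V] [DecidableEq V] {k : Type v} [Field k]

/-- The identification `M ⊗ S^ι ≃ M^ι` takes `M ⊗ koszulD` to the Koszul differential with
coefficients in `M`. -/
lemma koszulD_piScalarRight {M : Type*} [AddCommGroup M] [Module (MvPolynomial V k) M] (p : ℕ)
    (x : TensorProduct (MvPolynomial V k) M (CoCard V (p + 1) → MvPolynomial V k)) :
    koszulD k M p (TensorProduct.piScalarRight (MvPolynomial V k) (MvPolynomial V k) M _ x) =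
      TensorProduct.piScalarRight (MvPolynomial V k) (MvPolynomial V k) M _
        (LinearMap.lTensor M (koszulD k (MvPolynomial V k) p) x) := by
  induction x using TensorProduct.induction_on with
  | zero => simp
  | add x y hx hy => simp only [map_add, hx, hy]
  | tmul m f =>
    funext s
    simp only [LinearMap.lTensor_tmul, TensorProduct.piScalarRight_apply,
      TensorProduct.piScalarRightHom_tmul, koszulD_apply, wedgeVars_apply, Finset.sum_smul]
    refine Finset.sum_congr rfl fun w hw => ?_
    rw [zsmul_eq_mul, mul_smul, smul_assoc, ← Int.cast_smul_eq_zsmul (MvPolynomial V k)]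
    congr 2
    simp only [extendZero, LinearMap.coe_mk, AddHom.coe_mk]
    split_ifs <;> simp

variable (V k) in
/-- Three consecutive terms of the Koszul complex with coefficients in `M`, around
degree `p + 1`. -/
def koszulShort (M : Type (max u v)) [AddCommGroup M] [Module (MvPolynomial V k) M] (p : ℕ) :
    ShortComplex (ModuleCat.{max u v} (MvPolynomial V k)) :=
  ShortComplex.moduleCatMk (koszulD k M (p + 1)) (koszulD k M p)
    (LinearMap.ext fun f => koszulD_koszulD f)

/-- The same three terms of `M ⊗ koszulComplex V k` are those of the Koszul complex with
coefficients in `M`. -/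
def tensorKoszulShortIso (M : Type (max u v)) [AddCommGroup M] [Module (MvPolynomial V k) M]
    (p : ℕ) :
    ((((MonoidalCategory.tensoringLeft (ModuleCat.{max u v} (MvPolynomial V k))).obj
      (ModuleCat.of _ M)).mapHomologicalComplex _).obj (koszulComplex V k)).sc' (p + 2) (p + 1) p ≅
      koszulShort V k M p :=
  ShortComplex.isoMk
    (TensorProduct.piScalarRight (MvPolynomial V k) (MvPolynomial V k) M _).toModuleIso
    (TensorProduct.piScalarRight (MvPolynomial V k) (MvPolynomial V k) M _).toModuleIso
    (TensorProduct.piScalarRight (MvPolynomial V k) (MvPolynomial V k) M _).toModuleIso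
    (by
      refine ModuleCat.hom_ext (LinearMap.ext fun x => ?_)
      refine (koszulD_piScalarRight (p + 1) x).trans ?_
      change _ = TensorProduct.piScalarRight (MvPolynomial V k) (MvPolynomial V k) M _
        (LinearMap.lTensor M (((koszulComplex V k).d (p + 1 + 1) (p + 1)).hom) x)
      rw [koszulComplex_d]
      rfl)
    (by
      refine ModuleCat.hom_ext (LinearMap.ext fun x => ?_)
      refine (koszulD_piScalarRight p x).trans ?_
      change _ = TensorProduct.piScalarRight (MvPolynomial V k) (MvPolynomial V k) M _
        (LinearMap.lTensor M (((koszulComplex V k).d (p + 1) p).hom) x)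
      rw [koszulComplex_d]
      rfl)

/-- The Koszul differential as a map into the cycles of degree `p + 1`. -/
def koszulToCycles (M : Type*) [AddCommGroup M] [Module (MvPolynomial V k) M] (p : ℕ) :
    (CoCard V (p + 2) → M) →ₗ[MvPolynomial V k] LinearMap.ker (koszulD (V := V) k M p) :=
  (koszulD k M (p + 1)).codRestrict _ fun f => koszulD_koszulD f

/-- `Tor_{p+1}(S/I, k)` is the homology of the Koszul complex with coefficients in `S/I`. -/
def torModuleIso (I : Ideal (MvPolynomial V k)) (p : ℕ) :
    torModule I (p + 1) ≅ ModuleCat.of (MvPolynomial V k)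
      (LinearMap.ker (koszulD (V := V) k (MvPolynomial V k ⧸ I) p) ⧸
        LinearMap.range (koszulToCycles (V := V) (k := k) (MvPolynomial V k ⧸ I) p)) :=
  (koszulResolution V k).isoLeftDerivedObj
      ((MonoidalCategory.tensoringLeft (ModuleCat.{max u v} (MvPolynomial V k))).obj
        (ModuleCat.of _ (MvPolynomial V k ⧸ I))) (p + 1) ≪≫
    ShortComplex.homologyMapIso
      (HomologicalComplex.isoSc' _ (p + 2) (p + 1) p (by simp) (by simp)) ≪≫
    ShortComplex.homologyMapIso (tensorKoszulShortIso (MvPolynomial V k ⧸ I) p) ≪≫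
    (koszulShort V k (MvPolynomial V k ⧸ I) p).moduleCatHomologyIso

/-- A way to compute `dim Tor_{p+1}(S/I, k)`: a space `X` of cycles `L x` that meets every homology
class, modulo the subspace `Y` of those that are boundaries. -/
lemma torDim_succ_eq (I : Ideal (MvPolynomial V k)) (p : ℕ)
    {X : Type*} [AddCommGroup X] [Module k X]
    (L : X →ₗ[k] (CoCard V (p + 1) → MvPolynomial V k ⧸ I)) (Y : Submodule k X)
    (h1 : ∀ x, koszulD k (MvPolynomial V k ⧸ I) p (L x) = 0)
    (h2 : ∀ f, koszulD k (MvPolynomial V k ⧸ I) p f = 0 →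
      ∃ x g, f = L x + koszulD k (MvPolynomial V k ⧸ I) (p + 1) g)
    (h3 : ∀ x, (∃ g, koszulD k (MvPolynomial V k ⧸ I) (p + 1) g = L x) ↔ x ∈ Y) :
    torDim I (p + 1) = Module.finrank k (X ⧸ Y) := by
  let F := ModuleCat.restrictScalars.{max u v} (algebraMap k (MvPolynomial V k))
  let Q := ModuleCat.of (MvPolynomial V k)
      (LinearMap.ker (koszulD (V := V) k (MvPolynomial V k ⧸ I) p) ⧸
        LinearMap.range (koszulToCycles (V := V) (k := k) (MvPolynomial V k ⧸ I) p))
  have e : torDim I (p + 1) = Module.finrank k (F.obj Q) :=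
    (F.mapIso (torModuleIso I p)).toLinearEquiv.finrank_eq
  rw [e]
  let π := (LinearMap.range (koszulToCycles (V := V) (k := k) (MvPolynomial V k ⧸ I) p)).mkQ
  let Φ : X →ₗ[k] F.obj Q :=
    { toFun := fun x => π ⟨L x, h1 x⟩
      map_add' := fun x y => by
        refine Eq.trans (congrArg π (Subtype.ext ?_)) (map_add π ⟨L x, h1 x⟩ ⟨L y, h1 y⟩)
        exact map_add L x y
      map_smul' := fun c x => by
        refine Eq.trans (congrArg π (Subtype.ext ?_))
          (map_smul π (algebraMap k (MvPolynomial V k) c) ⟨L x, h1 x⟩)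
        refine (map_smul L c x).trans ?_
        exact (algebraMap_smul (MvPolynomial V k) c (L x)).symm }
  have hker : LinearMap.ker Φ = Y := by
    ext x
    rw [← h3 x, LinearMap.mem_ker]
    refine (Submodule.Quotient.mk_eq_zero
      (LinearMap.range (koszulToCycles (V := V) (k := k) (MvPolynomial V k ⧸ I) p))
      (x := ⟨L x, h1 x⟩)).trans ?_
    constructor
    · rintro ⟨g, hg⟩
      exact ⟨g, congrArg Subtype.val hg⟩
    · rintro ⟨g, hg⟩
      exact ⟨g, Subtype.ext hg⟩
  have hsurj : Function.Surjective Φ := by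
    intro q
    obtain ⟨⟨f, hf⟩, rfl⟩ := Submodule.Quotient.mk_surjective _ q
    obtain ⟨x, g, hfg⟩ := h2 f hf
    refine ⟨x, (Submodule.Quotient.eq _).mpr ⟨-g, Subtype.ext ?_⟩⟩
    change koszulD k (MvPolynomial V k ⧸ I) (p + 1) (-g) = L x - f
    rw [hfg, map_neg]
    abel
  rw [← hker]
  exact (Φ.quotKerEquivOfSurjective hsurj).finrank_eq.symm

end TorKoszul

/-! ### Coefficients in the Stanley–Reisner ring of a graph -/

section FaceMonomials

variable {V : Type u} (G : SimpleGraph V) (k : Type v) [Field k]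

/-- The Stanley–Reisner ring of a graph. -/
abbrev GraphRing : Type (max u v) :=
  MvPolynomial V k ⧸ stanleyReisnerIdeal k (graphComplex G)

/-- The exponents of the monomials that are nonzero in the Stanley–Reisner ring of `G`: the support
is empty, a vertex or an edge. -/
def IsFaceExponent (m : V →₀ ℕ) : Prop :=
  m.support.card ≤ 2 ∧ G.IsClique (m.support : Set V)

variable {G}

lemma IsFaceExponent.mono {m m' : V →₀ ℕ} (h : IsFaceExponent G m)
    (hs : m'.support ⊆ m.support) : IsFaceExponent G m' :=
  ⟨(Finset.card_le_card hs).trans h.1, h.2.subset (Finset.coe_subset.mpr hs)⟩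

lemma isFaceExponent_zero : IsFaceExponent G (0 : V →₀ ℕ) := by
  simp [IsFaceExponent]

lemma isFaceExponent_single (v : V) (n : ℕ) : IsFaceExponent G (Finsupp.single v n) := by
  have h : (Finsupp.single v n).support ⊆ {v} := Finsupp.support_single_subset
  refine ⟨(Finset.card_le_card h).trans (by simp), ?_⟩
  refine Set.Pairwise.mono (Finset.coe_subset.mpr h) ?_
  simp

lemma isFaceExponent_pair {u w : V} (h : G.Adj u w) :
    IsFaceExponent G (Finsupp.single u 1 + Finsupp.single w 1) := by
  classical
  have hs : (Finsupp.single u 1 + Finsupp.single w 1 : V →₀ ℕ).support ⊆ {u, w} := by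
    refine Finsupp.support_add.trans (Finset.union_subset ?_ ?_)
    · exact Finsupp.support_single_subset.trans (by simp)
    · exact Finsupp.support_single_subset.trans (by simp)
  refine ⟨(Finset.card_le_card hs).trans Finset.card_le_two, ?_⟩
  refine Set.Pairwise.mono (Finset.coe_subset.mpr hs) ?_
  rw [Finset.coe_pair, Set.pairwise_pair]
  exact fun _ => ⟨h, h.symm⟩

variable {k}

/-- The Stanley–Reisner ideal consists of the polynomials all of whose monomials are supported on
non-faces. -/
lemma mem_stanleyReisnerIdeal_iff (p : MvPolynomial V k) :
    p ∈ stanleyReisnerIdeal k (graphComplex G) ↔ ∀ m, IsFaceExponent G m → p.coeff m = 0 := by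
  classical
  have hgen : {q : MvPolynomial V k | ∃ s : Finset V, s.Nonempty ∧ s ∉ graphComplex G ∧
      q = ∏ w ∈ s, X w} = (fun m => monomial m (1 : k)) ''
        {m | ∃ s : Finset V, s.Nonempty ∧ s ∉ graphComplex G ∧
          m = ∑ w ∈ s, Finsupp.single w 1} := by
    have hp : ∀ s : Finset V, ∏ w ∈ s, (X w : MvPolynomial V k) =
        monomial (∑ w ∈ s, Finsupp.single w 1) 1 := fun s => by
      rw [monomial_sum_one]; rfl
    ext q
    simp only [Set.mem_ofPred_eq, Set.mem_image, hp]
    constructor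
    · rintro ⟨s, h1, h2, rfl⟩
      exact ⟨_, ⟨s, h1, h2, rfl⟩, rfl⟩
    · rintro ⟨m, ⟨s, h1, h2, rfl⟩, rfl⟩
      exact ⟨s, h1, h2, rfl⟩
  have hface : ∀ s : Finset V, s ∈ graphComplex G ↔
      s.Nonempty ∧ s.card ≤ 2 ∧ G.IsClique (s : Set V) := fun s => Iff.rfl
  have hle : ∀ (s : Finset V) (m : V →₀ ℕ), ∑ w ∈ s, Finsupp.single w 1 ≤ m ↔ s ⊆ m.support := by
    intro s m
    have hval : ∀ t, (∑ w ∈ s, Finsupp.single w 1 : V →₀ ℕ) t = if t ∈ s then 1 else 0 := by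
      intro t
      simp [Finsupp.finsetSum_apply, Finsupp.single_apply]
    constructor
    · intro h t ht
      have := h t
      rw [hval, if_pos ht] at this
      exact Finsupp.mem_support_iff.mpr (by omega)
    · intro h t
      rw [hval]
      split_ifs with ht
      · have := Finsupp.mem_support_iff.mp (h ht)
        omega
      · exact Nat.zero_le _
  rw [stanleyReisnerIdeal, hgen, mem_ideal_span_monomial_image]
  constructor
  · intro h m hm
    by_contra hc
    obtain ⟨_, ⟨s, h1, h2, rfl⟩, h3⟩ := h m (mem_support_iff.mpr hc)
    rw [hle] at h3
    exact h2 ((hface s).mpr ⟨h1, (Finset.card_le_card h3).trans hm.1,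
      hm.2.subset (Finset.coe_subset.mpr h3)⟩)
  · intro h m hm
    have hnf : ¬ IsFaceExponent G m := fun hf => mem_support_iff.mp hm (h m hf)
    refine ⟨_, ⟨m.support, ?_, ?_, rfl⟩, (hle _ _).mpr subset_rfl⟩
    · rw [Finset.nonempty_iff_ne_empty]
      intro he
      refine hnf ?_
      rw [Finsupp.support_eq_empty.mp he]
      exact isFaceExponent_zero
    · intro hf
      exact hnf ((hface _).mp hf).2

open Classical in
variable (G k) in
/-- The coefficients of an element of the Stanley–Reisner ring in its basis of monomials supported
on faces; the value at every other exponent is `0`. The chosen lift to a polynomial does not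
matter, by `faceCoeff_mk`. -/
def faceCoeff : GraphRing G k →ₗ[k] ((V →₀ ℕ) → k) where
  toFun a := fun m => if IsFaceExponent G m then
    (Function.surjInv (Ideal.Quotient.mk_surjective (I := stanleyReisnerIdeal k (graphComplex G)))
      a).coeff m else 0
  map_add' a b := by
    funext m
    simp only [Pi.add_apply]
    split_ifs with hm
    · rw [← coeff_add, ← sub_eq_zero, ← coeff_sub]
      refine (mem_stanleyReisnerIdeal_iff _).mp ?_ m hm
      rw [← Ideal.Quotient.eq_zero_iff_mem, map_sub, map_add]
      simp only [Function.surjInv_eq, sub_self]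
    · simp
  map_smul' c a := by
    funext m
    simp only [Pi.smul_apply, RingHom.id_apply]
    split_ifs with hm
    · rw [← coeff_smul, ← sub_eq_zero, ← coeff_sub]
      refine (mem_stanleyReisnerIdeal_iff _).mp ?_ m hm
      rw [← Ideal.Quotient.eq_zero_iff_mem, map_sub, smul_eq_C_mul, map_mul]
      simp only [Function.surjInv_eq]
      obtain ⟨p, rfl⟩ := Ideal.Quotient.mk_surjective a
      rw [sub_eq_zero, ← map_mul, ← smul_eq_C_mul]
      rfl
    · simp

open Classical in
lemma faceCoeff_mk (p : MvPolynomial V k) (m : V →₀ ℕ) :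
    faceCoeff G k (Ideal.Quotient.mk _ p) m = if IsFaceExponent G m then p.coeff m else 0 := by
  simp only [faceCoeff, LinearMap.coe_mk, AddHom.coe_mk]
  split_ifs with hm
  · rw [← sub_eq_zero, ← coeff_sub]
    refine (mem_stanleyReisnerIdeal_iff _).mp ?_ m hm
    rw [← Ideal.Quotient.eq_zero_iff_mem, map_sub]
    simp only [Function.surjInv_eq, sub_self]
  · rfl

lemma faceCoeff_of_not (a : GraphRing G k) {m : V →₀ ℕ} (h : ¬ IsFaceExponent G m) :
    faceCoeff G k a m = 0 := by
  obtain ⟨p, rfl⟩ := Ideal.Quotient.mk_surjective a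
  rw [faceCoeff_mk, if_neg h]

lemma faceCoeff_ext {a b : GraphRing G k}
    (h : ∀ m, IsFaceExponent G m → faceCoeff G k a m = faceCoeff G k b m) : a = b := by
  obtain ⟨p, rfl⟩ := Ideal.Quotient.mk_surjective a
  obtain ⟨q, rfl⟩ := Ideal.Quotient.mk_surjective b
  rw [Ideal.Quotient.mk_eq_mk_iff_sub_mem, mem_stanleyReisnerIdeal_iff]
  intro m hm
  have := h m hm
  rw [faceCoeff_mk, faceCoeff_mk, if_pos hm, if_pos hm] at this
  rw [coeff_sub, this, sub_self]

lemma faceCoeff_X_smul (u : V) (a : GraphRing G k) {m : V →₀ ℕ} (hm : IsFaceExponent G m) :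
    faceCoeff G k ((X u : MvPolynomial V k) • a) m =
      if m u = 0 then 0 else faceCoeff G k a (m - Finsupp.single u 1) := by
  classical
  obtain ⟨p, rfl⟩ := Ideal.Quotient.mk_surjective a
  have : (X u : MvPolynomial V k) • (Ideal.Quotient.mk _ p : GraphRing G k) =
    Ideal.Quotient.mk _ (X u * p) := rfl
  rw [this, faceCoeff_mk, if_pos hm, coeff_X_mul', faceCoeff_mk,
    if_pos (hm.mono Finsupp.support_tsub)]
  simp only [Finsupp.mem_support_iff]
  split_ifs <;> simp_all

variable (k) in
/-- Division by `x_v` of the part of `a` divisible by `x_v²`, the rest being discarded. (Divide by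
`x_v²`, then multiply by `x_v`.) This leaves the supports of the monomials unchanged, so it is
well defined on the Stanley–Reisner ring. -/
def lowerPower (v : V) (a : GraphRing G k) : GraphRing G k :=
  Ideal.Quotient.mk _ (X v * (Function.surjInv (Ideal.Quotient.mk_surjective
    (I := stanleyReisnerIdeal k (graphComplex G))) a).divMonomial (Finsupp.single v 2))

lemma faceCoeff_lowerPower (v : V) (a : GraphRing G k) (m : V →₀ ℕ) :
    faceCoeff G k (lowerPower k v a) m =
      if m v = 0 then 0 else faceCoeff G k a (m + Finsupp.single v 1) := by
  classical
  by_cases hm : IsFaceExponent G m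
  · rw [lowerPower, faceCoeff_mk, if_pos hm, coeff_X_mul']
    by_cases hv : m v = 0
    · simp [hv]
    · rw [if_pos (by simpa using hv), if_neg hv, coeff_divMonomial]
      have h1 : Finsupp.single v 2 + (m - Finsupp.single v 1) = m + Finsupp.single v 1 := by
        ext t
        simp only [Finsupp.add_apply, Finsupp.tsub_apply, Finsupp.single_apply]
        split_ifs with h
        · subst h; omega
        · omega
      have h2 : IsFaceExponent G (m + Finsupp.single v 1) := by
        refine hm.mono fun t ht => ?_
        rw [Finsupp.mem_support_iff] at ht ⊢
        rw [Finsupp.add_apply, Finsupp.single_apply] at ht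
        split_ifs at ht with h
        · exact h ▸ hv
        · simpa using ht
      rw [h1]
      conv_rhs => rw [← Function.surjInv_eq (Ideal.Quotient.mk_surjective
        (I := stanleyReisnerIdeal k (graphComplex G))) a]
      rw [faceCoeff_mk, if_pos h2]
  · rw [faceCoeff_of_not _ hm]
    split_ifs
    · rfl
    · rw [faceCoeff_of_not _ fun h => hm (h.mono fun t ht => ?_)]
      rw [Finsupp.mem_support_iff] at ht ⊢
      rw [Finsupp.add_apply]
      omega

lemma faceCoeff_X (u : V) (m : V →₀ ℕ) [DecidableEq V] :
    faceCoeff G k (Ideal.Quotient.mk _ (X u)) m = if Finsupp.single u 1 = m then 1 else 0 := by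
  rw [faceCoeff_mk, coeff_X]
  split_ifs with h1 h2 h2
  · rfl
  · rfl
  · exact absurd (h2 ▸ isFaceExponent_single u 1) h1
  · rfl

lemma faceCoeff_X_mul_X {u w : V} (h : G.Adj u w) (m : V →₀ ℕ) [DecidableEq V] :
    faceCoeff G k (Ideal.Quotient.mk _ (X u * X w)) m =
      if Finsupp.single u 1 + Finsupp.single w 1 = m then 1 else 0 := by
  rw [faceCoeff_mk, X, X, monomial_mul, one_mul, coeff_monomial]
  split_ifs with h1 h2 h2
  · rfl
  · rfl
  · exact absurd (h2 ▸ isFaceExponent_pair h) h1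
  · rfl

lemma mk_X_mul_X_of_not_adj {u w : V} (hne : u ≠ w) (h : ¬ G.Adj u w) :
    (Ideal.Quotient.mk _ (X u * X w) : GraphRing G k) = 0 := by
  classical
  rw [Ideal.Quotient.eq_zero_iff_mem]
  refine Ideal.subset_span ⟨{u, w}, by simp, ?_, by rw [Finset.prod_pair hne]⟩
  intro hf
  have := hf.2.2
  rw [Finset.coe_pair] at this
  exact h (this (by simp) (by simp) hne)

end FaceMonomials

/-! ### Normal form of two-cocycles -/

section TwoCocycles

variable {V : Type u} {G : SimpleGraph V} {k : Type v} [Field k]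

/-- The coboundary `ω ∧ h` of `h = ∑_v h_v e_v`, as an antisymmetric function of two vertices. -/
def oneCoboundary (h : V → GraphRing G k) (u w : V) : GraphRing G k :=
  (X u : MvPolynomial V k) • h w - (X w : MvPolynomial V k) • h u

/-- A two-cocycle `∑_{u < w} g(u, w) e_u ∧ e_w` of the complex `(S/I ⊗ ⋀ S^V, ω ∧ ·)`, as an
alternating function of two vertices. -/
structure IsTwoCocycle (g : V → V → GraphRing G k) : Prop where
  self : ∀ u, g u u = 0
  anti : ∀ u w, g u w = -g w u
  cocycle : ∀ u v w, (X u : MvPolynomial V k) • g v w - (X v : MvPolynomial V k) • g u w +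
    (X w : MvPolynomial V k) • g u v = 0

lemma IsTwoCocycle.sub_oneCoboundary {g : V → V → GraphRing G k} (hg : IsTwoCocycle g)
    (h : V → GraphRing G k) : IsTwoCocycle fun u w => g u w - oneCoboundary h u w where
  self u := by simp [hg.self u, oneCoboundary]
  anti u w := by
    rw [hg.anti u w, oneCoboundary, oneCoboundary]
    abel
  cocycle u v w := by
    have := hg.cocycle u v w
    simp only [oneCoboundary, smul_sub, smul_smul] at this ⊢
    rw [mul_comm (X v) (X u), mul_comm (X w) (X u), mul_comm (X w) (X v)]
    rw [← sub_eq_zero_of_eq this]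
    abel

open Classical in
/-- For `u ≠ w` no monomial of `g u w` has a larger exponent at `t` than `x_u x_w` has. -/
def IsReducedAt (t : V) (g : V → V → GraphRing G k) : Prop :=
  ∀ u w m, u ≠ w → faceCoeff G k (g u w) m ≠ 0 →
    m t ≤ (if t = u then 1 else 0) + (if t = w then 1 else 0)

/-- The cocycle identity with `v` as one of its three vertices makes the coboundary of
`x ↦ lowerPower v (g v x)` agree with `g` in all monomials that violate the bound at `v`. -/
lemma IsTwoCocycle.isReducedAt_sub {g : V → V → GraphRing G k} (hg : IsTwoCocycle g) (v : V) :
    IsReducedAt v fun u w => g u w - oneCoboundary (fun x => lowerPower k v (g v x)) u w := by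
  classical
  intro u w m huw hne
  by_contra hlt
  push Not at hlt
  have hm : IsFaceExponent G m := by
    by_contra hm
    exact hne (faceCoeff_of_not _ hm)
  refine hne ?_
  have hsub : ∀ x, x ≠ v → (m - Finsupp.single x 1 : V →₀ ℕ) v = m v := fun x hx => by
    simp [hx]
  have hmv : m v ≠ 0 := by omega
  have hmv' : IsFaceExponent G (m + Finsupp.single v 1) := by
    refine hm.mono fun t ht => ?_
    rw [Finsupp.mem_support_iff] at ht ⊢
    rw [Finsupp.add_apply, Finsupp.single_apply] at ht
    split_ifs at ht with h
    · exact h ▸ hmv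
    · simpa using ht
  have hcomm : ∀ x, x ≠ v → m + Finsupp.single v 1 - Finsupp.single x 1 =
      m - Finsupp.single x 1 + Finsupp.single v 1 := fun x hx => by
    ext t
    simp only [Finsupp.add_apply, Finsupp.tsub_apply, Finsupp.single_apply]
    split_ifs with h1 h2
    · exact absurd (h2.trans h1.symm) hx
    all_goals omega
  have hcancel : (m - Finsupp.single v 1 + Finsupp.single v 1) = m := by
    ext t
    simp only [Finsupp.add_apply, Finsupp.tsub_apply, Finsupp.single_apply]
    split_ifs with h
    · subst h; omega
    · omega
  simp only [oneCoboundary, map_sub, Pi.sub_apply, faceCoeff_X_smul _ _ hm, faceCoeff_lowerPower]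
  by_cases hvu : v = u
  · subst hvu
    rw [if_pos rfl, if_neg huw] at hlt
    have h1 : (m - Finsupp.single v 1 : V →₀ ℕ) v ≠ 0 := by
      simp only [Finsupp.tsub_apply, Finsupp.single_eq_same]; omega
    rw [if_neg hmv, if_neg h1, hcancel, hg.self v, map_zero]
    simp only [Pi.zero_apply, ite_self, sub_zero, sub_self]
  · by_cases hvw : v = w
    · subst hvw
      rw [if_pos rfl, if_neg hvu] at hlt
      have h1 : (m - Finsupp.single v 1 : V →₀ ℕ) v ≠ 0 := by
        simp only [Finsupp.tsub_apply, Finsupp.single_eq_same]; omega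
      rw [if_neg hmv, if_neg h1, hcancel, hg.self v, hg.anti u v, map_neg]
      simp
    · have hc := congrFun (congrArg (faceCoeff G k) (hg.cocycle v u w)) (m + Finsupp.single v 1)
      simp only [map_add, map_sub, Pi.add_apply, Pi.sub_apply, faceCoeff_X_smul _ _ hmv',
        map_zero, Pi.zero_apply] at hc
      have h1 : (m + Finsupp.single v 1 : V →₀ ℕ) v ≠ 0 := by simp
      have h2 : (m + Finsupp.single v 1 : V →₀ ℕ) u = m u := by simp [hvu]
      have h3 : (m + Finsupp.single v 1 : V →₀ ℕ) w = m w := by simp [hvw]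
      rw [if_neg h1, add_tsub_cancel_right, h2, h3, hcomm u (Ne.symm hvu),
        hcomm w (Ne.symm hvw)] at hc
      rw [hsub u (Ne.symm hvu), hsub w (Ne.symm hvw), if_neg hmv, if_neg hmv]
      linear_combination hc

/-- Reducing at `v` does not destroy the reducedness at another vertex `t`. -/
lemma IsReducedAt.sub_oneCoboundary {g : V → V → GraphRing G k} {t : V} (hg : IsTwoCocycle g)
    (hr : IsReducedAt t g) (v : V) :
    IsReducedAt t fun u w => g u w - oneCoboundary (fun x => lowerPower k v (g v x)) u w := by
  classical
  have key : ∀ u w m, u ≠ w → faceCoeff G k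
      ((X u : MvPolynomial V k) • lowerPower k v (g v w)) m ≠ 0 →
      m t ≤ (if t = u then 1 else 0) + (if t = w then 1 else 0) := by
    intro u w m _ hne
    have hm : IsFaceExponent G m := by
      by_contra hm
      exact hne (faceCoeff_of_not _ hm)
    rw [faceCoeff_X_smul _ _ hm, faceCoeff_lowerPower] at hne
    split_ifs at hne with h1 h2
    · exact absurd rfl hne
    · exact absurd rfl hne
    · have hvw : v ≠ w := by
        rintro rfl
        rw [hg.self, map_zero] at hne
        exact hne rfl
      have := hr v w _ hvw hne
      simp only [Finsupp.add_apply, Finsupp.tsub_apply, Finsupp.single_apply,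
        eq_comm (a := u) (b := t), eq_comm (a := v) (b := t)] at this
      split_ifs at this ⊢ <;> omega
  intro u w m huw hne
  simp only [oneCoboundary, map_sub, Pi.sub_apply] at hne
  by_cases h1 : faceCoeff G k (g u w) m = 0
  · by_cases h2 : faceCoeff G k ((X u : MvPolynomial V k) • lowerPower k v (g v w)) m = 0
    · have h3 : faceCoeff G k ((X w : MvPolynomial V k) • lowerPower k v (g v u)) m ≠ 0 := by
        intro h3
        rw [h1, h2, h3] at hne
        simp at hne
      rw [add_comm]
      exact key w u m huw.symm h3
    · exact key u w m huw h2
  · exact hr u w m huw h1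

/-- Every two-cocycle is cohomologous to one that is reduced at all vertices of `T`. -/
lemma IsTwoCocycle.exists_reduced {g : V → V → GraphRing G k} (hg : IsTwoCocycle g)
    (T : Finset V) : ∃ h : V → GraphRing G k,
      ∀ t ∈ T, IsReducedAt t fun u w => g u w - oneCoboundary h u w := by
  classical
  induction T using Finset.induction_on with
  | empty => exact ⟨0, by simp⟩
  | insert v T _ ih =>
    obtain ⟨h, hh⟩ := ih
    have hg' := hg.sub_oneCoboundary h
    refine ⟨fun x => h x + lowerPower k v (g v x - oneCoboundary h v x), ?_⟩
    have heq : (fun u w => g u w - oneCoboundary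
        (fun x => h x + lowerPower k v (g v x - oneCoboundary h v x)) u w) =
        fun u w => (g u w - oneCoboundary h u w) -
          oneCoboundary (fun x => lowerPower k v (g v x - oneCoboundary h v x)) u w := by
      funext u w
      simp only [oneCoboundary, smul_add]
      abel
    rw [heq]
    intro t ht
    rcases Finset.mem_insert.mp ht with rfl | ht
    · exact hg'.isReducedAt_sub t
    · exact (hh t ht).sub_oneCoboundary hg' v

variable (G k) in
/-- The pairs `(α, β)` consisting of an antisymmetric function `α` on the oriented edges of `G`
and a function `β` such that `β u ·` is constant along the edges of `G - u`, for every vertex `u`.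
Both are functions on all pairs of vertices, with `α` zero off the edges and `β` zero on the
diagonal. -/
def localCochains : Submodule k ((V → V → k) × (V → V → k)) where
  carrier := {x | (∀ u w, x.1 u w = -x.1 w u) ∧ (∀ u w, ¬ G.Adj u w → x.1 u w = 0) ∧
    (∀ u, x.2 u u = 0) ∧ ∀ u v w, v ≠ u → w ≠ u → G.Adj v w → x.2 u v = x.2 u w}
  zero_mem' := by simp
  add_mem' := by
    rintro x y ⟨h1, h2, h3, h4⟩ ⟨h1', h2', h3', h4'⟩
    refine ⟨fun u w => ?_, fun u w h => ?_, fun u => ?_, fun u v w hv hw h => ?_⟩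
    · simp only [Prod.fst_add, Pi.add_apply]
      rw [h1 u w, h1' u w, neg_add]
    · simp [h2 u w h, h2' u w h]
    · simp [h3 u, h3' u]
    · simp [h4 u v w hv hw h, h4' u v w hv hw h]
  smul_mem' := by
    rintro c x ⟨h1, h2, h3, h4⟩
    refine ⟨fun u w => ?_, fun u w h => ?_, fun u => ?_, fun u v w hv hw h => ?_⟩
    · simp only [Prod.smul_fst, Pi.smul_apply]
      rw [h1 u w, smul_neg]
    · simp [h2 u w h]
    · simp [h3 u]
    · simp [h4 u v w hv hw h]

variable (G) in
/-- The two-cocycle `α(u, w) x_u x_w + β(u, w) x_w - β(w, u) x_u` attached to `(α, β)`. -/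
def localCocycle (x : (V → V → k) × (V → V → k)) (u w : V) : GraphRing G k :=
  x.1 u w • Ideal.Quotient.mk _ (X u * X w) + x.2 u w • Ideal.Quotient.mk _ (X w) -
    x.2 w u • Ideal.Quotient.mk _ (X u)

lemma faceCoeff_localCocycle [DecidableEq V] {x : (V → V → k) × (V → V → k)}
    (hx : x ∈ localCochains G k) (u w : V) (m : V →₀ ℕ) :
    faceCoeff G k (localCocycle G x u w) m =
      (if Finsupp.single u 1 + Finsupp.single w 1 = m then x.1 u w else 0) +
      (if Finsupp.single w 1 = m then x.2 u w else 0) -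
      (if Finsupp.single u 1 = m then x.2 w u else 0) := by
  simp only [localCocycle, map_add, map_sub, map_smul, Pi.add_apply, Pi.sub_apply, Pi.smul_apply,
    faceCoeff_X, smul_eq_mul, mul_ite, mul_one, mul_zero]
  congr 2
  by_cases h : G.Adj u w
  · rw [faceCoeff_X_mul_X h, mul_ite, mul_one, mul_zero]
  · rw [hx.2.1 u w h]
    simp

/-- A graph complex has no faces with three vertices. -/
lemma smul_X_mul_X_zero {u v w : V} (hv : v ≠ w) (hu : u ≠ v) (hw : u ≠ w) :
    (X u : MvPolynomial V k) • (Ideal.Quotient.mk _ (X v * X w) : GraphRing G k) = 0 := by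
  classical
  have h : (X u : MvPolynomial V k) • (Ideal.Quotient.mk _ (X v * X w) : GraphRing G k) =
    Ideal.Quotient.mk _ (X u * (X v * X w)) := rfl
  rw [h, Ideal.Quotient.eq_zero_iff_mem]
  refine Ideal.subset_span ⟨{u, v, w}, by simp, ?_, ?_⟩
  · intro hf
    have h3 : Finset.card {u, v, w} = 3 := Finset.card_eq_three.mpr ⟨u, v, w, hu, hw, hv, rfl⟩
    have := hf.2.1
    omega
  · rw [Finset.prod_insert (by simp [hu, hw]), Finset.prod_pair hv]

lemma isTwoCocycle_localCocycle {x : (V → V → k) × (V → V → k)} (hx : x ∈ localCochains G k) :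
    IsTwoCocycle (localCocycle G x) := by
  obtain ⟨h1, h2, h3, h4⟩ := hx
  have hself : ∀ u, localCocycle G x u u = 0 := fun u => by
    simp [localCocycle, h2 u u (G.irrefl), h3 u]
  have hanti : ∀ u w, localCocycle G x u w = -localCocycle G x w u := fun u w => by
    simp only [localCocycle]
    rw [h1 u w, mul_comm (X u)]
    module
  refine ⟨hself, hanti, fun u v w => ?_⟩
  by_cases huv : u = v
  · subst huv; simp [hself]
  by_cases hvw : v = w
  · subst hvw; simp [hself]
  by_cases huw : u = w
  · subst huw; rw [hanti v u, hself]; simp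
  have hX : ∀ a b : V, (X a : MvPolynomial V k) • (Ideal.Quotient.mk _ (X b) : GraphRing G k) =
    Ideal.Quotient.mk _ (X a * X b) := fun _ _ => rfl
  have hz : ∀ {a b c : V}, b ≠ c → a ≠ b → a ≠ c → ∀ r : k,
      (X a : MvPolynomial V k) • (r • Ideal.Quotient.mk _ (X b * X c) : GraphRing G k) = 0 := by
    intro a b c h h' h'' r
    rw [smul_comm, smul_X_mul_X_zero h h' h'', smul_zero]
  have hb : ∀ {a b c : V}, b ≠ a → c ≠ a → b ≠ c →
      (x.2 a b - x.2 a c) • (Ideal.Quotient.mk _ (X b * X c) : GraphRing G k) = 0 := by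
    intro a b c hba hca hbc
    by_cases hadj : G.Adj b c
    · rw [h4 a b c hba hca hadj, sub_self, zero_smul]
    · rw [mk_X_mul_X_of_not_adj hbc hadj, smul_zero]
  simp only [localCocycle, smul_add, smul_sub]
  rw [hz hvw huv huw, hz huw (Ne.symm huv) hvw, hz huv (Ne.symm huw) (Ne.symm hvw)]
  simp only [smul_comm (X _ : MvPolynomial V k) (x.2 _ _), hX]
  rw [mul_comm (X w) (X v), mul_comm (X w) (X u), mul_comm (X v) (X u)]
  have e1 := hb (a := u) (b := v) (c := w) (Ne.symm huv) (Ne.symm huw) hvw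
  have e2 := hb (a := v) (b := u) (c := w) huv (Ne.symm hvw) huw
  have e3 := hb (a := w) (b := u) (c := v) huw hvw huv
  rw [sub_smul] at e1 e2 e3
  linear_combination e1 - e2 + e3

/-- Every two-cocycle is cohomologous to the one attached to a pair `(α, β)`. With two
vertices this fails, as then the constants are cocycles too. -/
lemma IsTwoCocycle.exists_localCocycle [Fintype V] (hV : 3 ≤ Fintype.card V)
    {g : V → V → GraphRing G k} (hg : IsTwoCocycle g) :
    ∃ x ∈ localCochains G k, ∃ h, ∀ u w, g u w = localCocycle G x u w + oneCoboundary h u w := by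
  classical
  obtain ⟨h, hred⟩ := hg.exists_reduced Finset.univ
  replace hg := hg.sub_oneCoboundary h
  set g' : V → V → GraphRing G k := fun u w => g u w - oneCoboundary h u w with hg'
  have hco : ∀ u v w m, IsFaceExponent G m →
      (if m u = 0 then 0 else faceCoeff G k (g' v w) (m - Finsupp.single u 1)) -
      (if m v = 0 then 0 else faceCoeff G k (g' u w) (m - Finsupp.single v 1)) +
      (if m w = 0 then 0 else faceCoeff G k (g' u v) (m - Finsupp.single w 1)) = 0 := by
    intro u v w m hm
    have := congrFun (congrArg (faceCoeff G k) (hg.cocycle u v w)) m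
    simpa only [map_add, map_sub, Pi.add_apply, Pi.sub_apply, faceCoeff_X_smul _ _ hm,
      map_zero, Pi.zero_apply] using this
  have hanti : ∀ u w m, faceCoeff G k (g' u w) m = -faceCoeff G k (g' w u) m := fun u w m => by
    rw [hg.anti u w, map_neg, Pi.neg_apply]
  -- `α(u, w)` and `β(u, w)` are the coefficients of `x_u x_w` and of `x_w` in the reduced cocycle.
  let x : (V → V → k) × (V → V → k) :=
    (fun u w => if u = w then 0 else
      faceCoeff G k (g' u w) (Finsupp.single u 1 + Finsupp.single w 1),
     fun u w => if u = w then 0 else faceCoeff G k (g' u w) (Finsupp.single w 1))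
  have hx : x ∈ localCochains G k := by
    refine ⟨fun u w => ?_, fun u w hn => ?_, fun u => ?_, fun u v w hv hw hadj => ?_⟩
    · change (if u = w then _ else _) = -(if w = u then _ else _)
      by_cases e : u = w
      · simp [e]
      · rw [if_neg e, if_neg (Ne.symm e), hanti, add_comm]
    · change (if u = w then _ else _) = _
      split_ifs with e
      · rfl
      · refine faceCoeff_of_not _ fun hf => hn ?_
        refine hf.2 ?_ ?_ e <;> simp [Finsupp.single_apply]
    · change (if u = u then _ else _) = _
      rw [if_pos rfl]
    · change (if u = v then _ else _) = (if u = w then _ else _)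
      rw [if_neg (Ne.symm hv), if_neg (Ne.symm hw)]
      -- the coefficient of `x_v x_w` in the cocycle identity
      have := hco u v w _ (isFaceExponent_pair hadj)
      have e1 : (Finsupp.single v 1 + Finsupp.single w 1 : V →₀ ℕ) u = 0 := by
        simp [hv, hw]
      have e2 : (Finsupp.single v 1 + Finsupp.single w 1 : V →₀ ℕ) v ≠ 0 := by simp
      have e3 : (Finsupp.single v 1 + Finsupp.single w 1 : V →₀ ℕ) w ≠ 0 := by simp
      rw [if_pos e1, if_neg e2, if_neg e3, add_tsub_cancel_left, add_tsub_cancel_right] at this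
      linear_combination this
  refine ⟨x, hx, h, fun u w => ?_⟩
  suffices hs : g' u w = localCocycle G x u w by
    rw [← hs]; simp [hg']
  by_cases huw : u = w
  · subst huw
    rw [hg.self u, (isTwoCocycle_localCocycle hx).self u]
  refine faceCoeff_ext fun m hm => ?_
  rw [faceCoeff_localCocycle hx]
  change _ = (if _ then (if u = w then _ else _) else _) +
    (if _ then (if u = w then _ else _) else _) - (if _ then (if w = u then _ else _) else _)
  simp only [if_neg huw, if_neg (Ne.symm huw)]
  -- A third vertex `v` excludes constant terms: compare coefficients of `x_v` in the cocycle
  -- identity.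
  have hzero : faceCoeff G k (g' u w) 0 = 0 := by
    obtain ⟨v, hv⟩ : ∃ v, v ∉ ({u, w} : Finset V) := by
      by_contra! hall
      have h1 : Fintype.card V ≤ ({u, w} : Finset V).card := by
        rw [← Finset.card_univ]
        exact Finset.card_le_card fun v _ => hall v
      have h2 : ({u, w} : Finset V).card ≤ 2 := Finset.card_le_two
      omega
    simp only [Finset.mem_insert, Finset.mem_singleton, not_or] at hv
    have := hco v u w _ (isFaceExponent_single v 1)
    simpa [Finsupp.single_apply, hv.1, hv.2] using this
  have hne1 : (Finsupp.single u 1 : V →₀ ℕ) ≠ Finsupp.single w 1 := fun e =>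
    huw ((Finsupp.single_left_inj one_ne_zero).mp e)
  have hne2 : (Finsupp.single u 1 : V →₀ ℕ) + Finsupp.single w 1 ≠ Finsupp.single w 1 := by simp
  have hne3 : (Finsupp.single u 1 : V →₀ ℕ) + Finsupp.single w 1 ≠ Finsupp.single u 1 := by simp
  by_cases h1 : Finsupp.single u 1 + Finsupp.single w 1 = m
  · subst h1
    simp [hne2.symm, hne3.symm]
  by_cases h2 : Finsupp.single w 1 = m
  · subst h2
    simp [hne1, hne2]
  by_cases h3 : Finsupp.single u 1 = m
  · subst h3
    rw [hanti u w]
    simp [hne1.symm, hne3]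
  simp only [if_neg h1, if_neg h2, if_neg h3, add_zero, sub_zero]
  -- By reducedness `m` divides `x_u x_w`, and all four divisors have been dealt with.
  by_contra hne
  have hle : ∀ t, m t ≤ (if t = u then 1 else 0) + (if t = w then 1 else 0) := fun t =>
    hred t (Finset.mem_univ t) u w m huw hne
  have hm0 : m ≠ 0 := by
    rintro rfl
    exact hne hzero
  have hmeq : m = Finsupp.single u (m u) + Finsupp.single w (m w) := by
    ext t
    have := hle t
    simp only [Finsupp.add_apply, Finsupp.single_apply]
    by_cases htu : t = u
    · subst htu
      simp [Ne.symm huw]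
    · by_cases htw : t = w
      · subst htw
        simp [huw]
      · simp only [htu, htw, if_false] at this
        simp only [Ne.symm htu, Ne.symm htw, if_false]
        omega
  have hu : m u = 0 ∨ m u = 1 := by
    have := hle u
    rw [if_pos rfl, if_neg huw] at this
    omega
  have hw : m w = 0 ∨ m w = 1 := by
    have := hle w
    rw [if_pos rfl, if_neg (Ne.symm huw)] at this
    omega
  rcases hu with hu | hu <;> rcases hw with hw | hw <;> rw [hu, hw] at hmeq <;>
    try simp only [Finsupp.single_zero, zero_add, add_zero] at hmeq
  · exact hm0 hmeq
  · exact h2 hmeq.symm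
  · exact h3 hmeq.symm
  · exact h1 hmeq.symm

/-- The cocycle attached to `(α, β)` is a coboundary exactly if `α` is the difference of a
potential and each `β u ·` is constant. -/
lemma localCocycle_eq_oneCoboundary_iff [Fintype V] (x : (V → V → k) × (V → V → k))
    (hx : x ∈ localCochains G k) :
    (∃ h, ∀ u w, localCocycle G x u w = oneCoboundary h u w) ↔
      ∃ a c : V → k, (∀ u w, G.Adj u w → x.1 u w = a w - a u) ∧ ∀ u w, u ≠ w → x.2 u w = c u := by
  classical
  constructor
  · rintro ⟨h, hh⟩
    have hco : ∀ u w m, IsFaceExponent G m → faceCoeff G k (localCocycle G x u w) m =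
        (if m u = 0 then 0 else faceCoeff G k (h w) (m - Finsupp.single u 1)) -
        (if m w = 0 then 0 else faceCoeff G k (h u) (m - Finsupp.single w 1)) := by
      intro u w m hm
      rw [hh u w, oneCoboundary, map_sub, Pi.sub_apply, faceCoeff_X_smul _ _ hm,
        faceCoeff_X_smul _ _ hm]
    refine ⟨fun v => faceCoeff G k (h v) (Finsupp.single v 1),
      fun v => -faceCoeff G k (h v) 0, fun u w hadj => ?_, fun u w hne => ?_⟩
    · have := hco u w _ (isFaceExponent_pair hadj)
      have e2 : (Finsupp.single u 1 + Finsupp.single w 1 : V →₀ ℕ) u ≠ 0 := by simp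
      have e3 : (Finsupp.single u 1 + Finsupp.single w 1 : V →₀ ℕ) w ≠ 0 := by simp
      rw [if_neg e2, if_neg e3, add_tsub_cancel_left, add_tsub_cancel_right,
        faceCoeff_localCocycle hx] at this
      simpa using this
    · have := hco u w _ (isFaceExponent_single w 1)
      have e1 : (Finsupp.single w 1 : V →₀ ℕ) u = 0 := by simp [Ne.symm hne]
      have e2 : (Finsupp.single w 1 : V →₀ ℕ) w ≠ 0 := by simp
      have e3 : (Finsupp.single u 1 : V →₀ ℕ) ≠ Finsupp.single w 1 := fun e =>
        hne ((Finsupp.single_left_inj one_ne_zero).mp e)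
      rw [if_pos e1, if_neg e2, tsub_self, faceCoeff_localCocycle hx, if_neg e3] at this
      simpa using this
  · rintro ⟨a, c, h1, h2⟩
    refine ⟨fun v => a v • Ideal.Quotient.mk _ (X v) - c v • 1, fun u w => ?_⟩
    by_cases huw : u = w
    · subst huw
      rw [(isTwoCocycle_localCocycle hx).self u]
      simp [oneCoboundary]
    have hX : ∀ (r : k) (a b : V),
        (X a : MvPolynomial V k) • (r • Ideal.Quotient.mk _ (X b) : GraphRing G k) =
        r • Ideal.Quotient.mk _ (X a * X b) := fun r a b => by
      rw [smul_comm]; rfl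
    have h1' : ∀ (r : k) (a : V), (X a : MvPolynomial V k) • (r • 1 : GraphRing G k) =
        r • Ideal.Quotient.mk _ (X a) := fun r a => by
      rw [smul_comm, ← map_one (Ideal.Quotient.mk _)]
      congr 1
      exact congrArg (Ideal.Quotient.mk _) (mul_one (X a : MvPolynomial V k))
    simp only [oneCoboundary, smul_sub, hX, h1', localCocycle, h2 u w huw, h2 w u (Ne.symm huw)]
    rw [mul_comm (X w) (X u)]
    by_cases hadj : G.Adj u w
    · rw [h1 u w hadj]
      module
    · rw [mk_X_mul_X_of_not_adj huw hadj]
      module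

open Classical in
variable (k G) in
/-- The pair `(α, β)` with `α u w = a w - a u` on the edges and `β u · = c u` off the diagonal,
attached to a potential `a` and constants `c`. -/
def trivialLocal : ((V → k) × (V → k)) →ₗ[k] localCochains G k where
  toFun y :=
    ⟨(fun u w => if G.Adj u w then y.1 w - y.1 u else 0, fun u w => if u = w then 0 else y.2 u), by
      refine ⟨fun u w => ?_, fun u w h => if_neg h, fun u => if_pos rfl,
        fun u v w hv hw _ => ?_⟩
      · simp only [G.adj_comm u w]
        split_ifs <;> ring
      · simp only [if_neg hv.symm, if_neg hw.symm]⟩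
  map_add' y z := by
    refine Subtype.ext (Prod.ext ?_ ?_) <;> funext u w
    · simp only [Submodule.coe_add, Prod.fst_add, Pi.add_apply]
      split_ifs <;> ring
    · simp only [Submodule.coe_add, Prod.snd_add, Pi.add_apply]
      split_ifs <;> ring
  map_smul' c y := by
    refine Subtype.ext (Prod.ext ?_ ?_) <;> funext u w
    · simp only [Submodule.coe_smul, Prod.smul_fst, Pi.smul_apply, smul_eq_mul, RingHom.id_apply]
      split_ifs <;> ring
    · simp only [Submodule.coe_smul, Prod.smul_snd, Pi.smul_apply, smul_eq_mul, RingHom.id_apply]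
      split_ifs <;> ring

open Classical in
lemma trivialLocal_fst (y : (V → k) × (V → k)) (u w : V) :
    (trivialLocal G k y).1.1 u w = if G.Adj u w then y.1 w - y.1 u else 0 := by
  rfl

open Classical in
lemma trivialLocal_snd (y : (V → k) × (V → k)) (u w : V) :
    (trivialLocal G k y).1.2 u w = if u = w then 0 else y.2 u := by
  rfl

lemma mem_range_trivialLocal (x : localCochains G k) :
    x ∈ LinearMap.range (trivialLocal G k) ↔
      ∃ a c : V → k, (∀ u w, G.Adj u w → x.1.1 u w = a w - a u) ∧
        ∀ u w, u ≠ w → x.1.2 u w = c u := by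
  classical
  constructor
  · rintro ⟨y, rfl⟩
    exact ⟨y.1, y.2, fun u w h => by rw [trivialLocal_fst, if_pos h],
      fun u w h => by rw [trivialLocal_snd, if_neg h]⟩
  · rintro ⟨a, c, h1, h2⟩
    refine ⟨(a, c), Subtype.ext (Prod.ext ?_ ?_)⟩ <;> funext u w
    · rw [trivialLocal_fst]
      split_ifs with h
      · exact (h1 u w h).symm
      · exact (x.2.2.1 u w h).symm
    · rw [trivialLocal_snd]
      split_ifs with h
      · subst h; exact (x.2.2.2.1 u).symm
      · exact (h2 u w h).symm

end TwoCocycles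

/-! ### The dimension of Tor in degree `n - 2` -/

section TorFormula

variable {V : Type u} [Fintype V] {k : Type v} [Field k]

section Signs

variable [DecidableEq V] {M : Type*} [AddCommGroup M] [Module (MvPolynomial V k) M]

lemma wedgeVars_pair (F : Finset V → M) {u w : V} (h : u ≠ w) :
    wedgeVars k M F {u, w} = transSign w u •
      ((X u : MvPolynomial V k) • F {w} - (X w : MvPolynomial V k) • F {u}) := by
  have e1 : ({u, w} : Finset V).erase u = {w} := by
    rw [Finset.erase_insert]; simpa using h
  have e2 : ({u, w} : Finset V).erase w = {u} := by
    rw [Finset.pair_comm, Finset.erase_insert]; simpa using h.symm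
  rw [wedgeVars_apply, Finset.sum_pair h, e1, e2, wedgeSign, wedgeSign, Finset.prod_pair h,
    Finset.prod_pair h, transSign_self, transSign_self, transSign_swap h]
  module

/-- In exterior degree three `ω ∧ ·` is, up to sign, the cocycle expression of `IsTwoCocycle`. -/
lemma wedgeVars_triple (F : Finset V → M) (g : V → V → M)
    (hg : ∀ u w, u ≠ w → g u w = transSign w u • F {u, w})
    {u v w : V} (huv : u ≠ v) (huw : u ≠ w) (hvw : v ≠ w) :
    wedgeVars k M F {u, v, w} = (transSign v u * transSign w u * transSign w v) •
      ((X u : MvPolynomial V k) • g v w - (X v : MvPolynomial V k) • g u w +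
        (X w : MvPolynomial V k) • g u v) := by
  have e1 : ({u, v, w} : Finset V).erase u = {v, w} := by
    ext x; simp only [Finset.mem_erase, Finset.mem_insert, Finset.mem_singleton]; grind
  have e2 : ({u, v, w} : Finset V).erase v = {u, w} := by
    ext x; simp only [Finset.mem_erase, Finset.mem_insert, Finset.mem_singleton]; grind
  have e3 : ({u, v, w} : Finset V).erase w = {u, v} := by
    ext x; simp only [Finset.mem_erase, Finset.mem_insert, Finset.mem_singleton]; grind
  have hu : u ∉ ({v, w} : Finset V) := by simp [huv, huw]
  have hs : ∀ x : V, wedgeSign x {u, v, w} = transSign u x * (transSign v x * transSign w x) :=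
    fun x => by rw [wedgeSign, Finset.prod_insert hu, Finset.prod_pair hvw]
  rw [wedgeVars_apply, Finset.sum_insert hu, Finset.sum_pair hvw, e1, e2, e3, hs, hs, hs,
    hg v w hvw, hg u w huw, hg u v huv]
  simp only [transSign_self, smul_add, smul_sub]
  rw [smul_comm (X u : MvPolynomial V k) (transSign w v), smul_comm (X v : MvPolynomial V k)
    (transSign w u), smul_comm (X w : MvPolynomial V k) (transSign v u), smul_smul, smul_smul,
    smul_smul, transSign_swap huv, transSign_swap huw, transSign_swap hvw]
  rw [sub_eq_add_neg, ← neg_smul, add_assoc]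
  have s1 := transSign_mul_self v u
  have s2 := transSign_mul_self w u
  have s3 := transSign_mul_self w v
  congr 1
  · congr 1
    linear_combination (-transSign v u * transSign w u) * s3
  · congr 1
    · congr 1
      linear_combination (transSign v u * transSign w v) * s2
    · congr 1
      linear_combination (-transSign w u * transSign w v) * s1

/-- The coefficient of `e_u ∧ e_w`, with `u` before `w`, at the two-element set `{u, w}`. -/
def ofAlternating (g : V → V → M) (s : Finset V) : M :=
  ∑ u ∈ s, ∑ w ∈ s, if Fintype.equivFin V u < Fintype.equivFin V w then g u w else 0

lemma ofAlternating_pair {g : V → V → M} (hg : ∀ u w, g u w = -g w u) {u w : V} (h : u ≠ w) :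
    ofAlternating g {u, w} = transSign w u • g u w := by
  have h' : Fintype.equivFin V u ≠ Fintype.equivFin V w :=
    fun e => h ((Fintype.equivFin V).injective e)
  simp only [ofAlternating, Finset.sum_pair h, lt_irrefl, if_false, zero_add, add_zero, transSign]
  rcases lt_or_gt_of_ne h' with h1 | h1
  · simp [h1, h1.not_gt]
  · simp [h1, h1.not_gt, hg w u]

end Signs

section Quotient

variable {G : SimpleGraph V}

/-- The kernel consists of the constant potentials. -/
lemma finrank_range_trivialLocal (hG : G.Connected) (hV : 2 ≤ Fintype.card V) :
    Module.finrank k (LinearMap.range (trivialLocal G k)) + 1 = 2 * Fintype.card V := by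
  classical
  have hker : LinearMap.ker (trivialLocal G k) =
      Submodule.span k {((fun _ => 1, 0) : (V → k) × (V → k))} := by
    ext y
    rw [LinearMap.mem_ker, Submodule.mem_span_singleton]
    constructor
    · intro h
      have h1 : ∀ u w, G.Adj u w → y.1 w = y.1 u := fun u w hadj => by
        have := trivialLocal_fst (G := G) y u w
        rw [h, if_pos hadj] at this
        exact (sub_eq_zero.mp this.symm)
      have h2 : y.2 = 0 := by
        funext u
        obtain ⟨w, hw⟩ := Fintype.exists_ne_of_one_lt_card (by omega) u
        have := trivialLocal_snd (G := G) y u w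
        rw [h, if_neg hw.symm] at this
        exact this.symm
      obtain ⟨v⟩ := hG.nonempty
      refine ⟨y.1 v, Prod.ext ?_ ?_⟩
      · funext w
        simp only [Prod.smul_mk, Pi.smul_apply, smul_eq_mul, mul_one]
        obtain ⟨p⟩ := hG.preconnected v w
        induction p with
        | nil => rfl
        | cons hadj p ih => rw [← ih, h1 _ _ hadj]
      · simp [h2]
    · rintro ⟨c, rfl⟩
      refine Subtype.ext (Prod.ext ?_ ?_) <;> funext u w
      · rw [trivialLocal_fst]; simp
      · rw [trivialLocal_snd]; simp
  have hr := LinearMap.finrank_range_add_finrank_ker (trivialLocal G k)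
  obtain ⟨v⟩ := hG.nonempty
  rw [hker, finrank_span_singleton (fun h => one_ne_zero (congrFun (congrArg Prod.fst h) v)),
    Module.finrank_prod, Module.finrank_fintype_fun_eq_card] at hr
  omega

end Quotient

/-- `Tor_{n-2}(S/I, k)` is the space of pairs `(α, β)` modulo the trivial ones. -/
lemma torDim_graph (G : SimpleGraph V) {p : ℕ} (hp : p + 3 = Fintype.card V) :
    torDim (stanleyReisnerIdeal k (graphComplex G)) (p + 1) =
      Module.finrank k (localCochains G k ⧸ LinearMap.range (trivialLocal G k)) := by
  classical
  have hgC : ∀ x : localCochains G k, IsTwoCocycle (localCocycle G x.1) :=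
    fun x => isTwoCocycle_localCocycle x.2
  let L : localCochains G k →ₗ[k] (CoCard V (p + 1) → GraphRing G k) :=
    { toFun := fun x s => ofAlternating (localCocycle G x.1) s.1
      map_add' := fun x y => by
        funext s
        simp only [ofAlternating, Pi.add_apply, ← Finset.sum_add_distrib]
        refine Finset.sum_congr rfl fun u _ => Finset.sum_congr rfl fun w _ => ?_
        split_ifs
        · simp only [localCocycle, Submodule.coe_add, Prod.fst_add, Prod.snd_add, Pi.add_apply]
          module
        · simp
      map_smul' := fun c x => by
        funext s
        simp only [ofAlternating, Pi.smul_apply, Finset.smul_sum, RingHom.id_apply]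
        refine Finset.sum_congr rfl fun u _ => Finset.sum_congr rfl fun w _ => ?_
        split_ifs
        · simp only [localCocycle, Submodule.coe_smul, Prod.smul_fst, Prod.smul_snd, Pi.smul_apply,
            smul_eq_mul]
          module
        · simp }
  have hpair : ∀ {u w : V}, u ≠ w → ({u, w} : Finset V).card + (p + 1) = Fintype.card V :=
    fun h => by rw [Finset.card_pair h]; omega
  have hsing : ∀ u : V, ({u} : Finset V).card + (p + 2) = Fintype.card V :=
    fun u => by rw [Finset.card_singleton]; omega
  have hL : ∀ x u w, (h : u ≠ w) →
      L x ⟨{u, w}, hpair h⟩ = transSign w u • localCocycle G x.1 u w := fun x u w h =>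
    ofAlternating_pair (hgC x).anti h
  have hext : ∀ (f : CoCard V (p + 1) → GraphRing G k) {u w : V} (h : u ≠ w),
      extendZero k _ (p + 1) f {u, w} = f ⟨{u, w}, hpair h⟩ := fun f u w h =>
    extendZero_coe (k := k) f ⟨{u, w}, hpair h⟩
  have hcob : ∀ (h : CoCard V (p + 2) → GraphRing G k) {u w : V} (hne : u ≠ w),
      koszulD k _ (p + 1) h ⟨{u, w}, hpair hne⟩ =
        transSign w u • oneCoboundary (fun x => h ⟨{x}, hsing x⟩) u w := by
    intro h u w hne
    rw [koszulD_apply, wedgeVars_pair _ hne, oneCoboundary]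
    congr 3
    · exact (extendZero_coe (k := k) h ⟨{w}, hsing w⟩)
    · exact (extendZero_coe (k := k) h ⟨{u}, hsing u⟩)
  have hcoc : ∀ (f : CoCard V (p + 1) → GraphRing G k) (g : V → V → GraphRing G k)
      (hg : ∀ u w, (h : u ≠ w) → g u w = transSign w u • f ⟨{u, w}, hpair h⟩),
      (koszulD k _ p f = 0 ↔ ∀ u v w, u ≠ v → u ≠ w → v ≠ w →
        (X u : MvPolynomial V k) • g v w - (X v : MvPolynomial V k) • g u w +
        (X w : MvPolynomial V k) • g u v = 0) := by
    intro f g hg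
    have hg' : ∀ u w, u ≠ w → g u w = transSign w u • extendZero k _ (p + 1) f {u, w} :=
      fun u w h => by rw [hg u w h, hext f h]
    constructor
    · intro h u v w huv huw hvw
      have hc : ({u, v, w} : Finset V).card + p = Fintype.card V := by
        rw [Finset.card_eq_three.mpr ⟨u, v, w, huv, huw, hvw, rfl⟩]; omega
      have := congrFun h ⟨_, hc⟩
      rw [koszulD_apply, wedgeVars_triple _ g hg' huv huw hvw] at this
      have h2 := congrArg (fun z => (transSign v u * transSign w u * transSign w v) • z) this
      simp only [smul_smul] at h2
      have s1 := transSign_mul_self v u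
      have s2 := transSign_mul_self w u
      have s3 := transSign_mul_self w v
      have hone : transSign v u * transSign w u * transSign w v *
          (transSign v u * transSign w u * transSign w v) = 1 := by
        linear_combination (transSign w u * transSign w u * transSign w v * transSign w v) * s1 +
          (transSign w v * transSign w v) * s2 + s3
      rw [hone, one_smul] at h2
      rw [h2]
      exact smul_zero _
    · intro h
      funext s
      have hs3 : s.1.card = 3 := by have := s.2; omega
      obtain ⟨u, v, w, huv, huw, hvw, hs⟩ := Finset.card_eq_three.mp hs3
      rw [koszulD_apply, hs, wedgeVars_triple _ g hg' huv huw hvw, h u v w huv huw hvw, smul_zero]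
      rfl
  have htwo : ∀ s : CoCard V (p + 1), ∃ u w, ∃ h : u ≠ w, s = ⟨{u, w}, hpair h⟩ := by
    intro s
    have hs2 : s.1.card = 2 := by have := s.2; omega
    obtain ⟨u, w, h, hs⟩ := Finset.card_eq_two.mp hs2
    exact ⟨u, w, h, Subtype.ext hs⟩
  refine torDim_succ_eq (stanleyReisnerIdeal k (graphComplex G)) p L _ ?_ ?_ ?_
  · intro x
    rw [hcoc (L x) (localCocycle G x.1) fun u w h => by
      rw [hL x u w h, smul_smul, transSign_mul_self, one_smul]]
    exact fun u v w _ _ _ => (hgC x).cocycle u v w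
  · intro f hf
    let g : V → V → GraphRing G k := fun u w =>
      if h : u = w then 0 else transSign w u • f ⟨{u, w}, hpair h⟩
    have hg : ∀ u w, (h : u ≠ w) → g u w = transSign w u • f ⟨{u, w}, hpair h⟩ :=
      fun u w h => dif_neg h
    have hself : ∀ u, g u u = 0 := fun u => dif_pos rfl
    have hanti : ∀ u w, g u w = -g w u := by
      intro u w
      by_cases h : u = w
      · subst h; rw [hself, neg_zero]
      · rw [hg u w h, hg w u (Ne.symm h), transSign_swap h, neg_smul, neg_neg]
        congr 2
        exact Subtype.ext (Finset.pair_comm u w)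
    have hg2 : IsTwoCocycle g := by
      refine ⟨hself, hanti, fun u v w => ?_⟩
      by_cases huv : u = v
      · subst huv; simp [hself]
      by_cases hvw : v = w
      · subst hvw; simp [hself]
      by_cases huw : u = w
      · subst huw; rw [hanti v u, hself]; simp
      exact (hcoc f g hg).mp hf u v w huv huw hvw
    obtain ⟨x, hx, h, hxh⟩ := hg2.exists_localCocycle (by omega)
    refine ⟨⟨x, hx⟩, fun t => ∑ v ∈ t.1, h v, ?_⟩
    funext s
    obtain ⟨u, w, hne, rfl⟩ := htwo s
    rw [Pi.add_apply, hL _ u w hne, hcob _ hne]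
    have h1 : f ⟨{u, w}, hpair hne⟩ = transSign w u • g u w := by
      rw [hg u w hne, smul_smul, transSign_mul_self, one_smul]
    rw [h1, hxh u w, smul_add]
    simp only [Finset.sum_singleton]
  · intro x
    rw [mem_range_trivialLocal, ← localCocycle_eq_oneCoboundary_iff x.1 x.2]
    have hinj : ∀ (u w : V) {a b : GraphRing G k},
        transSign w u • a = transSign w u • b → a = b := fun u w a b h => by
      have := congrArg (fun z => transSign w u • z) h
      simpa only [smul_smul, transSign_mul_self, one_smul] using this
    constructor
    · rintro ⟨h, hh⟩
      refine ⟨fun x => h ⟨{x}, hsing x⟩, fun u w => ?_⟩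
      by_cases hne : u = w
      · subst hne
        rw [(hgC x).self, oneCoboundary, sub_self]
      · refine hinj u w ?_
        rw [← hL x u w hne, ← hcob h hne, hh]
    · rintro ⟨h, hh⟩
      refine ⟨fun t => ∑ v ∈ t.1, h v, ?_⟩
      funext s
      obtain ⟨u, w, hne, rfl⟩ := htwo s
      rw [hcob _ hne, hL x u w hne, hh u w]
      simp only [Finset.sum_singleton]

lemma torDim_graph_add (G : SimpleGraph V) (hG : G.Connected) {p : ℕ}
    (hp : p + 3 = Fintype.card V) :
    torDim (stanleyReisnerIdeal k (graphComplex G)) (p + 1) + 2 * Fintype.card V =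
      Module.finrank k (localCochains G k) + 1 := by
  have h1 := finrank_range_trivialLocal (k := k) hG (by omega)
  have h2 := Submodule.finrank_quotient_add_finrank (LinearMap.range (trivialLocal G k))
  rw [torDim_graph G hp]
  omega

end TorFormula

/-! ### The codimension of a graph -/

section Codim

lemma maxFaceCard_graphComplex_of_adj {V : Type u} (G : SimpleGraph V) {a b : V} (h : G.Adj a b) :
    maxFaceCard (graphComplex G) = 2 := by
  classical
  refine IsGreatest.csSup_eq
    ⟨⟨{a, b}, ⟨by simp, Finset.card_le_two, ?_⟩, Finset.card_pair h.ne⟩, ?_⟩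
  · rw [Finset.coe_pair, SimpleGraph.isClique_iff, Set.pairwise_pair]
    exact fun _ => ⟨h, h.symm⟩
  · rintro _ ⟨s, hs, rfl⟩
    exact hs.2.1

variable {V : Type u} [Fintype V] (G : SimpleGraph V)

lemma maxFaceCard_graphComplex_of_card_eq_one (h : Fintype.card V = 1) :
    maxFaceCard (graphComplex G) = 1 := by
  classical
  obtain ⟨v, hv⟩ := Fintype.card_eq_one_iff.mp h
  refine IsGreatest.csSup_eq ⟨⟨{v}, (graphComplex G).singleton_mem v, Finset.card_singleton v⟩, ?_⟩
  rintro _ ⟨s, hs, rfl⟩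
  rw [← h]
  exact Finset.card_le_univ s

variable {G}

lemma exists_adj_of_connected (hG : G.Connected) (h : 2 ≤ Fintype.card V) : ∃ a b, G.Adj a b := by
  obtain ⟨a, b, hab⟩ := Fintype.exists_pair_of_one_lt_card (α := V) (by omega)
  obtain ⟨p⟩ := hG.preconnected a b
  cases p with
  | nil => exact absurd rfl hab
  | cons hadj _ => exact ⟨_, _, hadj⟩

lemma codim_graphComplex (hG : G.Connected) :
    codim (graphComplex G) = Fintype.card V - 2 := by
  rw [codim, Nat.card_eq_fintype_card]
  rcases Nat.lt_or_ge (Fintype.card V) 2 with h | h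
  · obtain ⟨v⟩ := hG.nonempty
    have : 0 < Fintype.card V := Fintype.card_pos_iff.mpr ⟨v⟩
    rw [maxFaceCard_graphComplex_of_card_eq_one G (by omega)]
    omega
  · obtain ⟨a, b, hab⟩ := exists_adj_of_connected hG h
    rw [maxFaceCard_graphComplex_of_adj G hab]

end Codim

/-! ### The type defect of a connected graph -/

section LinearStrand

variable {V : Type u} (G : SimpleGraph V) (k : Type v) [Field k]

lemma mem_quotientDegreePart_sub_self {I : Ideal (MvPolynomial V k)} {p : ℕ}
    {a : MvPolynomial V k ⧸ I} (h : a ∈ quotientDegreePart I ((p : ℤ) - (p : ℤ))) :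
    ∃ r : k, a = Ideal.Quotient.mk I (C r) := by
  rw [sub_self] at h
  obtain ⟨q, hq, rfl⟩ := h
  have hq' : q.IsHomogeneous 0 := hq
  exact ⟨coeff 0 q, congrArg _ (totalDegree_eq_zero_iff_eq_C.mp
    ((totalDegree_zero_iff_isHomogeneous (p := q)).mpr hq'))⟩

lemma mk_one_ne_zero : (Ideal.Quotient.mk _ 1 : GraphRing G k) ≠ 0 := by
  classical
  intro h
  have := congrFun (congrArg (faceCoeff G k) h) 0
  rw [faceCoeff_mk, if_pos isFaceExponent_zero, coeff_zero_one, map_zero] at this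
  exact one_ne_zero this

lemma stanleyReisnerIdeal_le_irrelevantIdeal (Δ : AbstractSimplicialComplex V) :
    stanleyReisnerIdeal k Δ ≤ irrelevantIdeal V k := by
  refine Ideal.span_le.mpr ?_
  rintro _ ⟨s, ⟨w, hw⟩, -, rfl⟩
  exact Ideal.mem_of_dvd _ (Finset.dvd_prod_of_mem _ hw) (Ideal.subset_span ⟨w, rfl⟩)

lemma torDim_zero {I : Ideal (MvPolynomial V k)} (hI : I ≤ irrelevantIdeal V k) :
    torDim I 0 = 1 := by
  classical
  let R := MvPolynomial V k
  let m := irrelevantIdeal V k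
  let F := ModuleCat.restrictScalars.{max u v} (algebraMap k R)
  have hbot : I • (⊤ : Submodule R (R ⧸ m)) = ⊥ := by
    rw [eq_bot_iff, Submodule.smul_le]
    intro r hr n _
    obtain ⟨q, rfl⟩ := Ideal.Quotient.mk_surjective n
    exact Ideal.Quotient.eq_zero_iff_mem.mpr (Ideal.mul_mem_right _ _ (hI hr))
  let e1 : TensorProduct R (R ⧸ I) (R ⧸ m) ≃ₗ[R] (R ⧸ m) :=
    (TensorProduct.quotTensorEquivQuotSMul (R ⧸ m) I).trans (Submodule.quotEquivOfEqBot _ hbot)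
  let e2 : torModule I 0 ≅ ModuleCat.of R (R ⧸ m) :=
    (((MonoidalCategory.tensoringLeft (ModuleCat.{max u v} R)).obj
      (ModuleCat.of R (R ⧸ I))).leftDerivedZeroIsoSelf.app (ModuleCat.of R (R ⧸ m))) ≪≫
      e1.toModuleIso
  have e : torDim I 0 = Module.finrank k (F.obj (ModuleCat.of R (R ⧸ m))) :=
    (F.mapIso e2).toLinearEquiv.finrank_eq
  rw [e]
  have hne : (Ideal.Quotient.mk m 1) ≠ 0 := by
    intro h
    have h1 : m ≤ RingHom.ker (eval (fun _ : V => (0 : k))) := by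
      refine Ideal.span_le.mpr ?_
      rintro _ ⟨w, rfl⟩
      simp
    have := h1 (Ideal.Quotient.eq_zero_iff_mem.mp h)
    simp at this
  refine _root_.finrank_eq_one (M := F.obj (ModuleCat.of R (R ⧸ m))) (Ideal.Quotient.mk m 1) hne ?_
  intro q
  obtain ⟨p, rfl⟩ := Ideal.Quotient.mk_surjective (I := m) q
  have hp : ∃ r : k, p - C r ∈ m := by
    induction p using MvPolynomial.induction_on with
    | C a => exact ⟨a, by simp⟩
    | add p q hp hq =>
      obtain ⟨a, ha⟩ := hp
      obtain ⟨b, hb⟩ := hq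
      exact ⟨a + b, by rw [map_add, add_sub_add_comm]; exact m.add_mem ha hb⟩
    | mul_X p w _ =>
      exact ⟨0, by rw [map_zero, sub_zero]; exact m.mul_mem_left _ (Ideal.subset_span ⟨w, rfl⟩)⟩
  obtain ⟨r, hr⟩ := hp
  refine ⟨r, ?_⟩
  change Ideal.Quotient.mk m (C r * 1) = _
  rw [mul_one]
  exact ((Ideal.Quotient.mk_eq_mk_iff_sub_mem _ _).mpr hr).symm

variable [Fintype V]

/-- A Koszul cycle of degree `p + 1` in homological degree `p + 1` has constant coefficients, and
multiplication by the variables is injective on constants. -/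
lemma finrank_torDegree_succ (p : ℕ) :
    Module.finrank k (TorDegree (stanleyReisnerIdeal k (graphComplex G)) (p + 1) (p + 1)) = 0 := by
  classical
  have hsub : Subsingleton
      (koszulCycles (stanleyReisnerIdeal k (graphComplex G)) (p + 1) (p + 1)) := by
    refine ⟨fun a b => ?_⟩
    suffices h : ∀ a : koszulCycles (stanleyReisnerIdeal k (graphComplex G)) (p + 1) (p + 1),
        a.1 = 0 from Subtype.ext ((h a).trans (h b).symm)
    rintro ⟨f, ⟨-, hf⟩, hker⟩
    funext x
    have hC : ∀ x, ∃ r : k, f x = Ideal.Quotient.mk _ (C r) := fun x =>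
      mem_quotientDegreePart_sub_self k (hf x (Set.mem_univ x))
    choose r hr using hC
    have h1 := congrFun (LinearMap.mem_ker.mp hker) (Fin.tail x)
    change ∑ w : V, (X w : MvPolynomial V k) • f (Fin.cons w (Fin.tail x)) = 0 at h1
    -- the coefficient of `x_{x 0}` in the boundary at the remaining vertices of `x` is `f x`
    have h2 := congrFun (congrArg (faceCoeff G k) h1) (Finsupp.single (x 0) 1)
    rw [map_sum, Finset.sum_apply, map_zero, Pi.zero_apply,
      Finset.sum_eq_single_of_mem (x 0) (Finset.mem_univ _)] at h2
    · rw [Fin.cons_self_tail, faceCoeff_X_smul _ _ (isFaceExponent_single _ _), hr,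
        if_neg (by simp), tsub_self, faceCoeff_mk, if_pos isFaceExponent_zero, coeff_zero_C] at h2
      change f x = 0
      rw [hr, h2, map_zero, map_zero]
    · intro w _ hw
      rw [faceCoeff_X_smul _ _ (isFaceExponent_single _ _), if_pos (by simp [hw.symm])]
  have : Subsingleton (TorDegree (stanleyReisnerIdeal k (graphComplex G)) (p + 1) (p + 1)) :=
    (Submodule.Quotient.mk_surjective _).subsingleton
  exact Module.finrank_zero_of_subsingleton

lemma finrank_torDegree_zero :
    Module.finrank k (TorDegree (stanleyReisnerIdeal k (graphComplex G)) 0 0) = 1 := by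
  set I := stanleyReisnerIdeal k (graphComplex G) with hI
  have hmem : (fun _ => Ideal.Quotient.mk I 1 : (Fin 0 → V) → MvPolynomial V k ⧸ I) ∈
      koszulCycles I 0 0 := by
    refine ⟨⟨fun x hx => absurd (Function.injective_of_subsingleton x) hx, fun σ x => ?_⟩, ?_⟩
    · rw [Subsingleton.elim σ 1, Equiv.Perm.sign_one]
      simp
    · intro x _
      change _ ∈ quotientDegreePart I ((0 : ℕ) - (0 : ℕ) : ℤ)
      rw [sub_self]
      exact ⟨1, isHomogeneous_one V k, rfl⟩
  have hbd : koszulBoundaries I 0 0 = ⊥ := by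
    rw [eq_bot_iff]
    rintro _ ⟨f, hf, rfl⟩
    have hf0 : f = 0 := by
      funext x
      exact hf.2 x (Set.mem_univ x)
    rw [hf0, map_zero]
    exact Submodule.zero_mem _
  refine _root_.finrank_eq_one (Submodule.Quotient.mk ⟨_, hmem⟩) ?_ ?_
  · intro h
    rw [Submodule.Quotient.mk_eq_zero] at h
    have h' : (fun _ => Ideal.Quotient.mk I 1 : (Fin 0 → V) → MvPolynomial V k ⧸ I) ∈
      koszulBoundaries I 0 0 := h
    rw [hbd, Submodule.mem_bot] at h'
    exact mk_one_ne_zero G k (congrFun h' Fin.elim0)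
  · intro q
    obtain ⟨⟨f, hf⟩, rfl⟩ := Submodule.Quotient.mk_surjective _ q
    have hf' : f Fin.elim0 ∈ quotientDegreePart I ((0 : ℕ) - (0 : ℕ) : ℤ) :=
      hf.2 Fin.elim0 (Set.mem_univ _)
    obtain ⟨r, hr⟩ := mem_quotientDegreePart_sub_self k hf'
    refine ⟨r, ?_⟩
    rw [← Submodule.Quotient.mk_smul]
    congr 1
    refine Subtype.ext (funext fun x => ?_)
    change r • Ideal.Quotient.mk I 1 = f x
    rw [Subsingleton.elim x Fin.elim0, hr, ← mul_one (C r), ← smul_eq_C_mul]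
    rfl

variable {G}

/-- A connected graph with one or two vertices is a simplex, and its codimension is `0`. -/
lemma typeDefect_graphComplex_of_card_le_two (hG : G.Connected) (h : Fintype.card V ≤ 2) :
    typeDefect k (graphComplex G) = 0 := by
  have hc : codim (graphComplex G) = 0 := by rw [codim_graphComplex hG]; omega
  rw [typeDefect, modifiedType, hc, finrank_torDegree_zero,
    torDim_zero k (stanleyReisnerIdeal_le_irrelevantIdeal k _)]
  simp

/-- With `n` vertices the codimension is `n - 2`, and the trivial pairs form a space of dimension
`2 n - 1`; so the type defect is the dimension of the local cochains minus `3 n - 3`. -/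
lemma typeDefect_graphComplex_eq_zero_iff (hG : G.Connected) (h : 3 ≤ Fintype.card V) :
    typeDefect k (graphComplex G) = 0 ↔
      Module.finrank k (localCochains G k) + 3 = 3 * Fintype.card V := by
  obtain ⟨p, hp⟩ := Nat.exists_eq_add_of_le' h
  have hc : codim (graphComplex G) = p + 1 := by rw [codim_graphComplex hG]; omega
  have ht := torDim_graph_add (k := k) G hG hp.symm
  rw [typeDefect, modifiedType, hc, finrank_torDegree_succ]
  omega

end LinearStrand

/-! ### The space of local cochains under graph operations -/

section LocalDimension

variable {V : Type u} {k : Type v} [Field k]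

section Transport

variable {V' : Type*} {G : SimpleGraph V} {G' : SimpleGraph V'}

variable (k) in
lemma finrank_localCochains_le_of_iso [Finite V'] (e : G ≃g G') :
    Module.finrank k (localCochains G k) ≤ Module.finrank k (localCochains G' k) := by
  have : Finite V := Finite.of_equiv V' e.toEquiv.symm
  let F : localCochains G k →ₗ[k] localCochains G' k :=
    { toFun := fun x => ⟨(fun u w => x.1.1 (e.symm u) (e.symm w),
        fun u w => x.1.2 (e.symm u) (e.symm w)),
        fun _ _ => x.2.1 _ _, fun _ _ h => x.2.2.1 _ _ (by rwa [e.symm.map_adj_iff]),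
        fun _ => x.2.2.2.1 _, fun _ _ _ hv hw h => x.2.2.2.2 _ _ _
          (fun h => hv (e.symm.injective h)) (fun h => hw (e.symm.injective h))
          (by rwa [e.symm.map_adj_iff])⟩
      map_add' := fun _ _ => rfl
      map_smul' := fun _ _ => rfl }
  refine LinearMap.finrank_le_finrank_of_injective (f := F) fun x y hxy => ?_
  refine Subtype.ext (Prod.ext ?_ ?_) <;> funext u w
  · have := congrFun (congrFun (congrArg (fun z => z.1.1) hxy) (e u)) (e w)
    simpa [F] using this
  · have := congrFun (congrFun (congrArg (fun z => z.1.2) hxy) (e u)) (e w)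
    simpa [F] using this

variable (k) in
lemma finrank_localCochains_congr [Finite V'] (e : G ≃g G') :
    Module.finrank k (localCochains G k) = Module.finrank k (localCochains G' k) :=
  have : Finite V := Finite.of_equiv V' e.toEquiv.symm
  le_antisymm (finrank_localCochains_le_of_iso k e) (finrank_localCochains_le_of_iso k e.symm)

end Transport

section AddVertex

variable {G : SimpleGraph V} {N : Set V}

variable (k) in
/-- Restriction of `(α, β)` to the old vertices. -/
def restrictLocal (G : SimpleGraph V) (N : Set V) :
    localCochains (addVertex G N) k →ₗ[k] localCochains G k where
  toFun x := ⟨(fun u w => x.1.1 (some u) (some w), fun u w => x.1.2 (some u) (some w)),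
    fun _ _ => x.2.1 _ _, fun u w h => x.2.2.1 (some u) (some w) h,
    fun _ => x.2.2.2.1 _, fun u v w hv hw h => x.2.2.2.2 (some u) (some v) (some w)
      (fun h => hv (Option.some_injective _ h)) (fun h => hw (Option.some_injective _ h)) h⟩
  map_add' _ _ := rfl
  map_smul' _ _ := rfl

/-- Extension of a pair `(α, β)` to a new vertex with neighbourhood `N`: the values `a` of `α` on
the new edges and the constant value `c` of `β` at the new vertex are free; the value `d u` of
`β u ·` at the new vertex is prescribed as soon as `N` has an element other than `u`. -/
lemma exists_extend_local {x : (V → V → k) × (V → V → k)} (hx : x ∈ localCochains G k)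
    (a : V → k) (ha : ∀ u, u ∉ N → a u = 0) (c : k) (d : V → k)
    (hd : ∀ u, ∀ n ∈ N, n ≠ u → d u = x.2 u n) :
    ∃ y : localCochains (addVertex G N) k, (restrictLocal k G N y).1 = x ∧
      (∀ u, y.1.1 none (some u) = a u) ∧ (∀ u, y.1.2 none (some u) = c) ∧
      ∀ u, y.1.2 (some u) none = d u := by
  refine ⟨⟨(fun u w => match u, w with
      | some u, some w => x.1 u w
      | none, some w => a w
      | some u, none => -a u
      | none, none => 0,
    fun u w => match u, w with
      | some u, some w => x.2 u w
      | none, some _ => c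
      | some u, none => d u
      | none, none => 0), ?_, ?_, ?_, ?_⟩, rfl, fun _ => rfl, fun _ => rfl, fun _ => rfl⟩
  · rintro (_ | u) (_ | w)
    · exact neg_zero.symm
    · exact (neg_neg _).symm
    · rfl
    · exact hx.1 u w
  · rintro (_ | u) (_ | w) h
    · rfl
    · exact ha w h
    · change -a u = 0
      rw [ha u h, neg_zero]
    · exact hx.2.1 u w h
  · rintro (_ | u)
    · rfl
    · exact hx.2.2.1 u
  · rintro (_ | u) (_ | v) (_ | w) hv hw h
    · rfl
    · exact absurd rfl hv
    · exact absurd rfl hw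
    · rfl
    · rfl
    · exact hd u w h fun e => hw (congrArg some e)
    · exact (hd u v h fun e => hv (congrArg some e)).symm
    · exact hx.2.2.2 u v w (fun e => hv (congrArg some e)) (fun e => hw (congrArg some e)) h

lemma localCochains_none_const (hG : G.Connected) (y : localCochains (addVertex G N) k)
    (v w : V) : y.1.2 none (some v) = y.1.2 none (some w) := by
  obtain ⟨p⟩ := hG.preconnected v w
  induction p with
  | nil => rfl
  | cons h _ ih => exact (y.2.2.2.2 none (some _) (some _) (by simp) (by simp) h).trans ih

/-- The data of `exists_extend_local` determine the extension. -/
lemma localCochains_addVertex_ext {y z : localCochains (addVertex G N) k} (hG : G.Connected)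
    (v : V) (hr : restrictLocal k G N y = restrictLocal k G N z)
    (ha : ∀ u ∈ N, y.1.1 none (some u) = z.1.1 none (some u))
    (hc : y.1.2 none (some v) = z.1.2 none (some v))
    (hd : ∀ u, (∀ n ∈ N, n = u) → y.1.2 (some u) none = z.1.2 (some u) none) : y = z := by
  have hA : ∀ u, y.1.1 none (some u) = z.1.1 none (some u) := fun u => by
    by_cases h : u ∈ N
    · exact ha u h
    · rw [y.2.2.1 none (some u) h, z.2.2.1 none (some u) h]
  have hB : ∀ u w, y.1.2 (some u) (some w) = z.1.2 (some u) (some w) := fun u w =>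
    congrFun (congrFun (congrArg (fun t => t.1.2) hr) u) w
  refine Subtype.ext (Prod.ext ?_ ?_)
  · funext u w
    rcases u with _ | u <;> rcases w with _ | w
    · rw [y.2.2.1 none none (fun h => h), z.2.2.1 none none (fun h => h)]
    · exact hA w
    · rw [y.2.1, z.2.1, hA]
    · exact congrFun (congrFun (congrArg (fun t => t.1.1) hr) u) w
  · funext u w
    rcases u with _ | u <;> rcases w with _ | w
    · rw [y.2.2.2.1, z.2.2.2.1]
    · rw [localCochains_none_const hG y w v, localCochains_none_const hG z w v, hc]
    · by_cases h : ∀ n ∈ N, n = u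
      · exact hd u h
      · push Not at h
        obtain ⟨n, hn, hne⟩ := h
        have hne' : (some n : Option V) ≠ some u := fun e => hne (Option.some_injective _ e)
        rw [y.2.2.2.2 (some u) none (some n) (by simp) hne' hn,
          z.2.2.2.2 (some u) none (some n) (by simp) hne' hn, hB]
    · exact hB u w

/-- The new dimensions are the value of `α` on the new edge, the value of `β` at the new vertex,
and the value of `β v ·` at the new vertex, which deleting `v` isolates. -/
lemma finrank_localCochains_addPendant [Finite V] (hG : G.Connected) (v : V) :
    Module.finrank k (localCochains (addVertex G {v}) k) =
      Module.finrank k (localCochains G k) + 3 := by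
  classical
  let F : localCochains (addVertex G {v}) k →ₗ[k] localCochains G k × (k × k × k) :=
    { toFun := fun y => (restrictLocal k G _ y,
        (y.1.1 none (some v), y.1.2 none (some v), y.1.2 (some v) none))
      map_add' := fun _ _ => rfl
      map_smul' := fun _ _ => rfl }
  have hF : Function.Bijective F := by
    constructor
    · intro y z h
      refine localCochains_addVertex_ext hG v (congrArg Prod.fst h) ?_
        (congrArg (fun t => t.2.2.1) h) ?_
      · rintro u rfl
        exact congrArg (fun t => t.2.1) h
      · intro u hu
        obtain rfl := hu v rfl
        exact congrArg (fun t => t.2.2.2) h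
    · rintro ⟨⟨x, hx⟩, a, c, d⟩
      obtain ⟨y, hr, ha, hc, hd⟩ := exists_extend_local (N := {v}) hx
        (fun u => if u = v then a else 0) (fun u hu => if_neg hu) c
        (fun u => if u = v then d else x.2 u v) (by
          rintro u n rfl hne
          exact if_neg hne.symm)
      exact ⟨y, Prod.ext (Subtype.ext hr) (Prod.ext ((ha v).trans (if_pos rfl))
        (Prod.ext (hc v) ((hd v).trans (if_pos rfl))))⟩
  rw [(LinearEquiv.ofBijective F hF).finrank_eq, Module.finrank_prod, Module.finrank_prod,
    Module.finrank_prod, Module.finrank_self]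

/-- The new dimensions are the values of `α` on the two new edges and the value of `β` at the new
vertex. -/
lemma finrank_localCochains_addTriangle [Finite V] (hG : G.Connected) {v w : V} (h : G.Adj v w) :
    Module.finrank k (localCochains (addVertex G {v, w}) k) =
      Module.finrank k (localCochains G k) + 3 := by
  classical
  let F : localCochains (addVertex G {v, w}) k →ₗ[k] localCochains G k × (k × k × k) :=
    { toFun := fun y => (restrictLocal k G _ y,
        (y.1.1 none (some v), y.1.1 none (some w), y.1.2 none (some v)))
      map_add' := fun _ _ => rfl
      map_smul' := fun _ _ => rfl }
  have hF : Function.Bijective F := by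
    constructor
    · intro y z h'
      refine localCochains_addVertex_ext hG v (congrArg Prod.fst h') ?_
        (congrArg (fun t => t.2.2.2) h') ?_
      · rintro u (rfl | rfl)
        · exact congrArg (fun t => t.2.1) h'
        · exact congrArg (fun t => t.2.2.1) h'
      · intro u hu
        exact absurd ((hu v (by simp)).trans (hu w (by simp)).symm) h.ne
    · rintro ⟨⟨x, hx⟩, a, a', c⟩
      obtain ⟨y, hr, ha, hc, hd⟩ := exists_extend_local (N := {v, w}) hx
        (fun u => if u = v then a else if u = w then a' else 0) (fun u hu => by
          simp only [Set.mem_insert_iff, Set.mem_singleton_iff, not_or] at hu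
          rw [if_neg hu.1, if_neg hu.2]) c
        (fun u => if u = v then x.2 u w else x.2 u v) (by
          rintro u n (rfl | rfl) hne
          · exact if_neg hne.symm
          · split_ifs with hu
            · rfl
            · exact hx.2.2.2 u v n (Ne.symm hu) hne h)
      exact ⟨y, Prod.ext (Subtype.ext hr) (Prod.ext ((ha v).trans (if_pos rfl))
        (Prod.ext ((ha w).trans ((if_neg h.ne.symm).trans (if_pos rfl))) (hc v)))⟩
  rw [(LinearEquiv.ofBijective F hF).finrank_eq, Module.finrank_prod, Module.finrank_prod,
    Module.finrank_prod, Module.finrank_self]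

end AddVertex

section SmallGraphs

lemma finrank_localCochains_of_subsingleton [Subsingleton V] (G : SimpleGraph V) :
    Module.finrank k (localCochains G k) = 0 := by
  have : Subsingleton (localCochains G k) := by
    refine ⟨fun x y => Subtype.ext (Prod.ext ?_ ?_)⟩ <;> funext u w <;>
      obtain rfl := Subsingleton.elim u w
    · rw [x.2.2.1 u u G.irrefl, y.2.2.1 u u G.irrefl]
    · rw [x.2.2.2.1, y.2.2.2.1]
  exact Module.finrank_zero_of_subsingleton

open scoped Fin.CommRing in
/-- Deleting a vertex from a cycle leaves a path, which is connected; so `(α, β)` is determined by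
the values of `α` on the `m` edges and one value of `β` at each vertex. -/
lemma finrank_localCochains_cycleGraph_le (m : ℕ) (hm : 4 ≤ m) :
    Module.finrank k (localCochains (SimpleGraph.cycleGraph m) k) ≤ 2 * m := by
  obtain ⟨n, rfl⟩ := Nat.exists_eq_add_of_le' (show 2 ≤ m by omega)
  let F : localCochains (SimpleGraph.cycleGraph (n + 2)) k →ₗ[k]
      (Fin (n + 2) → k) × (Fin (n + 2) → k) :=
    { toFun := fun x => (fun i => x.1.1 i (i + 1), fun i => x.1.2 i (i + 1))
      map_add' := fun _ _ => rfl
      map_smul' := fun _ _ => rfl }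
  have hF : Function.Injective F := by
    rw [← LinearMap.ker_eq_bot, LinearMap.ker_eq_bot']
    intro x hx
    have hα : ∀ i, x.1.1 i (i + 1) = 0 := fun i => congrFun (congrArg Prod.fst hx) i
    have hβ : ∀ i, x.1.2 i (i + 1) = 0 := fun i => congrFun (congrArg Prod.snd hx) i
    refine Subtype.ext (Prod.ext ?_ ?_) <;> funext i j
    · change x.1.1 i j = 0
      by_cases h : (SimpleGraph.cycleGraph (n + 2)).Adj i j
      · rcases SimpleGraph.cycleGraph_adj.mp h with h | h
        · obtain rfl : i = j + 1 := by rw [← h]; abel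
          rw [x.2.1, hα, neg_zero]
        · obtain rfl : j = i + 1 := by rw [← h]; abel
          exact hα i
      · exact x.2.2.1 i j h
    · change x.1.2 i j = 0
      have hne : ∀ t : ℕ, t + 1 < n + 2 → i + 1 + (t : Fin (n + 2)) ≠ i := by
        intro t ht h
        have h1 : ((t + 1 : ℕ) : Fin (n + 2)) = 0 := by
          push_cast
          linear_combination h
        rw [Fin.natCast_eq_zero] at h1
        exact absurd (Nat.le_of_dvd (by omega) h1) (by omega)
      -- walk along the path obtained from the cycle by deleting `i`
      have key : ∀ t : ℕ, t + 1 < n + 2 → x.1.2 i (i + 1 + (t : Fin (n + 2))) = 0 := by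
        intro t
        induction t with
        | zero => intro _; simpa using hβ i
        | succ t ih =>
          intro ht
          rw [← ih (by omega)]
          refine x.2.2.2.2 i _ _ (hne _ ht) (hne _ (by omega)) ?_
          rw [SimpleGraph.cycleGraph_adj]
          left
          push_cast
          ring
      by_cases hij : j = i
      · subst hij; exact x.2.2.2.1 j
      · have hlt : (j - i - 1).val + 1 < n + 2 := by
          by_contra hge
          have h1 : (j - i - 1).val = n + 1 := by have := (j - i - 1).isLt; omega
          have h2 : j - i - 1 = Fin.last (n + 1) := Fin.ext h1
          have h3 : (Fin.last (n + 1) : Fin (n + 2)) = -1 := by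
            rw [eq_neg_iff_add_eq_zero, Fin.last_add_one]
          rw [h3] at h2
          exact hij (by linear_combination h2)
        have := key _ hlt
        rw [Fin.cast_val_eq_self] at this
        rwa [show i + 1 + (j - i - 1) = j by ring] at this
  calc Module.finrank k (localCochains (SimpleGraph.cycleGraph (n + 2)) k)
      ≤ Module.finrank k ((Fin (n + 2) → k) × (Fin (n + 2) → k)) :=
        LinearMap.finrank_le_finrank_of_injective hF
    _ = 2 * (n + 2) := by
        rw [Module.finrank_prod, Module.finrank_fintype_fun_eq_card, Fintype.card_fin]; ring

/-- On `K₄` there are `6` edges, and the `β u ·` that are constant off `u` account for `4`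
dimensions. -/
lemma le_finrank_localCochains_top :
    10 ≤ Module.finrank k (localCochains (⊤ : SimpleGraph (Fin 4)) k) := by
  let P := {p : Fin 4 × Fin 4 // p.1 < p.2}
  let F : ((P → k) × (Fin 4 → k)) →ₗ[k] localCochains (⊤ : SimpleGraph (Fin 4)) k :=
    { toFun := fun y => ⟨(fun i j => if h : i < j then y.1 ⟨(i, j), h⟩ else
          if h : j < i then -y.1 ⟨(j, i), h⟩ else 0, fun i j => if i = j then 0 else y.2 i), by
        refine ⟨fun i j => ?_, fun i j h => ?_, fun i => if_pos rfl, fun i j l hj hl _ => ?_⟩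
        · simp only
          rcases lt_trichotomy i j with h | h | h
          · simp [h, h.not_gt]
          · simp [h]
          · simp [h, h.not_gt]
        · obtain rfl : i = j := by simpa using h
          simp
        · simp only [if_neg hj.symm, if_neg hl.symm]⟩
      map_add' := fun y z => by
        refine Subtype.ext (Prod.ext ?_ ?_) <;> funext i j
        · simp only [Submodule.coe_add, Prod.fst_add, Pi.add_apply]
          split_ifs <;> ring
        · simp only [Submodule.coe_add, Prod.snd_add, Pi.add_apply]
          split_ifs <;> ring
      map_smul' := fun c y => by
        refine Subtype.ext (Prod.ext ?_ ?_) <;> funext i j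
        · simp only [Submodule.coe_smul, Prod.smul_fst, Pi.smul_apply, smul_eq_mul,
            RingHom.id_apply]
          split_ifs <;> ring
        · simp only [Submodule.coe_smul, Prod.smul_snd, Pi.smul_apply, smul_eq_mul,
            RingHom.id_apply]
          split_ifs <;> ring }
  have hF : Function.Injective F := by
    rw [← LinearMap.ker_eq_bot, LinearMap.ker_eq_bot']
    intro y hy
    refine Prod.ext ?_ ?_
    · funext ⟨⟨i, j⟩, h⟩
      have := congrFun (congrFun (congrArg (fun t => t.1.1) hy) i) j
      simpa [F, show i < j from h] using this
    · funext i
      have := congrFun (congrFun (congrArg (fun t => t.1.2) hy) i) (i + 1)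
      simpa [F] using this
  have hP : Fintype.card P = 6 := by decide
  calc 10 = Module.finrank k ((P → k) × (Fin 4 → k)) := by
        rw [Module.finrank_prod, Module.finrank_fintype_fun_eq_card,
          Module.finrank_fintype_fun_eq_card, hP, Fintype.card_fin]
    _ ≤ _ := LinearMap.finrank_le_finrank_of_injective hF

end SmallGraphs

end LocalDimension

/-! ### Simplicial vertices of chordal graphs -/

section Chordal

variable {V : Type u} {G : SimpleGraph V}

lemma IsChordal.of_embedding {V' : Type*} {G' : SimpleGraph V'} (h : IsChordal G)
    (f : G' ↪g G) : IsChordal G' :=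
  fun m hm => ⟨fun e => (h m hm).false (e.trans f)⟩

lemma cycleGraph_adj_iff_val {m : ℕ} (hm : 2 ≤ m) {i j : Fin m} :
    (SimpleGraph.cycleGraph m).Adj i j ↔ i.val + 1 = j.val ∨ j.val + 1 = i.val ∨
      (i.val = 0 ∧ j.val + 1 = m) ∨ (j.val = 0 ∧ i.val + 1 = m) := by
  rw [SimpleGraph.cycleGraph_adj']
  have hsub : ∀ a b : Fin m, (a - b).val = if b.val ≤ a.val then a.val - b.val
      else m + a.val - b.val := by
    intro a b
    have ha := a.isLt
    have hb := b.isLt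
    rw [Fin.sub_def]
    change (m - b.val + a.val) % m = _
    split_ifs with h
    · rw [show m - b.val + a.val = (a.val - b.val) + m by omega, Nat.add_mod_right,
        Nat.mod_eq_of_lt (by omega)]
    · rw [Nat.mod_eq_of_lt (by omega)]
      omega
  rw [hsub, hsub]
  have hi := i.isLt
  have hj := j.isLt
  split_ifs <;> omega

/-- A shortest path, as a sequence of vertices `p 0, …, p d`: the vertices are distinct, and
adjacent ones are consecutive. -/
lemma exists_geodesic {H : SimpleGraph V} {a b : V} (h : H.Reachable a b) :
    ∃ p : ℕ → V, p 0 = a ∧ p (H.dist a b) = b ∧ (∀ i < H.dist a b, H.Adj (p i) (p (i + 1))) ∧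
      (∀ i ≤ H.dist a b, ∀ j ≤ H.dist a b, p i = p j → i = j) ∧
      ∀ i ≤ H.dist a b, ∀ j ≤ H.dist a b, H.Adj (p i) (p j) → i ≤ j + 1 := by
  obtain ⟨w, hw⟩ := h.exists_walk_length_eq_dist
  have hdist : ∀ i ≤ H.dist a b, H.dist a (w.getVert i) = i := by
    intro i hi
    have h1 : H.dist a (w.getVert i) ≤ i :=
      (SimpleGraph.dist_le (w.take i)).trans (by rw [SimpleGraph.Walk.take_length]; omega)
    have h2 : H.dist (w.getVert i) b ≤ H.dist a b - i :=
      (SimpleGraph.dist_le (w.drop i)).trans (by rw [SimpleGraph.Walk.drop_length, hw])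
    obtain ⟨q, hq⟩ := (w.take i).reachable.exists_walk_length_eq_dist
    obtain ⟨r, hr⟩ := (w.drop i).reachable.exists_walk_length_eq_dist
    have h3 := SimpleGraph.dist_le (q.append r)
    rw [SimpleGraph.Walk.length_append, hq, hr] at h3
    omega
  refine ⟨w.getVert, w.getVert_zero, ?_, ?_, ?_, ?_⟩
  · rw [← hw]; exact w.getVert_length
  · intro i hi
    exact w.adj_getVert_succ (by omega)
  · intro i hi j hj hij
    rw [← hdist i hi, hij, hdist j hj]
  · intro i hi j hj hadj
    obtain ⟨q, hq⟩ := (w.take j).reachable.exists_walk_length_eq_dist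
    have h3 := SimpleGraph.dist_le (q.concat hadj.symm)
    rw [SimpleGraph.Walk.length_concat, hq, hdist i hi, hdist j hj] at h3
    exact h3

/-- The subgraph of the edges of `G` with both ends in `R`, on the same vertex set. -/
def restrictTo (G : SimpleGraph V) (R : Set V) : SimpleGraph V where
  Adj x y := G.Adj x y ∧ x ∈ R ∧ y ∈ R
  symm := ⟨fun _ _ h => ⟨h.1.symm, h.2.2, h.2.1⟩⟩
  loopless := ⟨fun _ h => G.irrefl h.1⟩

lemma mem_of_reachable_restrictTo {R : Set V} {u x : V} (hu : u ∈ R)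
    (h : (restrictTo G R).Reachable u x) : x ∈ R := by
  obtain ⟨p⟩ := h
  induction p with
  | nil => exact hu
  | cons hadj _ ih => exact ih hadj.2.2

lemma restrictTo_mono {R R' : Set V} (h : R ⊆ R') : restrictTo G R ≤ restrictTo G R' :=
  fun _ _ hxy => ⟨hxy.1, h hxy.2.1, h hxy.2.2⟩

/-- Two neighbours `a`, `b` of `v` that are joined by a path through non-neighbours of `v` are
adjacent: otherwise `v` and a shortest such path form an induced cycle of length at least four. -/
lemma IsChordal.adj_of_common_neighbor (hG : IsChordal G) {v a b : V} {C : Set V}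
    (hva : G.Adj v a) (hvb : G.Adj v b) (hab : a ≠ b) (hvC : ∀ c ∈ C, c ≠ v ∧ ¬ G.Adj v c)
    (hr : (restrictTo G (C ∪ {a, b})).Reachable a b) : G.Adj a b := by
  by_contra hnadj
  set H := restrictTo G (C ∪ {a, b}) with hH
  obtain ⟨p, hp0, hpL, hstep, hinj, hadj⟩ := exists_geodesic hr
  set L := H.dist a b with hL
  have hmemR : ∀ i ≤ L, p i ∈ C ∪ {a, b} := by
    intro i
    induction i with
    | zero => intro _; rw [hp0]; simp
    | succ i _ => intro hi; exact (hstep i hi).2.2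
  have hL2 : 2 ≤ L := by
    have h0 : L ≠ 0 := fun h => hab (by rw [← hp0, ← hpL, h])
    have h1 : L ≠ 1 := fun h => hnadj (by
      have := (hstep 0 (by omega)).1
      rwa [zero_add, ← h, hp0, hpL] at this)
    omega
  have hvp : ∀ i ≤ L, p i ≠ v ∧ (G.Adj v (p i) ↔ i = 0 ∨ i = L) := by
    intro i hi
    rcases hmemR i hi with hc | rfl | hb
    · refine ⟨(hvC _ hc).1, fun h => absurd h (hvC _ hc).2, ?_⟩
      rintro (rfl | rfl)
      · rwa [hp0]
      · rwa [hpL]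
    · have : i = 0 := hinj i hi 0 (by omega) hp0.symm
      exact ⟨hva.ne.symm, fun _ => Or.inl this, fun _ => hva⟩
    · have hb' : p i = b := hb
      have : i = L := hinj i hi L le_rfl (hb'.trans hpL.symm)
      rw [hb']
      exact ⟨hvb.ne.symm, by simp [this, hvb]⟩
  have hpp : ∀ i ≤ L, ∀ j ≤ L, (G.Adj (p i) (p j) ↔ i + 1 = j ∨ j + 1 = i) := by
    intro i hi j hj
    constructor
    · intro h
      have h1 := hadj i hi j hj ⟨h, hmemR i hi, hmemR j hj⟩
      have h2 := hadj j hj i hi ⟨h.symm, hmemR j hj, hmemR i hi⟩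
      have h3 : i ≠ j := by rintro rfl; exact G.irrefl h
      omega
    · rintro (rfl | rfl)
      · exact (hstep i (by omega)).1
      · exact (hstep j (by omega)).1.symm
  -- the induced cycle `p 0, …, p L, v`
  refine (hG (L + 2) (by omega)).false
    ⟨⟨fun i => if i.val ≤ L then p i.val else v, ?_⟩, ?_⟩
  · intro i j hij
    have hi := i.isLt
    have hj := j.isLt
    simp only at hij
    refine Fin.ext ?_
    split_ifs at hij with h1 h2 h2
    · exact hinj _ h1 _ h2 hij
    · exact absurd hij (hvp _ h1).1
    · exact absurd hij.symm (hvp _ h2).1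
    · omega
  · intro i j
    have hi := i.isLt
    have hj := j.isLt
    rw [cycleGraph_adj_iff_val (by omega)]
    change G.Adj (if i.val ≤ L then p i.val else v) (if j.val ≤ L then p j.val else v) ↔ _
    split_ifs with h1 h2 h2
    · rw [hpp _ h1 _ h2]; omega
    · rw [G.adj_comm, (hvp _ h1).2]; omega
    · rw [(hvp _ h2).2]; omega
    · simp only [SimpleGraph.irrefl, false_iff]; omega

/-- The neighbours of `z` in `W` form a clique. (The vertex `z` need not belong to `W`.) -/
def IsSimplicialIn (G : SimpleGraph V) (W : Finset V) (z : V) : Prop :=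
  ∀ a ∈ W, ∀ b ∈ W, G.Adj z a → G.Adj z b → a ≠ b → G.Adj a b

/-- The induction behind Dirac's theorem: if `v` is not adjacent to all other vertices of `W`,
then some simplicial vertex of `W` other than `v` is a non-neighbour of `v`. Let `C` be a
component of the non-neighbours of `v` in `W` and `S` the set of its neighbours in `W` outside
`C`. The vertices of `S` are adjacent to `v`, so they form a clique, and the induction hypothesis
applies to `C ∪ S`, which does not contain `v`. -/
lemma IsChordal.exists_simplicial_aux (hG : IsChordal G) (n : ℕ) :
    ∀ W : Finset V, W.card = n → ∀ v ∈ W, ∀ u ∈ W, u ≠ v → ¬ G.Adj v u →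
      ∃ z ∈ W, z ≠ v ∧ ¬ G.Adj v z ∧ IsSimplicialIn G W z := by
  classical
  induction n using Nat.strong_induction_on with
  | _ n ih =>
  intro W hW v hv u hu huv hnadj
  have hB : ∀ T : Finset V, T.card < n → T.Nonempty → ∃ z ∈ T, IsSimplicialIn G T z := by
    rintro T hT ⟨t, ht⟩
    by_cases h : ∃ x ∈ T, ∃ y ∈ T, y ≠ x ∧ ¬ G.Adj x y
    · obtain ⟨x, hx, y, hy, hne, hn⟩ := h
      obtain ⟨z, hz, -, -, hs⟩ := ih _ hT T rfl x hx y hy hne hn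
      exact ⟨z, hz, hs⟩
    · push Not at h
      exact ⟨t, ht, fun a ha b hb _ _ hab => h a ha b hb hab.symm⟩
  -- `C` is the component of `u` among the non-neighbours of `v`, and `S` is the boundary of `C`.
  set R : Set V := {x | x ∈ W ∧ x ≠ v ∧ ¬ G.Adj v x} with hR
  have huR : u ∈ R := ⟨hu, huv, hnadj⟩
  set C : Finset V := W.filter fun x => (restrictTo G R).Reachable u x with hC
  have hCR : ∀ c ∈ C, c ∈ R := fun c hc =>
    mem_of_reachable_restrictTo huR (Finset.mem_filter.mp hc).2
  have huC : u ∈ C := Finset.mem_filter.mpr ⟨hu, SimpleGraph.Reachable.refl u⟩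
  have hCreach : ∀ c ∈ C, (restrictTo G (C : Set V)).Reachable u c := by
    intro c hc
    obtain ⟨p⟩ := (Finset.mem_filter.mp hc).2
    have key : ∀ {x y : V} (p : (restrictTo G R).Walk x y), x ∈ C →
        (restrictTo G (C : Set V)).Reachable x y := by
      intro x y p
      induction p with
      | nil => intro _; exact SimpleGraph.Reachable.refl _
      | @cons x x' y hadj q ihq =>
        intro hx
        have hx' : x' ∈ C := Finset.mem_filter.mpr
          ⟨hadj.2.2.1, (Finset.mem_filter.mp hx).2.trans hadj.reachable⟩
        have hstep : (restrictTo G (C : Set V)).Adj x x' := ⟨hadj.1, hx, hx'⟩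
        exact hstep.reachable.trans (ihq hx')
    exact key p huC
  set S : Finset V := W.filter fun s => s ∉ C ∧ ∃ c ∈ C, G.Adj s c with hS
  have hvS : ∀ s ∈ S, G.Adj v s := by
    intro s hs
    obtain ⟨hsW, hsC, c, hc, hsc⟩ := Finset.mem_filter.mp hs
    by_contra hn
    have hsv : s ≠ v := by
      rintro rfl
      exact (hCR c hc).2.2 hsc
    have hsR : s ∈ R := ⟨hsW, hsv, hn⟩
    have hadj : (restrictTo G R).Adj c s := ⟨hsc.symm, hCR c hc, hsR⟩
    exact hsC (Finset.mem_filter.mpr ⟨hsW, (Finset.mem_filter.mp hc).2.trans hadj.reachable⟩)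
  have hSclique : ∀ a ∈ S, ∀ b ∈ S, a ≠ b → G.Adj a b := by
    intro a ha b hb hab
    obtain ⟨-, -, c, hc, hac⟩ := Finset.mem_filter.mp ha
    obtain ⟨-, -, d, hd, hbd⟩ := Finset.mem_filter.mp hb
    refine hG.adj_of_common_neighbor (C := (C : Set V)) (hvS a ha) (hvS b hb) hab
      (fun c hc => (hCR c hc).2) ?_
    have h1 : (restrictTo G ((C : Set V) ∪ {a, b})).Adj a c := ⟨hac, by simp, Or.inl hc⟩
    have h2 : (restrictTo G ((C : Set V) ∪ {a, b})).Adj d b := ⟨hbd.symm, Or.inl hd, by simp⟩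
    have h3 : (restrictTo G ((C : Set V) ∪ {a, b})).Reachable c d :=
      ((hCreach c hc).symm.trans (hCreach d hd)).mono (restrictTo_mono Set.subset_union_left)
    exact h1.reachable.trans (h3.trans h2.reachable)
  have hCW : C ⊆ W := Finset.filter_subset _ _
  have hTW : C ∪ S ⊆ W := Finset.union_subset hCW (Finset.filter_subset _ _)
  have hTv : v ∉ C ∪ S := by
    rw [Finset.mem_union, not_or]
    exact ⟨fun h => (hCR v h).2.1 rfl, fun h => G.irrefl (hvS v h)⟩
  have hTcard : (C ∪ S).card < n := by
    rw [← hW]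
    exact Finset.card_lt_card ⟨hTW, fun h => hTv (h hv)⟩
  have hnbr : ∀ c ∈ C, ∀ y ∈ W, G.Adj c y → y ∈ C ∪ S := by
    intro c hc y hy hadj
    by_cases hyC : y ∈ C
    · exact Finset.mem_union_left _ hyC
    · exact Finset.mem_union_right _ (Finset.mem_filter.mpr ⟨hy, hyC, c, hc, hadj.symm⟩)
  have hlift : ∀ c ∈ C, IsSimplicialIn G (C ∪ S) c → IsSimplicialIn G W c :=
    fun c hc h a ha b hb hca hcb => h a (hnbr c hc a ha hca) b (hnbr c hc b hb hcb) hca hcb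
  -- If some `s ∈ S` is not adjacent to all of `C ∪ S`, a simplicial vertex of `C ∪ S` not adjacent
  -- to `s` lies in `C`. Otherwise a simplicial vertex of `C` is simplicial in `C ∪ S`.
  by_cases hex : ∃ s ∈ S, ∃ t ∈ C ∪ S, t ≠ s ∧ ¬ G.Adj s t
  · obtain ⟨s, hs, t, ht, hne, hn⟩ := hex
    obtain ⟨z, hz, hzs, hnz, hsim⟩ :=
      ih _ hTcard (C ∪ S) rfl s (Finset.mem_union_right _ hs) t ht hne hn
    have hzC : z ∈ C := by
      rcases Finset.mem_union.mp hz with h | h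
      · exact h
      · exact absurd (hSclique s hs z h hzs.symm) hnz
    exact ⟨z, hCW hzC, (hCR z hzC).2.1, (hCR z hzC).2.2, hlift z hzC hsim⟩
  · push Not at hex
    obtain ⟨z, hz, hsim⟩ := hB C
      ((Finset.card_le_card Finset.subset_union_left).trans_lt hTcard) ⟨u, huC⟩
    refine ⟨z, hCW hz, (hCR z hz).2.1, (hCR z hz).2.2, hlift z hz ?_⟩
    intro a ha b hb hza hzb hab
    by_cases haS : a ∈ S
    · exact hex a haS b hb hab.symm
    · by_cases hbS : b ∈ S
      · exact (hex b hbS a ha hab).symm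
      · exact hsim a ((Finset.mem_union.mp ha).resolve_right haS) b
          ((Finset.mem_union.mp hb).resolve_right hbS) hza hzb hab

/-- Dirac's theorem: every nonempty induced subgraph of a chordal graph has a simplicial vertex. -/
theorem IsChordal.exists_isSimplicialIn (hG : IsChordal G) {W : Finset V} (hW : W.Nonempty) :
    ∃ z ∈ W, IsSimplicialIn G W z := by
  obtain ⟨t, ht⟩ := hW
  by_cases h : ∃ x ∈ W, ∃ y ∈ W, y ≠ x ∧ ¬ G.Adj x y
  · obtain ⟨x, hx, y, hy, hne, hn⟩ := h
    obtain ⟨z, hz, -, -, hs⟩ := hG.exists_simplicial_aux _ W rfl x hx y hy hne hn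
    exact ⟨z, hz, hs⟩
  · push Not at h
    exact ⟨t, ht, fun a ha b hb _ _ hab => h a ha b hb hab.symm⟩

end Chordal

/-! ### Treeish graphs are the connected chordal graphs without `K₄` -/

section Treeish

lemma addVertex_top_univ {V : Type u} : addVertex (⊤ : SimpleGraph V) Set.univ = ⊤ := by
  ext u w
  rcases u with _ | u <;> rcases w with _ | w
  · exact ⟨fun h => h.elim, fun h => (h rfl).elim⟩
  · exact ⟨fun _ => Option.some_ne_none w ∘ Eq.symm, fun _ => Set.mem_univ w⟩
  · exact ⟨fun _ => Option.some_ne_none u, fun _ => Set.mem_univ u⟩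
  · exact ⟨fun h e => h (Option.some_injective _ e), fun h e => h (congrArg some e)⟩

lemma exists_iso_top_fin {V : Type u} (n : ℕ) [Fintype V] (h : Fintype.card V = n) :
    Nonempty ((⊤ : SimpleGraph (Fin n)) ≃g (⊤ : SimpleGraph V)) :=
  ⟨SimpleGraph.Iso.completeGraph (Fintype.equivOfCardEq (by simp [h]))⟩

/-- Treeish graphs all arise from a single vertex by the two extension steps, as the edge is a
pendant extension of a vertex and the triangle an extension of an edge. So a property of treeish
graphs needs only one starting case. -/
theorem IsTreeish.induction_from_vertex {Q : ∀ {V : Type u}, SimpleGraph V → Prop}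
    (single : Q (⊤ : SimpleGraph PUnit.{u + 1}))
    (pendant : ∀ {V V' : Type u} {G : SimpleGraph V} {G' : SimpleGraph V'} (v : V), Q G →
      (G' ≃g addVertex G {v}) → Q G')
    (triangle : ∀ {V V' : Type u} {G : SimpleGraph V} {G' : SimpleGraph V'} (v w : V),
      G.Adj v w → Q G → (G' ≃g addVertex G {v, w}) → Q G')
    {V : Type u} {G : SimpleGraph V} (h : IsTreeish G) : Q G := by
  have hedge : ∀ {V : Type u} {G : SimpleGraph V}, Nonempty (G ≃g (⊤ : SimpleGraph (Fin 2))) →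
      Q G := by
    rintro V G ⟨e⟩
    obtain ⟨f⟩ := exists_iso_top_fin (V := Option PUnit.{u + 1}) 2 (by simp)
    have h1 : addVertex (⊤ : SimpleGraph PUnit.{u + 1}) {PUnit.unit} = ⊤ := by
      rw [show ({PUnit.unit} : Set PUnit.{u + 1}) = Set.univ from
        Set.eq_univ_of_forall fun _ => rfl]
      exact addVertex_top_univ
    refine pendant PUnit.unit single ?_
    rw [h1]
    exact e.trans f
  induction h with
  | edge e => exact hedge e
  | triangle e =>
    obtain ⟨e⟩ := e
    obtain ⟨f⟩ := exists_iso_top_fin (V := Option (Option PUnit.{u + 1})) 3 (by simp)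
    obtain ⟨f2⟩ := exists_iso_top_fin (V := Option PUnit.{u + 1}) 2 (by simp)
    have h1 : addVertex (⊤ : SimpleGraph (Option PUnit.{u + 1})) {none, some PUnit.unit} = ⊤ := by
      rw [show ({none, some PUnit.unit} : Set (Option PUnit.{u + 1})) = Set.univ by
        ext x
        rcases x with _ | ⟨⟨⟩⟩ <;> simp]
      exact addVertex_top_univ
    refine triangle none (some PUnit.unit) (by simp) (hedge ⟨f2.symm⟩) ?_
    rw [h1]
    exact e.trans f
  | addPendant _ v e ih => exact e.elim fun e => pendant v ih e
  | addTriangle _ v w hvw e ih => exact e.elim fun e => triangle v w hvw ih e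

section AddVertex

variable {V : Type u} {G : SimpleGraph V} {N : Set V}

lemma connected_addVertex (hG : G.Connected) {v : V} (hv : v ∈ N) :
    (addVertex G N).Connected := by
  have hsome : ∀ {x y : V}, G.Reachable x y → (addVertex G N).Reachable (some x) (some y) := by
    rintro x y ⟨p⟩
    induction p with
    | nil => exact SimpleGraph.Reachable.refl _
    | @cons a b c h _ ih =>
      have h' : (addVertex G N).Adj (some a) (some b) := h
      exact h'.reachable.trans ih
  have hnone : (addVertex G N).Adj none (some v) := hv
  have key : ∀ x, (addVertex G N).Reachable (some v) x := by
    rintro (_ | x)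
    · exact hnone.symm.reachable
    · exact hsome (hG.preconnected v x)
  rw [SimpleGraph.connected_iff]
  exact ⟨fun x y => (key x).symm.trans (key y), ⟨none⟩⟩

lemma nonempty_embedding_of_none_notMem {V' : Type*} {H : SimpleGraph V'}
    (f : H ↪g addVertex G N) (hf : ∀ i, f i ≠ none) : Nonempty (H ↪g G) := by
  choose g hg using fun i => Option.ne_none_iff_exists'.mp (hf i)
  refine ⟨⟨⟨g, fun i j hij => f.injective (by rw [hg, hg, hij])⟩, fun {i j} => ?_⟩⟩
  rw [← f.map_adj_iff, hg, hg]
  rfl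

lemma addVertex_adj_none_iff {x : Option V} :
    (addVertex G N).Adj none x ↔ ∃ a ∈ N, x = some a := by
  rcases x with _ | a
  · exact ⟨fun h => h.elim, fun ⟨_, _, h⟩ => (Option.some_ne_none _ h.symm).elim⟩
  · exact ⟨fun h => ⟨a, h, rfl⟩, fun ⟨b, hb, h⟩ => by
      obtain rfl := Option.some_injective _ h
      exact hb⟩

/-- An induced cycle of length at least four cannot pass through a vertex whose neighbours form a
clique. -/
lemma IsChordal.addVertex (hG : IsChordal G) (hN : G.IsClique N) :
    IsChordal (TypeDefect.addVertex G N) := by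
  refine fun m hm => ⟨fun f => ?_⟩
  by_cases hf : ∀ i, f i ≠ none
  · obtain ⟨g⟩ := nonempty_embedding_of_none_notMem f hf
    exact (hG m hm).false g
  push Not at hf
  obtain ⟨i, hi⟩ := hf
  have hi' := i.isLt
  -- two non-adjacent neighbours of `i` on the cycle
  obtain ⟨a, b, hia, hib, hab, hnab⟩ : ∃ a b, (SimpleGraph.cycleGraph m).Adj i a ∧
      (SimpleGraph.cycleGraph m).Adj i b ∧ a ≠ b ∧ ¬ (SimpleGraph.cycleGraph m).Adj a b := by
    have key : ∃ a b : ℕ, a < m ∧ b < m ∧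
        (i.val + 1 = a ∨ a + 1 = i.val ∨ (i.val = 0 ∧ a + 1 = m) ∨ (a = 0 ∧ i.val + 1 = m)) ∧
        (i.val + 1 = b ∨ b + 1 = i.val ∨ (i.val = 0 ∧ b + 1 = m) ∨ (b = 0 ∧ i.val + 1 = m)) ∧
        a ≠ b ∧ ¬ (a + 1 = b ∨ b + 1 = a ∨ (a = 0 ∧ b + 1 = m) ∨ (b = 0 ∧ a + 1 = m)) := by
      rcases Nat.eq_zero_or_pos i.val with h0 | h0
      · exact ⟨1, m - 1, by omega, by omega, by omega, by omega, by omega, by omega⟩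
      rcases Nat.lt_or_ge (i.val + 1) m with h1 | h1
      · exact ⟨i.val + 1, i.val - 1, by omega, by omega, by omega, by omega, by omega, by omega⟩
      · exact ⟨0, i.val - 1, by omega, by omega, by omega, by omega, by omega, by omega⟩
    obtain ⟨a, b, ha, hb, hia, hib, hab, hnab⟩ := key
    simp only [cycleGraph_adj_iff_val (show 2 ≤ m by omega), ne_eq, Fin.ext_iff]
    exact ⟨⟨a, ha⟩, ⟨b, hb⟩, hia, hib, hab, hnab⟩
  rw [← f.map_adj_iff, hi, addVertex_adj_none_iff] at hia hib
  obtain ⟨x, hx, hxa⟩ := hia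
  obtain ⟨y, hy, hyb⟩ := hib
  refine hnab ?_
  rw [← f.map_adj_iff, hxa, hyb]
  refine hN hx hy ?_
  rintro rfl
  exact hab (f.injective (hxa.trans hyb.symm))

lemma cliqueFree_four_addVertex (hG : G.CliqueFree 4) (v w : V) :
    (addVertex G {v, w}).CliqueFree 4 := by
  by_contra hcf
  have f := SimpleGraph.topEmbeddingOfNotCliqueFree hcf
  by_cases hf : ∀ i, f i ≠ none
  · obtain ⟨g⟩ := nonempty_embedding_of_none_notMem f hf
    exact g.isContained.not_cliqueFree hG
  push Not at hf
  obtain ⟨i, hi⟩ := hf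
  have hnb : ∀ j, j ≠ i → f j = some v ∨ f j = some w := by
    intro j hj
    have h1 : (addVertex G {v, w}).Adj (f i) (f j) := f.map_adj_iff.mpr hj.symm
    rw [hi, addVertex_adj_none_iff] at h1
    obtain ⟨a, rfl | rfl, ha⟩ := h1
    · exact Or.inl ha
    · exact Or.inr ha
  have h1 : i + 1 ≠ i := by
    have : ∀ i : Fin 4, i + 1 ≠ i := by decide
    exact this i
  have h2 : i + 2 ≠ i := by
    have : ∀ i : Fin 4, i + 2 ≠ i := by decide
    exact this i
  have h3 : i + 3 ≠ i := by
    have : ∀ i : Fin 4, i + 3 ≠ i := by decide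
    exact this i
  have h12 : i + 1 ≠ i + 2 := by
    have : ∀ i : Fin 4, i + 1 ≠ i + 2 := by decide
    exact this i
  have h13 : i + 1 ≠ i + 3 := by
    have : ∀ i : Fin 4, i + 1 ≠ i + 3 := by decide
    exact this i
  have h23 : i + 2 ≠ i + 3 := by
    have : ∀ i : Fin 4, i + 2 ≠ i + 3 := by decide
    exact this i
  have hinj : ∀ {a b : Fin 4} {t : Option V}, a ≠ b → f a = t → f b = t → False :=
    fun hab ha hb => hab (f.injective (ha.trans hb.symm))
  rcases hnb _ h1 with e1 | e1 <;> rcases hnb _ h2 with e2 | e2 <;> rcases hnb _ h3 with e3 | e3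
  · exact hinj h12 e1 e2
  · exact hinj h12 e1 e2
  · exact hinj h13 e1 e3
  · exact hinj h23 e2 e3
  · exact hinj h23 e2 e3
  · exact hinj h13 e1 e3
  · exact hinj h12 e1 e2
  · exact hinj h12 e1 e2

end AddVertex

lemma IsTreeish.isChordal_and_cliqueFree {V : Type u} {G : SimpleGraph V} (h : IsTreeish G) :
    IsChordal G ∧ G.CliqueFree 4 := by
  have hiso : ∀ {V V' : Type u} {G : SimpleGraph V} {G' : SimpleGraph V'}, (G' ≃g G) →
      IsChordal G → G.CliqueFree 4 → IsChordal G' ∧ G'.CliqueFree 4 := fun e h1 h2 =>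
    ⟨h1.of_embedding e.toEmbedding, h2.comap e.toEmbedding.isContained⟩
  refine IsTreeish.induction_from_vertex
    (Q := fun {V} (G : SimpleGraph V) => IsChordal G ∧ G.CliqueFree 4) ?_ ?_ ?_ h
  · constructor
    · refine fun m hm => ⟨fun f => ?_⟩
      have := f.injective (a₁ := ⟨0, by omega⟩) (a₂ := ⟨1, by omega⟩) (Subsingleton.elim _ _)
      simp at this
    · exact SimpleGraph.cliqueFree_of_card_lt (by simp)
  · rintro V V' G G' v ⟨h1, h2⟩ e
    refine hiso e (h1.addVertex (by simp)) ?_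
    have := cliqueFree_four_addVertex h2 v v
    rwa [Set.pair_eq_singleton] at this
  · rintro V V' G G' v w hvw ⟨h1, h2⟩ e
    refine hiso e (h1.addVertex ?_) (cliqueFree_four_addVertex h2 v w)
    rw [SimpleGraph.isClique_iff, Set.pairwise_pair]
    exact fun _ => ⟨hvw, hvw.symm⟩

/-- Each extension step adds one vertex and three dimensions; connectedness is carried along, since
the dimension formulas need it. -/
lemma IsTreeish.finrank_localCochains {V : Type u} {G : SimpleGraph V} (h : IsTreeish G)
    (k : Type v) [Field k] :
    Module.finrank k (localCochains G k) + 3 = 3 * Nat.card V := by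
  suffices hs : Finite V ∧ G.Connected ∧
      Module.finrank k (localCochains G k) + 3 = 3 * Nat.card V from hs.2.2
  have hcard : ∀ {V V' : Type u} [Finite V], (V' ≃ Option V) → Nat.card V' = Nat.card V + 1 :=
    fun e => by rw [Nat.card_congr e, Finite.card_option]
  refine IsTreeish.induction_from_vertex (Q := fun {V} (G : SimpleGraph V) => Finite V ∧
    G.Connected ∧ Module.finrank k (localCochains G k) + 3 = 3 * Nat.card V) ?_ ?_ ?_ h
  · refine ⟨inferInstance, SimpleGraph.connected_top, ?_⟩
    rw [finrank_localCochains_of_subsingleton]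
    simp
  · rintro V V' G G' v ⟨hfin, hcon, hdim⟩ e
    refine ⟨Finite.of_equiv _ e.toEquiv.symm,
      e.connected_iff.mpr (connected_addVertex hcon (Set.mem_singleton v)), ?_⟩
    rw [finrank_localCochains_congr k e, finrank_localCochains_addPendant hcon, hcard e.toEquiv]
    omega
  · rintro V V' G G' v w hvw ⟨hfin, hcon, hdim⟩ e
    refine ⟨Finite.of_equiv _ e.toEquiv.symm,
      e.connected_iff.mpr (connected_addVertex hcon (Set.mem_insert v _)), ?_⟩
    rw [finrank_localCochains_congr k e, finrank_localCochains_addTriangle hcon hvw,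
      hcard e.toEquiv]
    omega

/-- The graph `G - z`. -/
def deleteVertex {V : Type u} (G : SimpleGraph V) (z : V) : SimpleGraph {y // y ≠ z} :=
  G.comap Subtype.val

lemma nonempty_iso_addVertex_deleteVertex {V : Type u} (G : SimpleGraph V) (z : V) :
    Nonempty (G ≃g addVertex (deleteVertex G z) {y | G.Adj z y.1}) := by
  classical
  refine ⟨SimpleGraph.Iso.symm ⟨Equiv.optionSubtypeNe z, ?_⟩⟩
  rintro (_ | a) (_ | b)
  · simp only [Equiv.optionSubtypeNe_none, SimpleGraph.irrefl]
  · simp only [Equiv.optionSubtypeNe_none, Equiv.optionSubtypeNe_some]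
    rfl
  · simp only [Equiv.optionSubtypeNe_none, Equiv.optionSubtypeNe_some, G.adj_comm a.1 z]
    rfl
  · simp only [Equiv.optionSubtypeNe_some]
    rfl

/-- Deleting a simplicial vertex of positive degree keeps a graph connected: a path through `z` can
be shortened. -/
lemma connected_deleteVertex {V : Type u} {G : SimpleGraph V} (hG : G.Connected) {z n : V}
    (hz : ∀ a b, G.Adj z a → G.Adj z b → a ≠ b → G.Adj a b) (hn : G.Adj z n) :
    (deleteVertex G z).Connected := by
  classical
  -- the retraction of `G` onto `G - z` that sends `z` to its neighbour `n`
  let r : V → {y // y ≠ z} := fun u => if h : u = z then ⟨n, hn.ne.symm⟩ else ⟨u, h⟩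
  have hr : ∀ u : {y // y ≠ z}, r u.1 = u := fun u => dif_neg u.2
  have hrz : r z = ⟨n, hn.ne.symm⟩ := dif_pos rfl
  have hnb : ∀ a, G.Adj z a → (deleteVertex G z).Reachable (r z) (r a) := by
    intro a ha
    have hra : r a = ⟨a, ha.ne.symm⟩ := dif_neg ha.ne.symm
    rw [hrz, hra]
    by_cases h : n = a
    · subst h; exact SimpleGraph.Reachable.refl _
    · have : (deleteVertex G z).Adj ⟨n, hn.ne.symm⟩ ⟨a, ha.ne.symm⟩ := hz n a hn ha h
      exact this.reachable
  have hstep : ∀ a b, G.Adj a b → (deleteVertex G z).Reachable (r a) (r b) := by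
    intro a b hab
    by_cases ha : a = z
    · subst ha; exact hnb b hab
    by_cases hb : b = z
    · subst hb; exact (hnb a hab.symm).symm
    have hra : r a = ⟨a, ha⟩ := dif_neg ha
    have hrb : r b = ⟨b, hb⟩ := dif_neg hb
    rw [hra, hrb]
    have : (deleteVertex G z).Adj ⟨a, ha⟩ ⟨b, hb⟩ := hab
    exact this.reachable
  rw [SimpleGraph.connected_iff]
  have hwalk : ∀ a b, G.Reachable a b → (deleteVertex G z).Reachable (r a) (r b) := by
    rintro a b ⟨p⟩
    induction p with
    | nil => exact SimpleGraph.Reachable.refl _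
    | cons h _ ih => exact (hstep _ _ h).trans ih
  refine ⟨fun x y => ?_, ⟨⟨n, hn.ne.symm⟩⟩⟩
  rw [← hr x, ← hr y]
  exact hwalk _ _ (hG.preconnected x.1 y.1)

/-- Induction on the number of vertices: a simplicial vertex of a connected graph without `K₄` has
one neighbour, or two adjacent ones. -/
theorem isTreeish_of_isChordal (n : ℕ) : ∀ {V : Type u} [Fintype V] {G : SimpleGraph V},
    Fintype.card V = n + 2 → G.Connected → IsChordal G → G.CliqueFree 4 → IsTreeish G := by
  classical
  induction n with
  | zero =>
    intro V _ G hV hG _ _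
    obtain ⟨a, b, hab⟩ := exists_adj_of_connected hG (by omega)
    have htop : G = ⊤ := by
      rw [SimpleGraph.eq_top_iff_forall_ne_adj]
      intro x y hxy
      have huniv : ({a, b} : Finset V) = Finset.univ :=
        Finset.eq_univ_of_card _ (by rw [Finset.card_pair hab.ne]; omega)
      have hx : x ∈ ({a, b} : Finset V) := by rw [huniv]; exact Finset.mem_univ x
      have hy : y ∈ ({a, b} : Finset V) := by rw [huniv]; exact Finset.mem_univ y
      simp only [Finset.mem_insert, Finset.mem_singleton] at hx hy
      rcases hx with rfl | rfl <;> rcases hy with rfl | rfl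
      · exact absurd rfl hxy
      · exact hab
      · exact hab.symm
      · exact absurd rfl hxy
    subst htop
    exact IsTreeish.edge ((exists_iso_top_fin 2 hV).map SimpleGraph.Iso.symm)
  | succ n ih =>
    intro V _ G hV hG hch hcf
    obtain ⟨v₀⟩ := hG.nonempty
    obtain ⟨z, -, hz⟩ := hch.exists_isSimplicialIn (W := Finset.univ) ⟨v₀, Finset.mem_univ v₀⟩
    have hz' : ∀ a b, G.Adj z a → G.Adj z b → a ≠ b → G.Adj a b :=
      fun a b => hz a (Finset.mem_univ a) b (Finset.mem_univ b)
    obtain ⟨v, hv⟩ : ∃ v, G.Adj z v := by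
      obtain ⟨y, hy⟩ := Fintype.exists_ne_of_one_lt_card (show 1 < Fintype.card V by omega) z
      obtain ⟨p⟩ := hG.preconnected z y
      cases p with
      | nil => exact absurd rfl hy
      | cons h _ => exact ⟨_, h⟩
    have hemb : deleteVertex G z ↪g G :=
      SimpleGraph.Embedding.comap ⟨Subtype.val, Subtype.val_injective⟩ G
    have htree : IsTreeish (deleteVertex G z) := by
      refine ih ?_ (connected_deleteVertex hG hz' hv) (hch.of_embedding hemb)
        (hcf.comap hemb.isContained)
      rw [Fintype.card_subtype_compl, Fintype.card_subtype_eq]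
      omega
    have hiso := nonempty_iso_addVertex_deleteVertex G z
    by_cases hex : ∃ w, G.Adj z w ∧ w ≠ v
    · obtain ⟨w, hw, hwv⟩ := hex
      have hN : {y : {y // y ≠ z} | G.Adj z y.1} =
          {⟨v, hv.ne.symm⟩, ⟨w, hw.ne.symm⟩} := by
        ext ⟨x, hx⟩
        simp only [Set.mem_insert_iff, Set.mem_singleton_iff, Subtype.mk.injEq]
        constructor
        · intro hzx
          by_contra! hne
          have hzx' : G.Adj z x := hzx
          have h3 : G.IsNClique 3 {v, w, x} := SimpleGraph.is3Clique_triple_iff.mpr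
            ⟨hz' v w hv hw hwv.symm, hz' v x hv hzx' hne.1.symm, hz' w x hw hzx' hne.2.symm⟩
          -- a third neighbour `x` of `z` would give the clique `{z, v, w, x}`
          refine hcf _ (h3.insert (a := z) ?_)
          intro b hb
          simp only [Finset.mem_insert, Finset.mem_singleton] at hb
          rcases hb with rfl | rfl | rfl <;> assumption
        · rintro (rfl | rfl)
          · exact hv
          · exact hw
      rw [hN] at hiso
      have hadj : (deleteVertex G z).Adj ⟨v, hv.ne.symm⟩ ⟨w, hw.ne.symm⟩ := hz' v w hv hw hwv.symm
      exact IsTreeish.addTriangle htree _ _ hadj hiso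
    · push Not at hex
      have hN : {y : {y // y ≠ z} | G.Adj z y.1} = {⟨v, hv.ne.symm⟩} := by
        ext ⟨x, hx⟩
        simp only [Set.mem_singleton_iff, Subtype.mk.injEq]
        exact ⟨fun h => hex x h, by rintro rfl; exact hv⟩
      rw [hN] at hiso
      exact IsTreeish.addPendant htree _ hiso

end Treeish

/-! ### Vanishing type defects and chordality -/

section DefectZero

lemma connectedInducedDefectZero_of_isChordal {V : Type u} {G : SimpleGraph V}
    (k : Type v) [Field k] (hch : IsChordal G) (hcf : G.CliqueFree 4) :
    ConnectedInducedDefectZero k G := by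
  intro W hcon
  rcases Nat.lt_or_ge (Fintype.card (W : Set V)) 3 with h | h
  · exact typeDefect_graphComplex_of_card_le_two k hcon (by omega)
  · rw [typeDefect_graphComplex_eq_zero_iff k hcon h, ← Nat.card_eq_fintype_card]
    obtain ⟨n, hn⟩ := Nat.exists_eq_add_of_le' h
    have f : G.induce (W : Set V) ↪g G := SimpleGraph.Embedding.induce _
    exact (isTreeish_of_isChordal (n + 1) hn hcon (hch.of_embedding f)
      (hcf.comap f.isContained)).finrank_localCochains k

variable {V : Type u} [Fintype V] {G : SimpleGraph V} {k : Type v} [Field k]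

/-- The type defect condition on an induced copy of `H` in `G`, expressed on `H`. -/
lemma ConnectedInducedDefectZero.finrank_of_embedding (h : ConnectedInducedDefectZero k G)
    {m : ℕ} (hm : 3 ≤ m) {H : SimpleGraph (Fin m)} (hH : H.Connected) (f : H ↪g G) :
    Module.finrank k (localCochains H k) + 3 = 3 * m := by
  classical
  have e : H ≃g G.induce ((Finset.univ.image f : Finset V) : Set V) := by
    rw [Finset.coe_image, Finset.coe_univ, Set.image_univ]
    exact f.isoInduceRange
  have hcard : Fintype.card ((Finset.univ.image f : Finset V) : Set V) = m := by
    rw [← Fintype.card_congr e.toEquiv, Fintype.card_fin]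
  have hcon := e.connected_iff.mp hH
  have h1 := h _ hcon
  have h2 := (typeDefect_graphComplex_eq_zero_iff k hcon (hm.trans hcard.ge)).mp h1
  rw [finrank_localCochains_congr k e, h2, hcard]

/-- For a cycle of length `m ≥ 4` the dimension is at most `2 m < 3 m - 3`, and for `K₄` it is at
least `10 > 9`. -/
lemma ConnectedInducedDefectZero.isChordal_and_cliqueFree (h : ConnectedInducedDefectZero k G) :
    IsChordal G ∧ G.CliqueFree 4 := by
  constructor
  · refine fun m hm => ⟨fun f => ?_⟩
    have hcon : (SimpleGraph.cycleGraph m).Connected := by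
      obtain ⟨n, rfl⟩ := Nat.exists_eq_add_of_le' (show 1 ≤ m by omega)
      exact SimpleGraph.cycleGraph_connected
    have h1 := h.finrank_of_embedding (by omega) hcon f
    have h2 := finrank_localCochains_cycleGraph_le (k := k) m hm
    omega
  · by_contra hcf
    have f : (⊤ : SimpleGraph (Fin 4)) ↪g G := SimpleGraph.topEmbeddingOfNotCliqueFree hcf
    have h1 : Module.finrank k (localCochains (⊤ : SimpleGraph (Fin 4)) k) + 3 = 3 * 4 :=
      h.finrank_of_embedding (by omega) SimpleGraph.connected_top f
    have h2 := le_finrank_localCochains_top (k := k)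
    omega

end DefectZero

/-! ### First homology as the cycle space -/

section CycleSpace

/-- A graph has no two-dimensional faces. -/
lemma simplicialChains_graphComplex_three {V : Type u} {G : SimpleGraph V} {k : Type v} [Field k] :
    simplicialChains k (graphComplex G) 3 = ⊥ := by
  rw [eq_bot_iff]
  intro f hf
  rw [Submodule.mem_bot]
  funext x
  by_contra hx
  classical
  have hinj : Function.Injective x := by
    by_contra h
    exact hx (hf.1.1 x h)
  have hface := hf.2 x hx (Finset.univ.image x) (by simp) (by simp)
  have h3 : (Finset.univ.image x).card = 3 := by
    rw [Finset.card_image_of_injective _ hinj, Finset.card_univ, Fintype.card_fin]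
  have h2 : (Finset.univ.image x).card ≤ 2 := hface.2.1
  omega

variable {V : Type u} [Fintype V] (G : SimpleGraph V) (k : Type v) [Field k]

/-- The cycle space of a graph: antisymmetric weights on the oriented edges whose sum over the
edges into each vertex vanishes. -/
def cycleSpace : Submodule k (V → V → k) where
  carrier := {f | (∀ u w, f u w = -f w u) ∧ (∀ u w, ¬ G.Adj u w → f u w = 0) ∧
    ∀ x, ∑ w, f w x = 0}
  zero_mem' := ⟨fun _ _ => by simp, fun _ _ _ => rfl, fun _ => by simp⟩
  add_mem' := fun {f g} hf hg => ⟨fun u w => by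
      rw [Pi.add_apply, Pi.add_apply, hf.1, hg.1, Pi.add_apply, Pi.add_apply]; ring,
    fun u w h => by rw [Pi.add_apply, Pi.add_apply, hf.2.1 u w h, hg.2.1 u w h, add_zero],
    fun x => by simp [Finset.sum_add_distrib, hf.2.2 x, hg.2.2 x]⟩
  smul_mem' := fun a f hf => ⟨fun u w => by
      rw [Pi.smul_apply, Pi.smul_apply, hf.1, smul_neg]; rfl,
    fun u w h => by rw [Pi.smul_apply, Pi.smul_apply, hf.2.1 u w h, smul_zero],
    fun x => by simp [← Finset.mul_sum, hf.2.2 x]⟩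

variable {G k}

lemma mem_cycleSpace_of_mem_reducedCycles {f : (Fin 2 → V) → k}
    (hf : f ∈ reducedCycles k (graphComplex G) 1) : (fun u w => f ![u, w]) ∈ cycleSpace G k := by
  obtain ⟨⟨⟨hinj, hsign⟩, hface⟩, hker⟩ := hf
  refine ⟨fun u w => ?_, fun u w h => ?_, fun x => ?_⟩
  · have h := hsign (Equiv.swap 0 1) ![w, u]
    have h2 : ![w, u] ∘ (Equiv.swap 0 1 : Equiv.Perm (Fin 2)) = ![u, w] := by
      funext i
      fin_cases i <;> rfl
    rw [h2, Equiv.Perm.sign_swap (by decide)] at h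
    simpa using h
  · by_contra hne
    classical
    have huw : u ≠ w := by
      rintro rfl
      exact hne (hinj _ fun h => absurd (h (show ![u, u] 0 = ![u, u] 1 from rfl)) (by decide))
    have h2 := hface _ hne {u, w} (by simp) (by simp [Set.pair_comm])
    exact h (h2.2.2 (by simp) (by simp) huw)
  · exact congrFun hker ![x]

lemma mem_reducedCycles_of_mem_cycleSpace {g : V → V → k} (hg : g ∈ cycleSpace G k) :
    (fun x : Fin 2 → V => g (x 0) (x 1)) ∈ reducedCycles k (graphComplex G) 1 := by
  refine ⟨⟨⟨fun x hx => ?_, fun σ x => ?_⟩, fun x hx s hs hsx => ?_⟩, ?_⟩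
  · refine hg.2.1 _ _ fun h => hx fun i j hij => ?_
    fin_cases i <;> fin_cases j
    · rfl
    · exact absurd hij h.ne
    · exact absurd hij h.ne.symm
    · rfl
  · have hσ : ∀ σ : Equiv.Perm (Fin 2), σ = 1 ∨ σ = Equiv.swap 0 1 := by decide
    rcases hσ σ with rfl | rfl
    · simp
    · rw [Equiv.Perm.sign_swap (by decide)]
      simpa using hg.1 (x 1) (x 0)
  · have hadj : G.Adj (x 0) (x 1) := by
      by_contra h
      exact hx (hg.2.1 _ _ h)
    classical
    have hs' : s = {x 0, x 1} := by
      rw [← Finset.coe_inj, hsx]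
      ext y
      simp [Fin.exists_fin_two, eq_comm]
    subst hs'
    refine ⟨hs, Finset.card_le_two, ?_⟩
    rw [Finset.coe_pair, SimpleGraph.isClique_iff, Set.pairwise_pair]
    exact fun _ => ⟨hadj, hadj.symm⟩
  · refine LinearMap.mem_ker.mpr (funext fun x => ?_)
    exact hg.2.2 (x 0)

variable (G k) in
lemma finrank_reducedHomology_one : Module.finrank k (ReducedHomology k (graphComplex G) 1) =
    Module.finrank k (cycleSpace G k) := by
  have hbot : (reducedBoundaries k (graphComplex G) 1).submoduleOf
      (reducedCycles k (graphComplex G) 1) = ⊥ := by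
    rw [reducedBoundaries, simplicialChains_graphComplex_three, Submodule.map_bot]
    exact Submodule.comap_bot _ |>.trans (Submodule.ker_subtype _)
  rw [(Submodule.quotEquivOfEqBot _ hbot).finrank_eq]
  exact LinearEquiv.finrank_eq
    { toFun := fun f => ⟨fun u w => f.1 ![u, w], mem_cycleSpace_of_mem_reducedCycles f.2⟩
      invFun := fun g => ⟨fun x => g.1 (x 0) (x 1), mem_reducedCycles_of_mem_cycleSpace g.2⟩
      map_add' := fun _ _ => rfl
      map_smul' := fun _ _ => rfl
      left_inv := fun f => Subtype.ext <| funext fun x => congrArg f.1 <| by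
        funext i
        fin_cases i <;> rfl
      right_inv := fun _ => rfl }

end CycleSpace

/-! ### Removing the edges at a simplicial vertex -/

section Isolate

variable {V : Type u} {G : SimpleGraph V} {z : V}

variable (G z) in
/-- The graph obtained from `G` by removing all edges at `z`, keeping the vertex `z`. -/
abbrev isolate : SimpleGraph V := restrictTo G {z}ᶜ

lemma isChordal_isolate (hG : IsChordal G) (z : V) : IsChordal (isolate G z) := by
  refine fun m hm => ⟨fun f => ?_⟩
  have hf : ∀ i, f i ≠ z := by
    intro i
    have hi := i.isLt
    obtain ⟨j, hj⟩ : ∃ j, (SimpleGraph.cycleGraph m).Adj i j := by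
      simp only [cycleGraph_adj_iff_val (show 2 ≤ m by omega)]
      rcases Nat.lt_or_ge (i.val + 1) m with h | h
      · exact ⟨⟨i.val + 1, h⟩, Or.inl rfl⟩
      · exact ⟨⟨0, by omega⟩, Or.inr (Or.inr (Or.inr ⟨rfl, by omega⟩))⟩
    exact (f.map_adj_iff.mpr hj).2.1
  exact (hG m hm).false ⟨f.toEmbedding, fun {i j} =>
    ⟨fun h => f.map_adj_iff.mp ⟨h, hf i, hf j⟩, fun h => (f.map_adj_iff.mpr h).1⟩⟩

lemma isNClique_isolate_iff {n : ℕ} (hn : 2 ≤ n) {s : Finset V} :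
    (isolate G z).IsNClique n s ↔ G.IsNClique n s ∧ z ∉ s := by
  constructor
  · intro h
    refine ⟨⟨h.isClique.mono (show isolate G z ≤ G from fun _ _ h => h.1), h.card_eq⟩, fun hz => ?_⟩
    obtain ⟨y, hy, hyz⟩ := Finset.exists_mem_ne (show 1 < s.card by rw [h.card_eq]; omega) z
    exact (h.isClique hz hy hyz.symm).2.1 rfl
  · rintro ⟨h, hz⟩
    refine ⟨fun a ha b hb hab => ⟨h.isClique ha hb hab, ?_, ?_⟩, h.card_eq⟩
    · rintro rfl
      exact hz ha
    · rintro rfl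
      exact hz hb

variable [Fintype V] [DecidableEq V] [DecidableRel G.Adj]

/-- If the neighbours of `z` form a clique, then the cliques through `z` are the sets of neighbours
of `z` with `z` added. -/
lemma isNClique_and_mem_iff (hz : G.IsClique (G.neighborSet z)) {n : ℕ} {s : Finset V} :
    G.IsNClique (n + 1) s ∧ z ∈ s ↔
      ∃ T ∈ (G.neighborFinset z).powersetCard n, insert z T = s := by
  constructor
  · rintro ⟨h, hzs⟩
    refine ⟨s.erase z, Finset.mem_powersetCard.mpr ⟨fun y hy => ?_, ?_⟩, Finset.insert_erase hzs⟩
    · rw [Finset.mem_erase] at hy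
      exact (G.mem_neighborFinset z y).mpr (h.isClique hzs hy.2 hy.1.symm)
    · rw [Finset.card_erase_of_mem hzs, h.card_eq, Nat.add_sub_cancel]
  · rintro ⟨T, hT, rfl⟩
    rw [Finset.mem_powersetCard] at hT
    have hadj : ∀ b ∈ T, G.Adj z b := fun b hb => (G.mem_neighborFinset z b).mp (hT.1 hb)
    have hTc : G.IsNClique n T := ⟨hz.subset fun b hb => hadj b hb, hT.2⟩
    exact ⟨hTc.insert hadj, Finset.mem_insert_self z T⟩

/-- The triangles through a simplicial vertex `z` are the pairs of neighbours of `z`. -/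
lemma numTriangles_eq_add_choose (hz : G.IsClique (G.neighborSet z)) :
    numTriangles G = numTriangles (isolate G z) + (G.degree z).choose 2 := by
  have hsplit : {s : Finset V | G.IsNClique 3 s} = {s | (isolate G z).IsNClique 3 s} ∪
      insert z '' ((G.neighborFinset z).powersetCard 2 : Set (Finset V)) := by
    ext s
    simp only [Set.mem_union, Set.mem_ofPred_eq, isNClique_isolate_iff (show 2 ≤ 3 by omega),
      Set.mem_image, Finset.mem_coe, ← isNClique_and_mem_iff hz]
    tauto
  have hdisj : Disjoint {s | (isolate G z).IsNClique 3 s}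
      (insert z '' ((G.neighborFinset z).powersetCard 2 : Set (Finset V))) := by
    rw [Set.disjoint_left]
    rintro _ hs ⟨T, -, rfl⟩
    exact ((isNClique_isolate_iff (by omega)).mp hs).2 (Finset.mem_insert_self z T)
  have hinj : Set.InjOn (insert z)
      ((G.neighborFinset z).powersetCard 2 : Set (Finset V)) := by
    have hnot : ∀ T ∈ ((G.neighborFinset z).powersetCard 2 : Set (Finset V)), z ∉ T := by
      intro T hT hzT
      have := (Finset.mem_powersetCard.mp hT).1 hzT
      exact G.notMem_neighborFinset_self z this
    intro S hS T hT h
    rw [← Finset.erase_insert (hnot S hS), h, Finset.erase_insert (hnot T hT)]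
  rw [numTriangles, hsplit, Set.ncard_union_eq hdisj (Set.toFinite _) (Set.toFinite _),
    hinj.ncard_image, Set.ncard_coe_finset, Finset.card_powersetCard,
    SimpleGraph.card_neighborFinset_eq_degree, numTriangles]

/-- The `K₄` through a simplicial vertex `z` are the triples of neighbours of `z`. -/
lemma cliqueFree_four_iff (hz : G.IsClique (G.neighborSet z)) :
    G.CliqueFree 4 ↔ (isolate G z).CliqueFree 4 ∧ G.degree z ≤ 2 := by
  constructor
  · intro h
    refine ⟨fun s hs => h s ((isNClique_isolate_iff (by omega)).mp hs).1, ?_⟩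
    by_contra hd
    obtain ⟨T, hT⟩ := Finset.powersetCard_nonempty.mpr
      (show 3 ≤ (G.neighborFinset z).card by
        rw [SimpleGraph.card_neighborFinset_eq_degree]; omega)
    exact h _ ((isNClique_and_mem_iff hz).mpr ⟨T, hT, rfl⟩).1
  · rintro ⟨h, hd⟩ s hs
    by_cases hzs : z ∈ s
    · obtain ⟨T, hT, -⟩ := (isNClique_and_mem_iff hz).mp ⟨hs, hzs⟩
      have := Finset.powersetCard_nonempty.mp ⟨T, hT⟩
      rw [SimpleGraph.card_neighborFinset_eq_degree] at this
      omega
    · exact h s ((isNClique_isolate_iff (by omega)).mpr ⟨hs, hzs⟩)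

variable (k : Type v) [Field k]

/-- The cycles of the graph without the edges at `z` are the cycles vanishing on those edges. -/
lemma mem_cycleSpace_isolate_iff {f : V → V → k} :
    f ∈ cycleSpace (isolate G z) k ↔ f ∈ cycleSpace G k ∧ ∀ u, G.Adj z u → f z u = 0 := by
  constructor
  · intro h
    exact ⟨⟨h.1, fun u w huw => h.2.1 u w fun h' => huw h'.1, h.2.2⟩,
      fun u _ => h.2.1 z u fun h' => h'.2.1 rfl⟩
  · rintro ⟨h, hz⟩
    have hz' : ∀ u, f z u = 0 := fun u => by
      by_cases hu : G.Adj z u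
      · exact hz u hu
      · exact h.2.1 z u hu
    refine ⟨h.1, fun u w huw => ?_, h.2.2⟩
    by_cases hu : u = z
    · rw [hu, hz']
    by_cases hw : w = z
    · rw [hw, h.1, hz', neg_zero]
    · exact h.2.1 u w fun h' => huw ⟨h', hu, hw⟩

variable (G z) in
/-- The values of a cycle on the edges leaving `z`. -/
def cycleSpaceAt : cycleSpace G k →ₗ[k] ({u // G.Adj z u} → k) where
  toFun f u := f.1 z u.1
  map_add' _ _ := rfl
  map_smul' _ _ := rfl

/-- The sum of the values of a function on a finite type, as a linear functional. -/
def sumFunctional (ι : Type*) [Fintype ι] : (ι → k) →ₗ[k] k where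
  toFun φ := ∑ i, φ i
  map_add' φ ψ := Finset.sum_add_distrib
  map_smul' a φ := by simp [Finset.mul_sum]

/-- The values of a cycle on the edges at `z` are constrained only by the cycle condition at `z`,
since any two neighbours of `z` span a triangle with it. -/
lemma range_cycleSpaceAt (hz : G.IsClique (G.neighborSet z)) {n : V} (hn : G.Adj z n) :
    LinearMap.range (cycleSpaceAt G z k) = LinearMap.ker (sumFunctional k {u // G.Adj z u}) := by
  have hext : ∀ ψ : V → k, (∀ u, ¬ G.Adj z u → ψ u = 0) →
      ∑ u : {u // G.Adj z u}, ψ u.1 = ∑ u, ψ u := by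
    intro ψ hψ
    rw [← Fintype.sum_subtype_add_sum_subtype (G.Adj z) ψ,
      Finset.sum_eq_zero (s := Finset.univ) fun u _ => hψ (u : {u // ¬ G.Adj z u}).1 u.2, add_zero]
  ext φ
  rw [LinearMap.mem_ker]
  constructor
  · rintro ⟨f, rfl⟩
    change ∑ u : {u // G.Adj z u}, f.1 z u.1 = 0
    rw [hext _ (f.2.2.1 z), ← neg_eq_zero, ← Finset.sum_neg_distrib, ← f.2.2.2 z]
    exact Finset.sum_congr rfl fun u _ => (f.2.1 u z).symm
  · intro hφ
    let ψ : V → k := fun u => if h : G.Adj z u then φ ⟨u, h⟩ else 0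
    have hψ : ∀ u, ¬ G.Adj z u → ψ u = 0 := fun u h => dif_neg h
    have hψz : ψ z = 0 := hψ z (G.irrefl)
    have hψφ : ∀ u : {u // G.Adj z u}, ψ u.1 = φ u := fun u => dif_pos u.2
    have hsum : ∑ u, ψ u = 0 := by
      rw [← hext ψ hψ, Finset.sum_congr rfl fun u _ => hψφ u]
      exact hφ
    -- the sum of the cycles `z → u → n → z`, weighted by `ψ u`
    let f : V → V → k := fun u w => (if u = z then ψ w else 0) - (if w = z then ψ u else 0) +
      ((if w = n then ψ u else 0) - (if u = n then ψ w else 0))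
    refine ⟨⟨f, fun u w => ?_, fun u w huw => ?_, fun x => ?_⟩, ?_⟩
    · simp only [f]
      ring
    · have h1 : (if u = z then ψ w else 0) = 0 := by
        split_ifs with h
        · exact hψ w (h ▸ huw)
        · rfl
      have h2 : (if w = z then ψ u else 0) = 0 := by
        split_ifs with h
        · exact hψ u fun h' => huw (h ▸ h'.symm)
        · rfl
      simp only [f, h1, h2, sub_zero, zero_add]
      by_cases huw' : u = w
      · rw [huw', sub_self]
      have h3 : (if w = n then ψ u else 0) = 0 := by
        split_ifs with h
        · exact hψ u fun h' => huw (h ▸ hz h' hn (h ▸ huw'))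
        · rfl
      have h4 : (if u = n then ψ w else 0) = 0 := by
        split_ifs with h
        · exact hψ w fun h' => huw (h ▸ hz hn h' (h ▸ huw'))
        · rfl
      rw [h3, h4, sub_zero]
    · have hx : ∀ y : V, ∑ w, (if x = y then ψ w else 0) = 0 := fun y => by
        split_ifs
        · exact hsum
        · exact Finset.sum_const_zero
      simp only [f, Finset.sum_add_distrib, Finset.sum_sub_distrib, hx, Finset.sum_ite_eq',
        Finset.mem_univ, if_true]
      ring
    · funext u
      have hzn : z ≠ n := hn.ne
      have huz : u.1 ≠ z := u.2.ne.symm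
      change f z u.1 = φ u
      simp only [f, hψz, huz, hzn, if_true, if_false, ite_self, hψφ]
      ring

lemma finrank_cycleSpace_add_one (hz : G.IsClique (G.neighborSet z)) {n : V} (hn : G.Adj z n) :
    Module.finrank k (cycleSpace G k) + 1 =
      Module.finrank k (cycleSpace (isolate G z) k) + G.degree z := by
  have h1 := (cycleSpaceAt G z k).finrank_range_add_finrank_ker
  have h2 := (sumFunctional k {u // G.Adj z u}).finrank_range_add_finrank_ker
  have hsurj : LinearMap.range (sumFunctional k {u // G.Adj z u}) = ⊤ := by
    rw [LinearMap.range_eq_top]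
    refine fun a => ⟨Pi.single ⟨n, hn⟩ a, ?_⟩
    exact (Finset.sum_pi_single' (⟨n, hn⟩ : {u // G.Adj z u}) a Finset.univ).trans
      (if_pos (Finset.mem_univ _))
  have hker : Module.finrank k (LinearMap.ker (cycleSpaceAt G z k)) =
      Module.finrank k (cycleSpace (isolate G z) k) := by
    refine LinearEquiv.finrank_eq
      { toFun := fun f => ⟨f.1.1, (mem_cycleSpace_isolate_iff k).mpr
          ⟨f.1.2, fun u hu => congrFun f.2 ⟨u, hu⟩⟩⟩
        invFun := fun f => ⟨⟨f.1, ((mem_cycleSpace_isolate_iff k).mp f.2).1⟩,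
          funext fun u => ((mem_cycleSpace_isolate_iff k).mp f.2).2 u.1 u.2⟩
        map_add' := fun _ _ => rfl
        map_smul' := fun _ _ => rfl
        left_inv := fun _ => rfl
        right_inv := fun _ => rfl }
  have hdeg : Fintype.card {u // G.Adj z u} = G.degree z := by
    rw [← SimpleGraph.card_neighborSet_eq_degree]
    exact Fintype.card_congr (Equiv.refl _)
  rw [hsurj, finrank_top, Module.finrank_self, Module.finrank_fintype_fun_eq_card, hdeg] at h2
  rw [range_cycleSpaceAt k hz hn, hker] at h1
  omega

end Isolate

/-! ### Counting triangles in a chordal graph -/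

section TriangleCount

variable {V : Type u} [Fintype V] (k : Type v) [Field k]

/-- A chordal graph has at least `dim H̃₁` triangles, with equality exactly if it has no `K₄`.
Removing the edges at a simplicial vertex of degree `d ≥ 1` lowers the number of triangles by
`d (d - 1) / 2` and the dimension of the cycle space by `d - 1`; these agree exactly for
`d ≤ 2`. -/
theorem IsChordal.numTriangles_eq_iff {G : SimpleGraph V} (hG : IsChordal G) :
    Module.finrank k (cycleSpace G k) ≤ numTriangles G ∧
      (numTriangles G = Module.finrank k (cycleSpace G k) ↔ G.CliqueFree 4) := by
  classical
  induction G using WellFoundedLT.induction with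
  | ind G ih =>
  -- A simplicial vertex is taken among the non-isolated ones, so that each step removes edges.
  let W : Finset V := {u | ∃ w, G.Adj u w}
  have hW : ∀ {u w}, G.Adj u w → u ∈ W := fun {u w} h =>
    Finset.mem_filter.mpr ⟨Finset.mem_univ u, w, h⟩
  rcases W.eq_empty_or_nonempty with hempty | hne
  · have hno : ∀ u w, ¬ G.Adj u w := fun u w h => by
      have := hW h
      rw [hempty] at this
      exact Finset.notMem_empty u this
    have hcf : ∀ n, 2 ≤ n → G.CliqueFree n := by
      intro n hn s hs
      obtain ⟨a, ha, b, hb, hab⟩ := Finset.one_lt_card.mp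
        (show 1 < s.card by rw [hs.card_eq]; omega)
      exact hno a b (hs.isClique ha hb hab)
    have ht : numTriangles G = 0 := by
      rw [numTriangles, Set.ncard_eq_zero (Set.toFinite _), Set.eq_empty_iff_forall_notMem]
      exact hcf 3 (by omega)
    have hb : Module.finrank k (cycleSpace G k) = 0 := by
      have : cycleSpace G k = ⊥ := by
        rw [eq_bot_iff]
        intro f hf
        exact funext fun u => funext fun w => hf.2.1 u w (hno u w)
      rw [this, finrank_bot]
    rw [ht, hb]
    exact ⟨le_rfl, iff_of_true rfl (hcf 4 (by omega))⟩
  · obtain ⟨z, hzW, hz⟩ := hG.exists_isSimplicialIn hne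
    obtain ⟨n, hn⟩ := (Finset.mem_filter.mp hzW).2
    have hz' : G.IsClique (G.neighborSet z) := fun a ha b hb hab =>
      hz a (hW (SimpleGraph.Adj.symm ha)) b (hW (SimpleGraph.Adj.symm hb)) ha hb hab
    have hlt : isolate G z < G := by
      refine lt_of_le_of_ne (fun _ _ h => h.1) fun h => ?_
      have h2 : (isolate G z).Adj z n := by rwa [h]
      exact h2.2.1 rfl
    obtain ⟨h1, h2⟩ := ih _ hlt (isChordal_isolate hG z)
    have h3 := numTriangles_eq_add_choose hz'
    have h4 := finrank_cycleSpace_add_one k hz' hn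
    rw [cliqueFree_four_iff hz', ← h2]
    have hd : 1 ≤ G.degree z := (G.degree_pos_iff_exists_adj z).mpr ⟨n, hn⟩
    obtain ⟨d, hd⟩ := Nat.exists_eq_add_of_le' hd
    rw [hd] at h3 h4 ⊢
    have hc : (d + 1).choose 2 = d + d.choose 2 := by
      rw [Nat.choose_succ_succ' d 1, Nat.choose_one_right]
    have hzero : d.choose 2 = 0 ↔ d < 2 := Nat.choose_eq_zero_iff
    rw [hc] at h3
    omega

lemma chordalWithTriangleCount_iff (G : SimpleGraph V) :
    ChordalWithTriangleCount k G ↔ IsChordal G ∧ G.CliqueFree 4 := by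
  rw [ChordalWithTriangleCount, finrank_reducedHomology_one]
  exact and_congr_right fun h => (h.numTriangles_eq_iff k).2

end TriangleCount

end TypeDefect

end

theorem mainTheorem6 {V : Type u} [Fintype V] (G : SimpleGraph V) (k : Type v) [Field k] :
    (G.Connected → (∃ a b : V, G.Adj a b) →
      List.TFAE
        [TypeDefect.IsTreeish G,
          TypeDefect.ConnectedInducedDefectZero k G,
          TypeDefect.ChordalWithTriangleCount k G]) ∧
    (TypeDefect.IsTreeish G → TypeDefect.ConnectedInducedDefectZero k G) ∧
    (TypeDefect.ConnectedInducedDefectZero k G ↔ TypeDefect.ChordalWithTriangleCount k G) := by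
  have h12 : TypeDefect.IsTreeish G → TypeDefect.ConnectedInducedDefectZero k G := fun h =>
    TypeDefect.connectedInducedDefectZero_of_isChordal k h.isChordal_and_cliqueFree.1
      h.isChordal_and_cliqueFree.2
  have h23 : TypeDefect.ConnectedInducedDefectZero k G ↔
      TypeDefect.ChordalWithTriangleCount k G := by
    rw [TypeDefect.chordalWithTriangleCount_iff]
    exact ⟨fun h => h.isChordal_and_cliqueFree,
      fun h => TypeDefect.connectedInducedDefectZero_of_isChordal k h.1 h.2⟩
  refine ⟨fun hG hedge => ?_, h12, h23⟩
  have h31 : TypeDefect.ChordalWithTriangleCount k G → TypeDefect.IsTreeish G := by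
    rw [TypeDefect.chordalWithTriangleCount_iff]
    rintro ⟨hch, hcf⟩
    obtain ⟨a, b, hab⟩ := hedge
    have hcard : 1 < Fintype.card V := Fintype.one_lt_card_iff.mpr ⟨a, b, hab.ne⟩
    exact TypeDefect.isTreeish_of_isChordal (Fintype.card V - 2) (by omega) hG hch hcf
  tfae_have 1 → 2 := h12
  tfae_have 2 → 3 := h23.mp
  tfae_have 3 → 1 := h31
  tfae_finish
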